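/- Let $(X,d,\mu)$ be a separable metric space with a Borel measure $\mu$ such that all balls have finite measure and, writing $V_r(x)=V(x,r)=\mu(B(x,r))$ for the measure of the open ball, there are constants $D$ and $n>0$ with $V(x,\lambda r)\le D\lambda^n V(x,r)$ for all $x\in X$, $r>0$, $\lambda\ge 1$. For $E\subseteq X$ let $P_E f=\chi_E f$, and for an operator $T$ defined on $L^2(X)$ (complex-valued functions) let $\|T\|_{p\to q}$ be the supremum of $\|Tf\|_q/\|f\|_p$ over $0\ne f\in L^2(X)\cap L^p(X)$. Let $1\le p<2$, $\sigma_p=\frac1p-\frac12$, $a>[n/2]+1$, $s>n\left(\frac1p-\frac12\right)+\frac12$ and $K>0$. For $\tau>0$, a bounded self-adjoint operator $A$ on $L^2(X)$ is said to satisfy $\mathrm{PVE}^a_{p,2}(\tau)$ with constant $K$ if $$\big\|P_{B(x,\tau)}\,V_\tau^{\sigma_p}\,A\,P_{B(y,\tau)}\big\|_{p\to 2}<K\left(1+\frac{d(x,y)}{\tau}\right)^{-n-a}\qquad\text{for all }x,y\in X,$$ where $V_\tau^{\sigma_p}$ acts by multiplication. Let $H^s(\mathbb R)$ be the Sobolev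 space with norm $\|F\|_{H^s}=\|(I-d^2/dx^2)^{s/2}F\|_{L^2(\mathbb R)}$; since $s>1/2$, each of its elements has a unique bounded continuous representative, and a function $F\in H^s(\mathbb R)$ is always taken to be this representative. Then there is a constant $C>0$, depending only on $(X,d,\mu)$, $n$, $p$, $a$, $s$ and $K$ (in particular not on $\tau$, $A$ or $F$), such that for every $\tau>0$, every bounded self-adjoint operator $A$ on $L^2(X)$ that satisfies $\mathrm{PVE}^a_{p,2}(\tau)$ with constant $K$, and every bounded continuous $F:\mathbb R\to\mathbb C$ with $F\in H^s(\mathbb R)$, $$\|F(A)A\|_{p\to p}\le C\|F\|_{H^s}.$$ If in addition $A\ge 0$ and $\operatorname{supp}F\subset[-1,1]$, then also $$\|F(-\log A)\|_{p\to p}\le C\|F\|_{H^s},$$ where $F(-\log A)$ is the operator $g(A)$ with $g(\lambda)=F(-\log\lambda)$ for $\lambda>0$ and $g(0)=0$. -/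

import Mathlib

open MeasureTheory TemperedDistribution
open scoped ENNReal NNReal SchwartzMap BoundedContinuousFunction

noncomputable section

namespace SpectralMultiplier

variable {X : Type*} [MetricSpace X] [MeasurableSpace X]

/-- Homogeneous type of dimension `n`: balls have finite measure and, for some constant `D`,
`V(x, l * r) ≤ D * l ^ n * V(x, r)` for all `x`, all `r > 0` and all `l ≥ 1`. -/
def IsHomogeneousType (μ : Measure X) (n : ℝ) : Prop :=
  (∀ (x : X) (r : ℝ), μ (Metric.ball x r) < ∞) ∧
  ∃ D : ℝ, ∀ (x : X) (r l : ℝ), 0 < r → 1 ≤ l →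
    μ.real (Metric.ball x (l * r)) ≤ D * l ^ n * μ.real (Metric.ball x r)

/-- The norm `‖T‖_{p → q}` of an operator `T` defined on `L²(X, μ)`: the supremum of
`‖T f‖_q / ‖f‖_p` over `f ∈ L² ∩ L^p`. -/
def opNorm (μ : Measure X) (p q : ℝ≥0∞) (T : Lp ℂ 2 μ → X → ℂ) : ℝ≥0∞ :=
  ⨆ (f : Lp ℂ 2 μ) (_ : MemLp f p μ), eLpNorm (T f) q μ / eLpNorm f p μ

/-- The projection `P_B : f ↦ χ_B f` on `L²(X, μ)`, for the open ball `B = B(y, r)`. -/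
def ballProj [BorelSpace X] (μ : Measure X) (y : X) (r : ℝ) (f : Lp ℂ 2 μ) : Lp ℂ 2 μ :=
  ((Lp.memLp f).indicator (s := Metric.ball y r) measurableSet_ball).toLp _

/-- The operator `P_{B(x,τ)} V_τ^σ A P_{B(y,τ)}`, where `V_τ(z) = μ (B(z,τ))`. -/
def localized [BorelSpace X] (μ : Measure X) (A : Lp ℂ 2 μ →L[ℂ] Lp ℂ 2 μ) (σ τ : ℝ) (x y : X)
    (f : Lp ℂ 2 μ) : X → ℂ :=
  (Metric.ball x τ).indicator
    fun z => ((μ.real (Metric.ball z τ) ^ σ : ℝ) : ℂ) * A (ballProj μ y τ f) z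

/-- The polynomial off-diagonal estimate `PVE^a_{p,2}(τ)`, with constant `K`. -/
def PVE [BorelSpace X] (μ : Measure X) (n a p τ K : ℝ) (A : Lp ℂ 2 μ →L[ℂ] Lp ℂ 2 μ) : Prop :=
  ∀ x y : X, opNorm μ (ENNReal.ofReal p) 2 (localized μ A (1 / p - 1 / 2) τ x y) <
    ENNReal.ofReal (K * (1 + dist x y / τ) ^ (-n - a))

/-- The operator `(I - d²/dx²)^{s/2}` on tempered distributions on `ℝ`. With the normalization
`e^{-2πixξ}` of the Fourier transform it is the multiplier with symbol `(1 + (2πξ)²)^{s/2}`. -/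
def besselOp (s : ℝ) : 𝓢'(ℝ, ℂ) →L[ℂ] 𝓢'(ℝ, ℂ) :=
  fourierMultiplierCLM ℂ fun ξ : ℝ => (((1 + (2 * Real.pi * ξ) ^ 2) ^ (s / 2) : ℝ) : ℂ)

/-- A bounded continuous function as a tempered distribution. -/
def toDistribution (F : ℝ →ᵇ ℂ) : 𝓢'(ℝ, ℂ) :=
  Lp.toTemperedDistribution (F.memLp_top.toLp F : Lp ℂ ∞ (volume : Measure ℝ))

/-- The Sobolev norm `‖F‖_{H^s} = ‖(I - d²/dx²)^{s/2} F‖₂`. The infimum runs over the at most one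
`G ∈ L²` that represents the distribution `(I - d²/dx²)^{s/2} F`; the value is `∞` if there is
none, that is, if `F ∉ H^s`. -/
def sobolevNorm (s : ℝ) (F : ℝ →ᵇ ℂ) : ℝ≥0∞ :=
  ⨅ (G : Lp ℂ 2 (volume : Measure ℝ))
    (_ : besselOp s (toDistribution F) = Lp.toTemperedDistribution G), ‖G‖ₑ

/-- `F(A)` for a self-adjoint `A` and `F` continuous on `ℝ`, by the continuous functional
calculus. The spectrum of `A` is real, so `z.re = z` there. -/
def funcCalc {H : Type*} [NormedAddCommGroup H] [InnerProductSpace ℂ H] [CompleteSpace H]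
    (F : ℝ → ℂ) (A : H →L[ℂ] H) : H →L[ℂ] H :=
  cfc (fun z : ℂ => F z.re) A

/-- The function `l ↦ F(-log l)` for `l > 0`, extended by `0` (for `F` of compact support,
`F(+∞) = 0` is the value that belongs to `l = 0`). -/
def compNegLog (F : ℝ → ℂ) (l : ℝ) : ℂ :=
  if 0 < l then F (-Real.log l) else 0

end SpectralMultiplier

end

/-! Cover `X` by the disjoint measurable cells of a `τ`-net `S`, and let `V_i` be the measure of the
`τ`-ball around the net point `i`. The argument runs in the amalgam space `ℓ^p(L²)` with norm `(∑
V_i^(1-p/2) ‖P_i g‖₂^p)^(1/p)`. By Hölder on cells this norm dominates the `L^p` norm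
(`IsNet.eLpNorm_rpow_le`). By the off-diagonal estimate and Schur's test, `A` maps `L^p` into the
amalgam space (`exists_amalgam_apply_le`). It remains to bound functions of `A` on the amalgam
space.

The heart is the growth bound `‖exp(itA)‖ ≲ (1+|t|)^(n(1/p-1/2))` on that space
(`exists_amalgam_unitaryGroup_le`). The endpoint `p = 2` is unitarity. At the `ℓ¹` endpoint, take an
integer `k` with `n/2 < k < a` and the weight `W = (ρ + d(·,j)/τ)^k`, truncated so as to be bounded,
with `ρ = 1+|t|`. The commutator `[W, A]` is bounded by `C/ρ` relative to `W`
(`exists_commutator_bound`; this needs `k < a`), so by Gronwall `W` grows along the flow at most by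
`exp(C|t|/ρ) ≤ e^C`. Cauchy–Schwarz against `W⁻¹`, whose square is summable against volumes because
`2k > n`, gives growth `(1+|t|)^(n/2)` (`exists_l1_bound`). The three lines theorem interpolates
(`IsOrthDecomp.interpolation`).

Writing `F = 𝓕 g`, one has `F(A)A = ∫ g(ξ) exp(-2πiξA) A dξ` (`funcCalc_fourier`). Minkowski's
inequality bounds its `L^p` norm by the `L¹` norm of `(1+|ξ|)^(n(1/p-1/2)) g`
(`exists_opNorm_fourier_le`), and Cauchy–Schwarz bounds that by the `H^s` norm since `s > n(1/p-1/2)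
+ 1/2`.

For the second estimate, `F(-log l) = G(l) l` with `G(l) = η(l) F(-log l)` and `η` a bump equal to
`1/l` on `[1/e, e]`. It suffices that the transform of `G` has the same weighted `L¹` bound
(`exists_fourier_eq_compNegLog`). For fractional `s` this is done directly: on the shell `|t| ~
2^j`, split `g` at frequency `2^j`, differentiate the low part and use Plancherel on the high part.
-/

noncomputable section

namespace SpectralMultiplier

open scoped FourierTransform

/-! ### Sobolev functions as Fourier integrals with weighted `L²` densities. -/

section Fourier

lemma continuous_fourier_of_integrable {g : ℝ → ℂ} (hg : Integrable g) : Continuous (𝓕 g) :=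
  VectorFourier.fourierIntegral_continuous Real.continuous_fourierChar
    (by exact continuous_inner) hg

lemma integral_fourier_smul_eq_of_integrable {f g : ℝ → ℂ} (hf : Integrable f)
    (hg : Integrable g) : ∫ x, (𝓕 f) x • g x = ∫ x, f x • (𝓕 g) x := by
  have := VectorFourier.integral_fourierIntegral_smul_eq_flip (L := innerₗ ℝ)
    Real.continuous_fourierChar continuous_inner hf hg
  rwa [flip_innerₗ] at this

lemma ae_eq_of_integral_schwartz_eq {f g : ℝ → ℂ} (hf : LocallyIntegrable f)
    (hg : LocallyIntegrable g) (h : ∀ φ : 𝓢(ℝ, ℂ), ∫ x, φ x • f x = ∫ x, φ x • g x) :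
    f =ᵐ[volume] g := by
  refine ae_eq_of_integral_contDiff_smul_eq hf hg fun u hu hc => ?_
  have hc₁ : HasCompactSupport (Complex.ofRealCLM ∘ u) := hc.comp_left rfl
  have hc₂ : ContDiff ℝ (⊤ : ℕ∞) (Complex.ofRealCLM ∘ u) := by fun_prop
  simpa using h (hc₁.toSchwartzMap hc₂)

/-- Plancherel's theorem for functions in `L¹ ∩ L²`. -/
lemma eLpNorm_fourier_eq {g : ℝ → ℂ} (h1 : Integrable g) (h2 : MemLp g 2) :
    eLpNorm (𝓕 g) 2 = eLpNorm g 2 := by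
  set u : Lp ℂ 2 (volume : Measure ℝ) := h2.toLp g with hu
  have hae : (𝓕 u : Lp ℂ 2 (volume : Measure ℝ)) =ᵐ[volume] 𝓕 g := by
    refine ae_eq_of_integral_schwartz_eq ((Lp.memLp _).locallyIntegrable (by norm_num))
      (continuous_fourier_of_integrable h1).locallyIntegrable fun φ => ?_
    have h := congrArg (fun T : 𝓢'(ℝ, ℂ) => T φ) (Lp.fourier_toTemperedDistribution_eq u)
    simp only [TemperedDistribution.fourier_apply, Lp.toTemperedDistribution_apply] at h
    rw [← h, ← integral_fourier_smul_eq_of_integrable φ.integrable h1]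
    refine integral_congr_ae ?_
    filter_upwards [h2.coeFn_toLp] with x hx
    rw [hu, hx, SchwartzMap.fourier_coe]
  rw [← eLpNorm_congr_ae hae, ← eLpNorm_congr_ae h2.coeFn_toLp, ← hu]
  have := Lp.norm_fourier_eq u
  rw [Lp.norm_def, Lp.norm_def] at this
  exact (ENNReal.toReal_eq_toReal_iff' (Lp.eLpNorm_ne_top _) (Lp.eLpNorm_ne_top _)).1 this

lemma continuous_one_add_abs_rpow (r : ℝ) : Continuous fun ξ : ℝ => (1 + |ξ|) ^ r := by
  refine Continuous.rpow_const (by fun_prop) fun ξ => Or.inl ?_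
  positivity

lemma memLp_one_add_abs_rpow {r : ℝ} (hr : 1 / 2 < r) :
    MemLp (fun ξ : ℝ => (1 + |ξ|) ^ (-r)) 2 := by
  rw [memLp_two_iff_integrable_sq (continuous_one_add_abs_rpow _).aestronglyMeasurable]
  have h : Integrable (fun ξ : ℝ => (1 + ‖ξ‖) ^ (-(2 * r))) :=
    integrable_one_add_norm (by simp; linarith)
  refine h.congr (.of_forall fun ξ => ?_)
  simp only [Real.norm_eq_abs]
  rw [← Real.rpow_natCast, ← Real.rpow_mul (by positivity)]
  ring_nf

/-- The weighted `L²` norm `‖(1 + |ξ|)^s g‖₂`. -/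
def weightedNorm (s : ℝ) (g : ℝ → ℂ) : ℝ≥0∞ :=
  eLpNorm (fun ξ : ℝ => (((1 + |ξ|) ^ s : ℝ) : ℂ) * g ξ) 2

/-- Cauchy–Schwarz after writing the weight as `(1+|ξ|)^(-(s-α)) (1+|ξ|)^s`; the first factor is in
`L²` exactly because `s - α > 1/2`. -/
lemma lintegral_weight_le {α s : ℝ} (hs : α + 1 / 2 < s) :
    ∃ C : ℝ≥0, ∀ g : ℝ → ℂ, AEStronglyMeasurable g volume →
      ∫⁻ ξ, ENNReal.ofReal ((1 + |ξ|) ^ α) * ‖g ξ‖ₑ ≤ C * weightedNorm s g := by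
  have hm := memLp_one_add_abs_rpow (r := s - α) (by linarith)
  refine ⟨(eLpNorm (fun ξ : ℝ => (1 + |ξ|) ^ (-(s - α))) 2).toNNReal, fun g hg => ?_⟩
  rw [ENNReal.coe_toNNReal hm.eLpNorm_ne_top, weightedNorm,
    eLpNorm_eq_lintegral_rpow_enorm_toReal (by norm_num) (by norm_num),
    eLpNorm_eq_lintegral_rpow_enorm_toReal (by norm_num) (by norm_num)]
  have hmeas : AEMeasurable (fun ξ : ℝ => ‖(((1 + |ξ|) ^ s : ℝ) : ℂ) * g ξ‖ₑ) volume :=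
    ((Complex.continuous_ofReal.comp (continuous_one_add_abs_rpow s)).aestronglyMeasurable.mul
      hg).enorm
  refine le_trans (le_of_eq ?_) (ENNReal.lintegral_mul_le_Lp_mul_Lq volume
    (by simpa using Real.HolderConjugate.two_two)
    (continuous_one_add_abs_rpow (-(s - α))).aestronglyMeasurable.enorm hmeas)
  refine lintegral_congr fun ξ => ?_
  have hpos : 0 < 1 + |ξ| := by positivity
  rw [Pi.mul_apply, enorm_mul, ← mul_assoc]
  congr 1
  rw [← ofReal_norm (E := ℂ), ← ofReal_norm (E := ℝ), Complex.norm_real,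
    ← ENNReal.ofReal_mul (norm_nonneg _), Real.norm_of_nonneg (by positivity),
    Real.norm_of_nonneg (by positivity), ← Real.rpow_add hpos]
  ring_nf

lemma hasTemperateGrowth_bessel (r : ℝ) :
    (fun ξ : ℝ => (((1 + (2 * Real.pi * ξ) ^ 2) ^ r : ℝ) : ℂ)).HasTemperateGrowth := by
  have h1 := Function.hasTemperateGrowth_one_add_norm_sq_rpow ℝ r
  have h2 : (fun ξ : ℝ => 2 * Real.pi * ξ).HasTemperateGrowth := by fun_prop
  have h3 := h1.comp h2
  have := Function.Complex.hasTemperateGrowth_ofReal.comp h3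
  simpa [Function.comp_def, abs_mul, mul_pow] using this

lemma one_add_abs_rpow_le {s : ℝ} (hs : 0 ≤ s) (ξ : ℝ) :
    (1 + |ξ|) ^ s ≤ 2 ^ (s / 2) * (1 + (2 * Real.pi * ξ) ^ 2) ^ (s / 2) := by
  have h0 : (1 + |ξ|) ^ s = ((1 + |ξ|) ^ 2) ^ (s / 2) := by
    rw [← Real.rpow_natCast, ← Real.rpow_mul (by positivity)]; ring_nf
  rw [h0, ← Real.mul_rpow (by norm_num) (by positivity)]
  refine Real.rpow_le_rpow (by positivity) ?_ (by positivity)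
  have hpi := Real.pi_gt_three
  have h1 : ξ ^ 2 ≤ (2 * Real.pi * ξ) ^ 2 := by
    rw [mul_pow]
    exact le_mul_of_one_le_left (sq_nonneg ξ) (by nlinarith)
  nlinarith [sq_nonneg (1 - |ξ|), sq_abs ξ]

/-- A bounded continuous function in `H^s`, `s > 1/2`, is the Fourier integral of a function with
finite weighted norm. -/
lemma exists_fourier_eq {s : ℝ} (hs : 1 / 2 < s) (F : ℝ →ᵇ ℂ)
    (G : Lp ℂ 2 (volume : Measure ℝ))
    (h : besselOp s (toDistribution F) = Lp.toTemperedDistribution G) :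
    ∃ g : ℝ → ℂ, StronglyMeasurable g ∧ Integrable g ∧ (∀ x, F x = 𝓕 g x) ∧
      weightedNorm s g ≤ ENNReal.ofReal (2 ^ (s / 2)) * ‖G‖ₑ := by
  set m : ℝ → ℂ := fun ξ => (((1 + (2 * Real.pi * ξ) ^ 2) ^ (s / 2) : ℝ) : ℂ) with hm
  set m' : ℝ → ℂ := fun ξ => (((1 + (2 * Real.pi * ξ) ^ 2) ^ (-(s / 2)) : ℝ) : ℂ) with hm'
  have hmt : m.HasTemperateGrowth := hasTemperateGrowth_bessel _
  have hmt' : m'.HasTemperateGrowth := hasTemperateGrowth_bessel _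
  have hmm : ∀ ξ, m ξ * m' ξ = 1 := fun ξ => by
    have : (0 : ℝ) < 1 + (2 * Real.pi * ξ) ^ 2 := by positivity
    simp only [hm, hm']
    rw [← Complex.ofReal_mul, ← Real.rpow_add this]; simp
  set Γ : Lp ℂ 2 (volume : Measure ℝ) := 𝓕 G with hΓ
  set g₀ : ℝ → ℂ := fun ξ => m' ξ * Γ ξ with hg₀
  have hg₀m : StronglyMeasurable g₀ :=
    hmt'.1.continuous.stronglyMeasurable.mul (Lp.stronglyMeasurable Γ)
  have hw : weightedNorm s g₀ ≤ ENNReal.ofReal (2 ^ (s / 2)) * ‖G‖ₑ := by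
    have hGΓ : ‖G‖ₑ = eLpNorm Γ 2 volume := by
      rw [← Lp.enorm_def, ← ofReal_norm, ← ofReal_norm, hΓ, Lp.norm_fourier_eq]
    rw [hGΓ, weightedNorm]
    have := eLpNorm_le_mul_eLpNorm_of_ae_le_mul (f := fun ξ : ℝ => (((1 + |ξ|) ^ s : ℝ) : ℂ) * g₀ ξ)
      (g := Γ) (c := 2 ^ (s / 2)) (μ := volume) (.of_forall fun ξ => ?_) 2
    · exact this
    · have hpos : (0 : ℝ) < 1 + (2 * Real.pi * ξ) ^ 2 := by positivity
      rw [hg₀, norm_mul, norm_mul, ← mul_assoc]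
      refine mul_le_mul_of_nonneg_right ?_ (norm_nonneg _)
      simp only [hm', Complex.norm_real]
      rw [Real.norm_of_nonneg (by positivity), Real.norm_of_nonneg (by positivity)]
      calc _ ≤ (2 ^ (s / 2) * (1 + (2 * Real.pi * ξ) ^ 2) ^ (s / 2)) *
            (1 + (2 * Real.pi * ξ) ^ 2) ^ (-(s / 2)) :=
            mul_le_mul_of_nonneg_right (one_add_abs_rpow_le (by linarith) ξ) (by positivity)
        _ = _ := by rw [mul_assoc, ← Real.rpow_add hpos]; simp
  have hint : Integrable g₀ := by
    refine ⟨hg₀m.aestronglyMeasurable, ?_⟩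
    obtain ⟨C, hC⟩ := lintegral_weight_le (α := 0) (s := s) (by linarith)
    have := hC g₀ hg₀m.aestronglyMeasurable
    simp only [Real.rpow_zero, ENNReal.ofReal_one, one_mul] at this
    refine this.trans_lt (ENNReal.mul_lt_top ENNReal.coe_lt_top (hw.trans_lt ?_))
    exact ENNReal.mul_lt_top ENNReal.ofReal_lt_top enorm_lt_top
  -- The Bessel symbol `m` is inverted on the Fourier side by `m'`, which also has temperate growth.
  have hF : 𝓕 (toDistribution F) = smulLeftCLM ℂ m' (Γ : 𝓢'(ℝ, ℂ)) := by
    have h1 : smulLeftCLM ℂ m (𝓕 (toDistribution F)) = (Γ : 𝓢'(ℝ, ℂ)) := by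
      have := congrArg (fun T : 𝓢'(ℝ, ℂ) => 𝓕 T) h
      simp only [besselOp, TemperedDistribution.fourierMultiplierCLM_apply] at this
      rw [FourierTransform.fourier_fourierInv_eq, Lp.fourier_toTemperedDistribution_eq] at this
      exact this
    rw [← h1, smulLeftCLM_smulLeftCLM_apply hmt hmt']
    have : m * m' = fun _ => 1 := funext hmm
    rw [this, smulLeftCLM_const, one_smul]
  -- `F` is the inverse transform of `g₀`, that is, the forward transform of its reflection. Almost
  -- everywhere equality becomes equality because both sides are continuous.
  have hinv : Continuous (𝓕 fun x => g₀ (-x)) := continuous_fourier_of_integrable hint.comp_neg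
  have hae : (F : ℝ → ℂ) =ᵐ[volume] 𝓕 fun x => g₀ (-x) := by
    refine ae_eq_of_integral_schwartz_eq F.continuous.locallyIntegrable hinv.locallyIntegrable
      fun φ => ?_
    have h1 := congrArg (fun T : 𝓢'(ℝ, ℂ) => T (𝓕⁻ φ)) hF
    simp only [TemperedDistribution.fourier_apply, FourierTransform.fourier_fourierInv_eq,
      smulLeftCLM_apply_apply, Lp.toTemperedDistribution_apply, toDistribution] at h1
    have h2 : ∫ x, φ x • F x = ∫ x, φ x • (F.memLp_top.toLp F : Lp ℂ ∞ (volume : Measure ℝ)) x := by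
      refine integral_congr_ae ?_
      filter_upwards [F.memLp_top.coeFn_toLp (μ := volume)] with x hx
      rw [hx]
    rw [h2, h1, ← integral_fourier_smul_eq_of_integrable φ.integrable hint.comp_neg,
      ← integral_neg_eq_self]
    refine integral_congr_ae (.of_forall fun x => ?_)
    simp only [hg₀, neg_neg, SchwartzMap.smulLeftCLM_apply_apply hmt', SchwartzMap.fourierInv_coe,
      Real.fourierInv_eq_fourier_neg, smul_eq_mul]
    ring
  refine ⟨fun x => g₀ (-x), hg₀m.comp_measurable measurable_neg, hint.comp_neg,
    fun x => congrFun ((Continuous.ae_eq_iff_eq volume F.continuous hinv).1 hae) x, ?_⟩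
  -- The weight is even, so the reflection preserves the weighted norm.
  refine le_trans (le_of_eq ?_) hw
  have := eLpNorm_comp_measurePreserving (p := 2)
    (g := fun ξ : ℝ => (((1 + |ξ|) ^ s : ℝ) : ℂ) * g₀ ξ)
    (((Complex.continuous_ofReal.comp (continuous_one_add_abs_rpow s)).aestronglyMeasurable.mul
      hg₀m.aestronglyMeasurable)) (Measure.measurePreserving_neg (volume : Measure ℝ))
  rw [weightedNorm, weightedNorm, ← this]
  simp [Function.comp_def]

end Fourier

open scoped FourierTransform

/-! ### The change of variable `x = -log l`, localized by a bump. -/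

section LogChange

/-- Smooth functions with compact support in the open half-line. -/
structure IsHalfLineBump (η : ℝ → ℂ) : Prop where
  contDiff : ContDiff ℝ (⊤ : ℕ∞) η
  hasCompactSupport : HasCompactSupport η
  tsupport_subset : tsupport η ⊆ Set.Ioi 0

/-- The function `l ↦ η(l) u(-log l)`. -/
def logChange (η u : ℝ → ℂ) (l : ℝ) : ℂ := η l * u (-Real.log l)

namespace IsHalfLineBump

variable {η : ℝ → ℂ} (h : IsHalfLineBump η)
include h

lemma eq_zero_of_nonpos {l : ℝ} (hl : l ≤ 0) : η l = 0 := by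
  by_contra hne
  exact absurd (h.tsupport_subset (subset_tsupport η hne)) (by simpa using hl)

lemma eventually_eq_zero {l : ℝ} (hl : l ≤ 0) : ∀ᶠ x in nhds l, η x = 0 := by
  have : l ∉ tsupport η := fun hm => absurd (h.tsupport_subset hm) (by simpa using hl)
  exact notMem_tsupport_iff_eventuallyEq.1 this

lemma deriv : IsHalfLineBump (deriv η) where
  contDiff := by
    have := h.contDiff
    exact (contDiff_infty_iff_deriv.1 this).2
  hasCompactSupport := h.hasCompactSupport.deriv
  tsupport_subset := (closure_minimal support_deriv_subset (isClosed_tsupport _)).trans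
    h.tsupport_subset

/-- The singularity of `w` at `0`, typically that of `log` or of the inverse, is harmless because
`η` vanishes in a neighbourhood of every nonpositive point. -/
lemma mul_contDiffOn {w : ℝ → ℂ} (hw : ContDiffOn ℝ (⊤ : ℕ∞) w (Set.Ioi 0)) :
    IsHalfLineBump fun l => η l * w l where
  contDiff := by
    rw [contDiff_iff_contDiffAt]
    intro l
    rcases le_or_gt l 0 with hl | hl
    · refine contDiffAt_const (c := (0 : ℂ)) |>.congr_of_eventuallyEq ?_
      filter_upwards [h.eventually_eq_zero hl] with x hx
      rw [hx, zero_mul]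
    · exact h.contDiff.contDiffAt.mul (hw.contDiffAt (Ioi_mem_nhds hl))
  hasCompactSupport := h.hasCompactSupport.mul_right
  tsupport_subset := (closure_mono fun l hl => by
    simp only [Function.mem_support] at hl ⊢
    exact left_ne_zero_of_mul hl).trans h.tsupport_subset

lemma neg_div : IsHalfLineBump fun l => η l * (-((l⁻¹ : ℝ) : ℂ)) := by
  refine h.mul_contDiffOn fun l hl => ?_
  have hl' : l ≠ 0 := ne_of_gt hl
  exact ((Complex.ofRealCLM.contDiff.contDiffAt.comp l
    (contDiffAt_inv ℝ hl')).neg).contDiffWithinAt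

lemma logChange_contDiff {u : ℝ → ℂ} (hu : ContDiff ℝ (⊤ : ℕ∞) u) :
    ContDiff ℝ (⊤ : ℕ∞) (logChange η u) := by
  refine (h.mul_contDiffOn (w := fun l => u (-Real.log l)) fun l hl => ?_).contDiff
  have hl' : l ≠ 0 := ne_of_gt hl
  exact (hu.contDiffAt.comp l (Real.contDiffAt_log.2 hl').neg).contDiffWithinAt

lemma logChange_hasCompactSupport (u : ℝ → ℂ) : HasCompactSupport (logChange η u) :=
  h.hasCompactSupport.mul_right

lemma logChange_continuous {u : ℝ → ℂ} (hu : Continuous u) : Continuous (logChange η u) := by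
  rw [continuous_iff_continuousAt]
  intro l
  rcases le_or_gt l 0 with hl | hl
  · refine (continuousAt_const (y := (0 : ℂ))).congr ?_
    filter_upwards [h.eventually_eq_zero hl] with x hx
    rw [logChange, hx, zero_mul]
  · exact h.contDiff.continuous.continuousAt.mul
      (hu.continuousAt.comp (Real.continuousAt_log hl.ne').neg)

/-- Both terms are again of the form `logChange`, with half-line bumps `η'` and `-η/l`; this closure
is what lets higher derivatives be treated by induction. -/
lemma deriv_logChange {u : ℝ → ℂ} (hu : ContDiff ℝ (⊤ : ℕ∞) u) :
    _root_.deriv (logChange η u) = fun l => logChange (_root_.deriv η) u l +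
      logChange (fun l => η l * (-((l⁻¹ : ℝ) : ℂ))) (_root_.deriv u) l := by
  funext l
  rcases le_or_gt l 0 with hl | hl
  · have h1 : logChange η u =ᶠ[nhds l] fun _ => 0 := by
      filter_upwards [h.eventually_eq_zero hl] with x hx
      rw [logChange, hx, zero_mul]
    rw [h1.deriv_eq]
    simp [logChange, h.eq_zero_of_nonpos hl, h.deriv.eq_zero_of_nonpos hl]
  · have hη : HasDerivAt η (_root_.deriv η l) l :=
      (h.contDiff.differentiable (by simp)).differentiableAt.hasDerivAt
    have hu' : HasDerivAt u (_root_.deriv u (-Real.log l)) (-Real.log l) :=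
      (hu.differentiable (by simp)).differentiableAt.hasDerivAt
    have := hη.mul (hu'.scomp l (Real.hasDerivAt_log hl.ne').neg)
    rw [show logChange η u = η * (u ∘ (-Real.log)) from rfl, this.deriv]
    simp [logChange]
    ring

/-- Substitute `l = exp(-x)`. The Jacobian is `l`, so the squared constant is a bound for `‖η l‖²
|l|`, which is finite by compact support. -/
lemma eLpNorm_logChange_le : ∃ C : ℝ≥0, ∀ u : ℝ → ℂ,
    eLpNorm (logChange η u) 2 ≤ C * eLpNorm u 2 := by
  have hc : Continuous fun l : ℝ => ‖η l‖ ^ 2 * |l| :=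
    (h.contDiff.continuous.norm.pow 2).mul continuous_abs
  have hcs : HasCompactSupport fun l : ℝ => ‖η l‖ ^ 2 * |l| :=
    h.hasCompactSupport.mono fun l hl => by
      simp only [Function.mem_support] at hl ⊢
      intro h0; simp [h0] at hl
  obtain ⟨B, hB⟩ := hc.bounded_above_of_compact_support hcs
  have hB0 : 0 ≤ B := (norm_nonneg _).trans (hB 0)
  refine ⟨(Real.sqrt B).toNNReal, fun u => ?_⟩
  have hrange : (fun x : ℝ => Real.exp (-x)) '' Set.univ = Set.Ioi 0 := by
    ext l
    simp only [Set.image_univ, Set.mem_range, Set.mem_Ioi]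
    exact ⟨fun ⟨x, hx⟩ => hx ▸ Real.exp_pos _, fun hl => ⟨-Real.log l, by simp [Real.exp_log hl]⟩⟩
  have key : ∫⁻ l, ‖logChange η u l‖ₑ ^ (2 : ℝ) ≤
      ENNReal.ofReal B * ∫⁻ x, ‖u x‖ₑ ^ (2 : ℝ) := by
    calc ∫⁻ l, ‖logChange η u l‖ₑ ^ (2 : ℝ)
        = ∫⁻ l in Set.Ioi 0, ‖logChange η u l‖ₑ ^ (2 : ℝ) := by
          symm
          refine setLIntegral_eq_of_support_subset fun l hl => ?_
          by_contra hn
          exact hl (by simp [logChange, h.eq_zero_of_nonpos (not_lt.1 hn)])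
      _ = ∫⁻ x, ENNReal.ofReal |-Real.exp (-x)| *
            ‖logChange η u (Real.exp (-x))‖ₑ ^ (2 : ℝ) := by
          rw [← hrange, lintegral_image_eq_lintegral_abs_deriv_mul MeasurableSet.univ
            (f' := fun x => -Real.exp (-x)), setLIntegral_univ]
          · intro x _
            have := (Real.hasDerivAt_exp (-x)).comp x (hasDerivAt_neg x)
            simpa [Function.comp_def] using this
          · intro x _ y _ hxy
            simpa using hxy
      _ ≤ ∫⁻ x, ENNReal.ofReal B * ‖u x‖ₑ ^ (2 : ℝ) := by
          refine lintegral_mono fun x => ?_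
          have hb := hB (Real.exp (-x))
          rw [Real.norm_of_nonneg (by positivity)] at hb
          simp only [logChange, Real.log_exp, neg_neg, enorm_mul, abs_neg]
          rw [ENNReal.mul_rpow_of_nonneg _ _ (by norm_num), ← mul_assoc]
          gcongr
          rw [← ofReal_norm (E := ℂ), ENNReal.ofReal_rpow_of_nonneg (norm_nonneg _) (by norm_num),
            ← ENNReal.ofReal_mul (abs_nonneg _)]
          refine ENNReal.ofReal_le_ofReal ?_
          rw [mul_comm]
          exact_mod_cast hb
      _ = _ := lintegral_const_mul' _ _ ENNReal.ofReal_ne_top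
  rw [eLpNorm_eq_lintegral_rpow_enorm_toReal (by norm_num) (by norm_num),
    eLpNorm_eq_lintegral_rpow_enorm_toReal (by norm_num) (by norm_num)]
  simp only [ENNReal.toReal_ofNat]
  refine (ENNReal.rpow_le_rpow key (by norm_num)).trans (le_of_eq ?_)
  rw [ENNReal.mul_rpow_of_nonneg _ _ (by norm_num), ENNReal.ofReal_rpow_of_nonneg hB0 (by norm_num),
    ← Real.sqrt_eq_rpow]
  rfl

end IsHalfLineBump

lemma eLpNorm_iteratedDeriv_logChange_le (k : ℕ) : ∀ {η : ℝ → ℂ}, IsHalfLineBump η →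
    ∃ C : ℝ≥0, ∀ u : ℝ → ℂ, ContDiff ℝ (⊤ : ℕ∞) u →
      eLpNorm (iteratedDeriv k (logChange η u)) 2 ≤
        C * ∑ m ∈ Finset.range (k + 1), eLpNorm (iteratedDeriv m u) 2 := by
  induction k with
  | zero =>
    intro η h
    obtain ⟨C, hC⟩ := h.eLpNorm_logChange_le
    exact ⟨C, fun u _ => by simpa using hC u⟩
  | succ k ih =>
    intro η h
    obtain ⟨C₁, hC₁⟩ := ih h.deriv
    obtain ⟨C₂, hC₂⟩ := ih h.neg_div
    refine ⟨C₁ + C₂, fun u hu => ?_⟩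
    have hu' : ContDiff ℝ (⊤ : ℕ∞) (deriv u) := (contDiff_infty_iff_deriv.1 hu).2
    have hs1 := h.deriv.logChange_contDiff hu
    have hs2 := h.neg_div.logChange_contDiff hu'
    have hk : (k : WithTop ℕ∞) ≤ ((⊤ : ℕ∞) : WithTop ℕ∞) := by exact_mod_cast le_top
    have hadd : iteratedDeriv (k + 1) (logChange η u) =
        iteratedDeriv k (logChange (deriv η) u) +
        iteratedDeriv k (logChange (fun l => η l * (-((l⁻¹ : ℝ) : ℂ))) (deriv u)) := by
      rw [iteratedDeriv_succ', h.deriv_logChange hu]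
      funext l
      exact iteratedDeriv_fun_add (hs1.of_le hk).contDiffAt (hs2.of_le hk).contDiffAt
    rw [hadd]
    refine (eLpNorm_add_le
      (hs1.continuous_iteratedDeriv k hk).aestronglyMeasurable
      (hs2.continuous_iteratedDeriv k hk).aestronglyMeasurable (by norm_num)).trans ?_
    rw [ENNReal.coe_add, add_mul]
    refine add_le_add ((hC₁ u hu).trans ?_) ((hC₂ _ hu').trans ?_)
    · gcongr
      exact Nat.le_succ _
    · gcongr
      rw [Finset.sum_range_succ' _ (k + 1)]
      simp only [iteratedDeriv_succ']
      exact le_self_add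

end LogChange

open scoped FourierTransform

/-! ### Weighted `L¹` bounds for the transform of `η(l) F(-log l)`, by dyadic shells. -/

section Shells

lemma eLpNorm_two_le_of_pointwise {f h : ℝ → ℂ} {c : ℝ} {ν : Measure ℝ}
    (hfh : ∀ x, ‖f x‖ ≤ c * ‖h x‖) : eLpNorm f 2 ν ≤ ENNReal.ofReal c * eLpNorm h 2 ν :=
  eLpNorm_le_mul_eLpNorm_of_ae_le_mul (.of_forall hfh) 2

/-- The part of `g` at frequencies `1 + |ξ| < R`. -/
def lowFreq (R : ℝ) (g : ℝ → ℂ) : ℝ → ℂ := {ξ : ℝ | 1 + |ξ| < R}.indicator g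

/-- The part of `g` at frequencies `1 + |ξ| ≥ R`. -/
def highFreq (R : ℝ) (g : ℝ → ℂ) : ℝ → ℂ := {ξ : ℝ | 1 + |ξ| < R}ᶜ.indicator g

variable {R : ℝ} {g : ℝ → ℂ}

lemma measurableSet_lowFreq (R : ℝ) : MeasurableSet {ξ : ℝ | 1 + |ξ| < R} :=
  measurableSet_lt (by fun_prop) (by fun_prop)

lemma norm_weight_mul (s ξ : ℝ) (z : ℂ) :
    ‖(((1 + |ξ|) ^ s : ℝ) : ℂ) * z‖ = (1 + |ξ|) ^ s * ‖z‖ := by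
  rw [norm_mul, Complex.norm_real, Real.norm_of_nonneg (by positivity)]

lemma eLpNorm_highFreq_le {s : ℝ} (hs : 0 ≤ s) (hR : 0 < R) (g : ℝ → ℂ) :
    eLpNorm (highFreq R g) 2 ≤ ENNReal.ofReal (R ^ (-s)) * weightedNorm s g := by
  refine eLpNorm_two_le_of_pointwise fun ξ => ?_
  rw [norm_weight_mul, highFreq, ← mul_assoc]
  by_cases hξ : 1 + |ξ| < R
  · rw [Set.indicator_of_notMem (by simpa using hξ), norm_zero]; positivity
  · rw [Set.indicator_of_mem (by simpa using hξ)]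
    refine le_mul_of_one_le_left (norm_nonneg _) ?_
    rw [Real.rpow_neg hR.le, ← div_eq_inv_mul, one_le_div (by positivity)]
    exact Real.rpow_le_rpow hR.le (not_lt.1 hξ) hs

/-- Bernstein's inequality: below frequency `R`, all derivatives up to order `k` cost at most
`R^(k-s)` over the `H^s` norm. The orders `m < k` share this bound because `2π(1+|ξ|) ≥ 1`. -/
lemma eLpNorm_pow_mul_lowFreq_le {s : ℝ} {m k : ℕ} (hmk : m ≤ k) (hsk : s ≤ k)
    (hR : 0 < R) (g : ℝ → ℂ) :
    eLpNorm (fun ξ : ℝ => (-2 * Real.pi * Complex.I * ξ) ^ m • lowFreq R g ξ) 2 ≤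
      ENNReal.ofReal ((2 * Real.pi) ^ k * R ^ (k - s)) * weightedNorm s g := by
  refine eLpNorm_two_le_of_pointwise fun ξ => ?_
  have hpi := Real.pi_gt_three
  rw [norm_weight_mul, lowFreq]
  by_cases hξ : 1 + |ξ| < R
  · rw [Set.indicator_of_mem (by simpa using hξ), norm_smul, ← mul_assoc]
    refine mul_le_mul_of_nonneg_right ?_ (norm_nonneg _)
    have h1 : ‖(-2 * Real.pi * Complex.I * ξ : ℂ)‖ = 2 * Real.pi * |ξ| := by
      simp [abs_of_pos Real.pi_pos]
    rw [norm_pow, h1]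
    calc (2 * Real.pi * |ξ|) ^ m ≤ (2 * Real.pi * (1 + |ξ|)) ^ m := by gcongr; linarith
      _ ≤ (2 * Real.pi * (1 + |ξ|)) ^ k := by
          refine pow_le_pow_right₀ ?_ hmk
          nlinarith [abs_nonneg ξ]
      _ = (2 * Real.pi) ^ k * ((1 + |ξ|) ^ (k - s) * (1 + |ξ|) ^ s) := by
          rw [mul_pow, ← Real.rpow_add (by positivity)]; simp
      _ ≤ (2 * Real.pi) ^ k * (R ^ (k - s) * (1 + |ξ|) ^ s) := by
          gcongr
      _ = _ := by ring
  · rw [Set.indicator_of_notMem (by simpa using hξ), smul_zero, norm_zero]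
    positivity

lemma lowFreq_integrable_pow (hg : Integrable g) (n : ℕ) :
    Integrable fun ξ : ℝ => ξ ^ n • lowFreq R g ξ := by
  have h1 : Integrable (lowFreq R g) := hg.indicator (measurableSet_lowFreq R)
  refine (h1.norm.const_mul (|R| ^ n)).mono'
    ((continuous_pow n).aestronglyMeasurable.smul h1.aestronglyMeasurable) (.of_forall fun ξ => ?_)
  rw [norm_smul, norm_pow, Real.norm_eq_abs, lowFreq]
  by_cases hξ : 1 + |ξ| < R
  · refine mul_le_mul_of_nonneg_right ?_ (norm_nonneg _)
    exact pow_le_pow_left₀ (abs_nonneg ξ) ((by linarith : |ξ| ≤ R).trans (le_abs_self R)) n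
  · rw [Set.indicator_of_notMem (by simpa using hξ)]; simp

lemma fourier_lowFreq_contDiff (hg : Integrable g) : ContDiff ℝ (⊤ : ℕ∞) (𝓕 (lowFreq R g)) := by
  refine Real.contDiff_fourier fun n _ => ?_
  refine (lowFreq_integrable_pow hg n (R := R)).norm.congr (.of_forall fun ξ => ?_)
  simp

lemma iteratedDeriv_fourier_lowFreq (hg : Integrable g) (m : ℕ) :
    iteratedDeriv m (𝓕 (lowFreq R g)) =
      𝓕 fun ξ : ℝ => (-2 * Real.pi * Complex.I * ξ) ^ m • lowFreq R g ξ :=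
  Real.iteratedDeriv_fourier (N := ⊤) (fun n _ => lowFreq_integrable_pow hg n) le_top

lemma eLpNorm_iteratedDeriv_fourier_lowFreq_le {s : ℝ} {m k : ℕ} (hmk : m ≤ k) (hsk : s ≤ k)
    (hR : 0 < R) (hg : Integrable g) (hw : weightedNorm s g < ∞) :
    eLpNorm (iteratedDeriv m (𝓕 (lowFreq R g))) 2 ≤
      ENNReal.ofReal ((2 * Real.pi) ^ k * R ^ (k - s)) * weightedNorm s g := by
  have h1 := eLpNorm_pow_mul_lowFreq_le hmk hsk hR g
  have hi : Integrable fun ξ : ℝ => (-2 * Real.pi * Complex.I * ξ) ^ m • lowFreq R g ξ := by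
    refine ((lowFreq_integrable_pow hg m (R := R)).const_mul ((-2 * Real.pi * Complex.I) ^ m)).congr
      (.of_forall fun ξ => ?_)
    simp only [Complex.real_smul, smul_eq_mul, mul_pow]
    push_cast
    ring
  rw [iteratedDeriv_fourier_lowFreq hg, eLpNorm_fourier_eq hi ⟨hi.aestronglyMeasurable, ?_⟩]
  · exact h1
  · exact h1.trans_lt (ENNReal.mul_lt_top ENNReal.ofReal_lt_top hw)

/-- Decay in frequency of a compactly supported smooth function. -/
lemma eLpNorm_fourier_restrict_le {T : ℝ → ℂ} (hT : ContDiff ℝ (⊤ : ℕ∞) T)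
    (hc : HasCompactSupport T) (k : ℕ) (hR : 0 < R) {E : Set ℝ} (hE : MeasurableSet E)
    (hER : ∀ t ∈ E, R ≤ 1 + |t|) :
    eLpNorm (𝓕 T) 2 (volume.restrict E) ≤
      ENNReal.ofReal (2 ^ k * (R ^ k)⁻¹) * (eLpNorm T 2 + eLpNorm (iteratedDeriv k T) 2) := by
  have hk : (k : WithTop ℕ∞) ≤ ((⊤ : ℕ∞) : WithTop ℕ∞) := by exact_mod_cast le_top
  have hcd : ∀ m : ℕ, Continuous (iteratedDeriv m T) ∧ HasCompactSupport (iteratedDeriv m T) :=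
    fun m => ⟨hT.continuous_iteratedDeriv m (by exact_mod_cast le_top), by
      rw [iteratedDeriv_eq_iterate]
      induction m with
      | zero => simpa using hc
      | succ m ih => rw [Function.iterate_succ_apply']; exact ih.deriv⟩
  have hi : ∀ m : ℕ, Integrable (iteratedDeriv m T) := fun m =>
    (hcd m).1.integrable_of_hasCompactSupport (hcd m).2
  have hm : ∀ m : ℕ, MemLp (iteratedDeriv m T) 2 := fun m =>
    (hcd m).1.memLp_of_hasCompactSupport (hcd m).2
  have hf := Real.fourier_iteratedDeriv (N := ⊤) (n := k) hT (fun m _ => hi m) le_top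
  have hi0 := hi 0
  have hm0 := hm 0
  rw [iteratedDeriv_zero] at hi0 hm0
  rw [← eLpNorm_fourier_eq hi0 hm0, ← eLpNorm_fourier_eq (hi k) (hm k)]
  have hpt : ∀ᵐ t ∂(volume.restrict E),
      ‖𝓕 T t‖ ≤ 2 ^ k * (R ^ k)⁻¹ * ‖‖𝓕 T t‖ + ‖𝓕 (iteratedDeriv k T) t‖‖ := by
    filter_upwards [ae_restrict_mem hE] with t ht
    rw [hf, Real.norm_of_nonneg (by positivity)]
    have h1 : ‖(2 * Real.pi * Complex.I * t : ℂ)‖ = 2 * Real.pi * |t| := by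
      simp [abs_of_pos Real.pi_pos]
    rw [norm_smul, norm_pow, h1]
    -- The `1` is paid for by `T` itself and the power of `2π|t|` by its `k`-th derivative.
    have h2 : R ^ k ≤ 2 ^ k * (1 + (2 * Real.pi * |t|) ^ k) := by
      have hpi := Real.pi_gt_three
      calc R ^ k ≤ (1 + |t|) ^ k := by gcongr; exact hER t ht
        _ ≤ 2 ^ (k - 1) * (1 ^ k + |t| ^ k) := add_pow_le zero_le_one (abs_nonneg t) k
        _ ≤ 2 ^ k * (1 + (2 * Real.pi * |t|) ^ k) := by
          rw [one_pow]
          gcongr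
          · norm_num
          · omega
          · nlinarith [abs_nonneg t]
    have h3 : 1 ≤ 2 ^ k * (R ^ k)⁻¹ * (1 + (2 * Real.pi * |t|) ^ k) := by
      rw [mul_right_comm, ← div_eq_mul_inv, one_le_div (by positivity)]
      exact h2
    calc ‖𝓕 T t‖ = 1 * ‖𝓕 T t‖ := (one_mul _).symm
      _ ≤ 2 ^ k * (R ^ k)⁻¹ * (1 + (2 * Real.pi * |t|) ^ k) * ‖𝓕 T t‖ := by gcongr
      _ = _ := by ring
  refine (eLpNorm_le_mul_eLpNorm_of_ae_le_mul hpt 2).trans ?_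
  gcongr
  refine (eLpNorm_mono_measure _ Measure.restrict_le_self).trans ?_
  have hc1 := (continuous_fourier_of_integrable hi0).norm.aestronglyMeasurable (μ := volume)
  have hc2 := (continuous_fourier_of_integrable (hi k)).norm.aestronglyMeasurable (μ := volume)
  refine (eLpNorm_add_le hc1 hc2 (by norm_num)).trans (le_of_eq ?_)
  rw [eLpNorm_norm, eLpNorm_norm]

/-- The dyadic shell `2^j ≤ 1 + |t| < 2^(j+1)`. -/
def shell (j : ℕ) : Set ℝ := {t | 2 ^ j ≤ 1 + |t| ∧ 1 + |t| < 2 ^ (j + 1)}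

lemma measurableSet_shell (j : ℕ) : MeasurableSet (shell j) := by
  have h : Measurable fun t : ℝ => 1 + |t| := by fun_prop
  exact (measurableSet_le measurable_const h).inter (measurableSet_lt h measurable_const)

/-- A substitute for `H^s` invariance under the change of variable when `s` is not an integer. Split
`g` at `R = 2^j`. With `k = ⌈s⌉`, the low part loses `R^(k-s)` on differentiation and gains `R^(-k)`
from frequency localization to the shell; the high part is already of size `R^(-s)` in `L²`. Both
give `R^(-s)`. -/
lemma eLpNorm_fourier_logChange_shell_le {η : ℝ → ℂ} (hη : IsHalfLineBump η) {s : ℝ}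
    (hs : 0 ≤ s) : ∃ C : ℝ≥0, ∀ g : ℝ → ℂ, Integrable g → weightedNorm s g < ∞ → ∀ j : ℕ,
      eLpNorm (𝓕 (logChange η (𝓕 g))) 2 (volume.restrict (shell j)) ≤
        C * ENNReal.ofReal (((2 : ℝ) ^ j) ^ (-s)) * weightedNorm s g := by
  set k := ⌈s⌉₊ with hk
  have hsk : s ≤ k := Nat.le_ceil s
  obtain ⟨C₀, hC₀⟩ := hη.eLpNorm_logChange_le
  obtain ⟨C₁, hC₁⟩ := eLpNorm_iteratedDeriv_logChange_le k hη
  -- The constant of the low part: `k + 1` counts the derivatives of order `0, ..., k`. The high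
  -- part contributes only `C₀`.
  set c : ℝ≥0 := 2 ^ k * (C₀ + C₁ * (k + 1)) * ((2 * Real.pi) ^ k).toNNReal with hc
  refine ⟨c + C₀, fun g hg hw j => ?_⟩
  set R : ℝ := 2 ^ j with hR
  have hRpos : 0 < R := by positivity
  have hlo : Integrable (lowFreq R g) := hg.indicator (measurableSet_lowFreq R)
  have hhi : Integrable (highFreq R g) := hg.indicator (measurableSet_lowFreq R).compl
  have hhi2 : MemLp (highFreq R g) 2 := ⟨hhi.aestronglyMeasurable,
    (eLpNorm_highFreq_le hs hRpos g).trans_lt (ENNReal.mul_lt_top ENNReal.ofReal_lt_top hw)⟩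
  have hsplit : g = lowFreq R g + highFreq R g :=
    (Set.indicator_self_add_compl _ g).symm
  have hFsplit : 𝓕 g = 𝓕 (lowFreq R g) + 𝓕 (highFreq R g) := by
    conv_lhs => rw [hsplit]
    funext x
    exact congrFun (VectorFourier.fourierIntegral_add Real.continuous_fourierChar
      (by exact continuous_inner) hlo hhi) x
  have hT₁ := hη.logChange_contDiff (fourier_lowFreq_contDiff hg (R := R))
  have hT₁c := hη.logChange_hasCompactSupport (𝓕 (lowFreq R g))
  have hT₂ := hη.logChange_continuous (continuous_fourier_of_integrable hhi)
  have hT₂c := hη.logChange_hasCompactSupport (𝓕 (highFreq R g))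
  have hTsplit : logChange η (𝓕 g) = logChange η (𝓕 (lowFreq R g)) +
      logChange η (𝓕 (highFreq R g)) := by
    funext l; simp [logChange, hFsplit, mul_add]
  have hi₁ := hT₁.continuous.integrable_of_hasCompactSupport (μ := volume) hT₁c
  have hi₂ := hT₂.integrable_of_hasCompactSupport (μ := volume) hT₂c
  have hFT : 𝓕 (logChange η (𝓕 g)) = 𝓕 (logChange η (𝓕 (lowFreq R g))) +
      𝓕 (logChange η (𝓕 (highFreq R g))) := by
    rw [hTsplit]
    funext x
    exact congrFun (VectorFourier.fourierIntegral_add Real.continuous_fourierChar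
      (by exact continuous_inner) hi₁ hi₂) x
  rw [hFT]
  refine (eLpNorm_add_le (continuous_fourier_of_integrable hi₁).aestronglyMeasurable
    (continuous_fourier_of_integrable hi₂).aestronglyMeasurable (by norm_num)).trans ?_
  rw [ENNReal.coe_add, add_mul, add_mul]
  refine add_le_add ?_ ?_
  · refine (eLpNorm_fourier_restrict_le hT₁ hT₁c k hRpos (measurableSet_shell j)
      fun t ht => ht.1).trans ?_
    have hb : ∀ m ≤ k, eLpNorm (iteratedDeriv m (𝓕 (lowFreq R g))) 2 ≤
      ENNReal.ofReal ((2 * Real.pi) ^ k * R ^ (k - s)) * weightedNorm s g := fun m hm =>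
        eLpNorm_iteratedDeriv_fourier_lowFreq_le hm hsk hRpos hg hw
    set Q := ENNReal.ofReal ((2 * Real.pi) ^ k * R ^ (k - s)) * weightedNorm s g with hQ
    have h0 := (hC₀ (𝓕 (lowFreq R g))).trans (mul_le_mul_right (by simpa using hb 0 (Nat.zero_le _)) _)
    have h1 := (hC₁ _ (fourier_lowFreq_contDiff hg (R := R))).trans
      (mul_le_mul_right (Finset.sum_le_card_nsmul _ _ Q
        fun m hm => hb m (Nat.lt_succ_iff.1 (Finset.mem_range.1 hm))) _)
    refine (mul_le_mul_right (add_le_add h0 h1) _).trans (le_of_eq ?_)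
    have hRk : R ^ (k - s) = R ^ k * R ^ (-s) := by
      rw [sub_eq_add_neg, Real.rpow_add hRpos, Real.rpow_natCast]
    rw [hQ, hRk, hc, Finset.card_range, nsmul_eq_mul]
    rw [show (2 * Real.pi) ^ k * (R ^ k * R ^ (-s)) = R ^ k * ((2 * Real.pi) ^ k * R ^ (-s)) by ring,
      ENNReal.ofReal_mul (p := R ^ k) (by positivity),
      ENNReal.ofReal_mul (p := (2 * Real.pi) ^ k) (by positivity),
      ENNReal.ofReal_mul (p := 2 ^ k) (by positivity)]
    have hcan : ENNReal.ofReal (R ^ k)⁻¹ * ENNReal.ofReal (R ^ k) = 1 := by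
      rw [← ENNReal.ofReal_mul (by positivity), inv_mul_cancel₀ (by positivity), ENNReal.ofReal_one]
    have h2k : ENNReal.ofReal (2 ^ k) = ((2 : ℝ≥0) ^ k : ℝ≥0) := by
      rw [ENNReal.ofReal_pow (by norm_num)]; simp
    have hpik : ENNReal.ofReal ((2 * Real.pi) ^ k) = (((2 * Real.pi) ^ k).toNNReal : ℝ≥0) := rfl
    rw [h2k, hpik]
    push_cast
    calc _ = (ENNReal.ofReal (R ^ k)⁻¹ * ENNReal.ofReal (R ^ k)) * (2 ^ k * (C₀ + C₁ * (k + 1)) *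
        (((2 * Real.pi) ^ k).toNNReal : ℝ≥0∞) * ENNReal.ofReal (R ^ (-s)) * weightedNorm s g) := by
          ring
      _ = _ := by rw [hcan, one_mul]
  · refine (eLpNorm_mono_measure _ Measure.restrict_le_self).trans ?_
    rw [eLpNorm_fourier_eq hi₂ (hT₂.memLp_of_hasCompactSupport hT₂c), mul_assoc]
    refine (hC₀ _).trans ?_
    gcongr
    rw [eLpNorm_fourier_eq hhi hhi2]
    exact eLpNorm_highFreq_le hs hRpos g

lemma iUnion_shell : ⋃ j, shell j = Set.univ := by
  refine Set.eq_univ_of_forall fun t => ?_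
  obtain ⟨j, hj⟩ := exists_nat_pow_near (le_add_of_nonneg_right (abs_nonneg t) : 1 ≤ 1 + |t|)
    one_lt_two
  exact Set.mem_iUnion.2 ⟨j, hj⟩

lemma pairwise_disjoint_shell : Pairwise (Function.onFun Disjoint shell) := by
  have key : ∀ i j : ℕ, i < j → Disjoint (shell i) (shell j) := fun i j hij => by
    rw [Set.disjoint_left]
    intro t hi hj
    have h1 : (2 : ℝ) ^ (i + 1) ≤ 2 ^ j := pow_le_pow_right₀ one_le_two hij
    exact absurd (hi.2.trans_le (h1.trans hj.1)) (lt_irrefl _)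
  intro i j hij
  rcases lt_or_gt_of_ne hij with h | h
  · exact key i j h
  · exact (key j i h).symm

lemma volume_shell_le (j : ℕ) : volume (shell j) ≤ ENNReal.ofReal (4 * 2 ^ j) := by
  have hsub : shell j ⊆ Set.Ioo (-2 ^ (j + 1)) (2 ^ (j + 1)) := fun t ht =>
    abs_lt.1 (by linarith [ht.2])
  refine (measure_mono hsub).trans (le_of_eq ?_)
  rw [Real.volume_Ioo]
  ring_nf

/-- On shell `j`, Cauchy–Schwarz costs the square root of its length, of order `2^(j/2)`, and the
weight costs `2^(jα)`; against `2^(-js)` this leaves a geometric series of ratio `2^(α+1/2-s) < 1`.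
-/
lemma lintegral_weight_shells_le {α s : ℝ} (hα : 0 ≤ α) (hs : α + 1 / 2 < s) :
    ∃ C : ℝ≥0, ∀ (f : ℝ → ℂ) (B : ℝ≥0∞), Continuous f →
      (∀ j, eLpNorm f 2 (volume.restrict (shell j)) ≤
        ENNReal.ofReal (((2 : ℝ) ^ j) ^ (-s)) * B) →
      ∫⁻ t, ENNReal.ofReal ((1 + |t|) ^ α) * ‖f t‖ₑ ≤ C * B := by
  set q : ℝ≥0∞ := ENNReal.ofReal (2 ^ (α + 1 / 2 - s)) with hq
  have hq1 : q < 1 := by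
    rw [hq, ← ENNReal.ofReal_one]
    exact (ENNReal.ofReal_lt_ofReal_iff one_pos).2
      (Real.rpow_lt_one_of_one_lt_of_neg one_lt_two (by linarith))
  have hfin : ENNReal.ofReal (2 ^ α * 2) * (1 - q)⁻¹ ≠ ∞ :=
    ENNReal.mul_ne_top ENNReal.ofReal_ne_top
      (ENNReal.inv_ne_top.2 (tsub_pos_of_lt hq1).ne')
  refine ⟨(ENNReal.ofReal (2 ^ α * 2) * (1 - q)⁻¹).toNNReal, fun f B hf hB => ?_⟩
  rw [ENNReal.coe_toNNReal hfin, ← setLIntegral_univ, ← iUnion_shell,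
    lintegral_iUnion measurableSet_shell pairwise_disjoint_shell]
  have hj : ∀ j, ∫⁻ t in shell j, ENNReal.ofReal ((1 + |t|) ^ α) * ‖f t‖ₑ ≤
      ENNReal.ofReal (2 ^ α * 2) * B * q ^ j := fun j => by
    calc ∫⁻ t in shell j, ENNReal.ofReal ((1 + |t|) ^ α) * ‖f t‖ₑ
        ≤ ∫⁻ t in shell j, ENNReal.ofReal (((2 : ℝ) ^ (j + 1)) ^ α) * ‖f t‖ₑ := by
          refine setLIntegral_mono' (measurableSet_shell j) fun t ht => ?_
          gcongr
          exact ht.2.le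
      _ = ENNReal.ofReal (((2 : ℝ) ^ (j + 1)) ^ α) * eLpNorm f 1 (volume.restrict (shell j)) := by
          rw [lintegral_const_mul' _ _ ENNReal.ofReal_ne_top, eLpNorm_one_eq_lintegral_enorm]
      _ ≤ ENNReal.ofReal (((2 : ℝ) ^ (j + 1)) ^ α) * ((ENNReal.ofReal (((2 : ℝ) ^ j) ^ (-s)) * B) *
            ENNReal.ofReal ((4 * 2 ^ j) ^ (1 / 2 : ℝ))) := by
          gcongr
          refine (eLpNorm_le_eLpNorm_mul_rpow_measure_univ (q := 2) (by norm_num)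
            hf.aestronglyMeasurable).trans (mul_le_mul' (hB j) ?_)
          rw [Measure.restrict_apply_univ, ← ENNReal.ofReal_rpow_of_nonneg (by positivity)
            (by norm_num)]
          norm_num
          exact ENNReal.rpow_le_rpow (by simpa using volume_shell_le j) (by norm_num)
      _ = ENNReal.ofReal (2 ^ α * 2) * B * q ^ j := by
          rw [mul_right_comm (ENNReal.ofReal _) B, ← mul_assoc, mul_right_comm _ B,
            ← ENNReal.ofReal_mul (by positivity), ← ENNReal.ofReal_mul (by positivity), hq,
            ← ENNReal.ofReal_pow (by positivity), ← ENNReal.ofReal_mul (by positivity)]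
          congr 2
          have h2 : (0 : ℝ) < 2 := two_pos
          have h4 : (4 * 2 ^ j : ℝ) ^ (1 / 2 : ℝ) = 2 * (2 ^ j) ^ (1 / 2 : ℝ) := by
            rw [Real.mul_rpow (by norm_num) (by positivity),
              show (4 : ℝ) = 2 ^ (2 : ℝ) by norm_num, ← Real.rpow_mul h2.le]
            norm_num
          rw [h4, pow_succ, Real.mul_rpow (by positivity) h2.le, ← Real.rpow_natCast,
            ← Real.rpow_natCast, ← Real.rpow_mul h2.le, ← Real.rpow_mul h2.le,
            ← Real.rpow_mul h2.le, ← Real.rpow_mul h2.le,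
            show (α + 1 / 2 - s) * j = j * α + (j * (-s) + j * (1 / 2)) by ring,
            Real.rpow_add h2, Real.rpow_add h2]
          ring
  refine (ENNReal.tsum_le_tsum hj).trans (le_of_eq ?_)
  rw [ENNReal.tsum_mul_left, ENNReal.tsum_geometric]
  ring

lemma exists_halfLineBump : ∃ η : ℝ → ℂ, IsHalfLineBump η ∧
    ∀ l ∈ Set.Icc (Real.exp (-1)) (Real.exp 1), η l = ((l⁻¹ : ℝ) : ℂ) := by
  -- The bump is `1` on `[0.3, 2.9]`, which contains `[1/e, e]`, and is supported in `[0.1, 3.1]`,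
  -- away from `0`.
  let χ : ContDiffBump (1.6 : ℝ) := ⟨1.3, 1.5, by norm_num, by norm_num⟩
  have hχ : IsHalfLineBump fun l => ((χ l : ℝ) : ℂ) :=
    { contDiff := Complex.ofRealCLM.contDiff.comp χ.contDiff
      hasCompactSupport := χ.hasCompactSupport.comp_left Complex.ofReal_zero
      tsupport_subset := by
        have h1 : tsupport (fun l => ((χ l : ℝ) : ℂ)) ⊆ tsupport χ :=
          closure_mono fun l hl => by
            simp only [Function.mem_support, ne_eq, Complex.ofReal_eq_zero] at hl ⊢
            exact hl
        refine h1.trans ?_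
        rw [χ.tsupport_eq]
        intro l hl
        rw [Metric.mem_closedBall, Real.dist_eq] at hl
        have := (abs_le.1 hl).1
        simp only [Set.mem_Ioi, χ] at this ⊢
        norm_num at this
        linarith }
  refine ⟨fun l => ((χ l : ℝ) : ℂ) * ((l⁻¹ : ℝ) : ℂ), hχ.mul_contDiffOn fun l hl => ?_,
    fun l hl => ?_⟩
  · exact (Complex.ofRealCLM.contDiff.contDiffAt.comp l
      (contDiffAt_inv ℝ (ne_of_gt hl))).contDiffWithinAt
  · have he : Real.exp 1 < 2.7182818286 := Real.exp_one_lt_d9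
    have he' : (0.3 : ℝ) ≤ Real.exp (-1) := by
      rw [Real.exp_neg, le_inv_comm₀ (by norm_num) (Real.exp_pos 1)]
      norm_num at he ⊢
      linarith
    have : χ l = 1 := χ.one_of_mem_closedBall (by
      rw [Metric.mem_closedBall, Real.dist_eq, abs_le]
      simp only [χ]
      norm_num at he he' ⊢
      constructor <;> linarith [hl.1, hl.2])
    simp [this]

/-- `F(-log l) / l` is the Fourier integral of a function with controlled weighted `L¹` norm. -/
lemma exists_fourier_eq_compNegLog {α s : ℝ} (hα : 0 ≤ α) (hs : α + 1 / 2 < s) :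
    ∃ C : ℝ≥0, ∀ F : ℝ → ℂ, Function.support F ⊆ Set.Icc (-1) 1 → ∀ g : ℝ → ℂ, Integrable g →
      weightedNorm s g < ∞ → (∀ x, F x = 𝓕 g x) →
      ∃ h : ℝ → ℂ, Integrable h ∧ (∀ l : ℝ, compNegLog F l = 𝓕 h l * l) ∧
        ∫⁻ t, ENNReal.ofReal ((1 + |t|) ^ α) * ‖h t‖ₑ ≤ C * weightedNorm s g := by
  obtain ⟨η, hη, hηl⟩ := exists_halfLineBump
  obtain ⟨C₁, hC₁⟩ := eLpNorm_fourier_logChange_shell_le hη (s := s) (by linarith)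
  obtain ⟨C₂, hC₂⟩ := lintegral_weight_shells_le hα hs
  refine ⟨C₂ * C₁, fun F hF g hg hw hFg => ?_⟩
  have hFg' : F = 𝓕 g := funext hFg
  set H := logChange η (𝓕 g) with hH
  have hHc : Continuous H := hη.logChange_continuous (continuous_fourier_of_integrable hg)
  have hHi : Integrable H :=
    hHc.integrable_of_hasCompactSupport (hη.logChange_hasCompactSupport _)
  have hfc := continuous_fourier_of_integrable hHi
  have hb : ∫⁻ t, ENNReal.ofReal ((1 + |t|) ^ α) * ‖𝓕 H t‖ₑ ≤ ↑(C₂ * C₁) * weightedNorm s g := by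
    rw [ENNReal.coe_mul, mul_assoc]
    refine hC₂ _ _ hfc fun j => (hC₁ g hg hw j).trans (le_of_eq (by ring))
  -- Since `α ≥ 0` the weight is at least `1`, so the weighted bound gives integrability and hence
  -- Fourier inversion for `H`.
  have hbint : Integrable (𝓕 H) := by
    refine ⟨hfc.aestronglyMeasurable, ?_⟩
    refine lt_of_le_of_lt ?_ (hb.trans_lt (ENNReal.mul_lt_top ENNReal.coe_lt_top hw))
    refine lintegral_mono fun t => ?_
    refine le_mul_of_one_le_left (zero_le) ?_
    rw [← ENNReal.ofReal_one]
    exact ENNReal.ofReal_le_ofReal (Real.one_le_rpow (by linarith [abs_nonneg t]) hα)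
  have hinv : 𝓕⁻ H = fun t => 𝓕 H (-t) := funext fun t => Real.fourierInv_eq_fourier_neg H t
  refine ⟨𝓕⁻ H, hinv ▸ hbint.comp_neg, fun l => ?_, ?_⟩
  · rw [hHc.fourier_fourierInv_eq hHi hbint, hH, logChange, compNegLog]
    split_ifs with hl
    · by_cases hmem : l ∈ Set.Icc (Real.exp (-1)) (Real.exp 1)
      · rw [hηl l hmem, hFg, mul_right_comm, ← Complex.ofReal_mul, inv_mul_cancel₀ hl.ne']
        simp
      -- Outside `[1/e, e]` the point `-log l` leaves `[-1, 1]`, where `F` vanishes; the value of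
      -- `η` there does not matter.
      · have : F (-Real.log l) = 0 := by
          by_contra hne
          have h1 := hF hne
          refine hmem ⟨?_, ?_⟩
          · rw [← Real.le_log_iff_exp_le hl]; linarith [h1.2]
          · rw [← Real.log_le_iff_le_exp hl]; linarith [h1.1]
        rw [← hFg, this]; simp
    · rw [hη.eq_zero_of_nonpos (not_lt.1 hl)]; simp
  · refine le_trans (le_of_eq ?_) hb
    rw [hinv, ← lintegral_neg_eq_self]
    simp

end Shells

/-! ### Orthogonal decompositions and interpolation between weighted `ℓ¹` and `ℓ²` sums of blocks.
-/

section Interpolation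

variable {H ι : Type*} [NormedAddCommGroup H] [InnerProductSpace ℂ H]

/-- A resolution of the identity by mutually orthogonal projections. -/
structure IsOrthDecomp (P : ι → H →L[ℂ] H) : Prop where
  symm : ∀ i x y, inner ℂ (P i x) y = inner ℂ x (P i y)
  idem : ∀ i x, P i (P i x) = P i x
  orth : ∀ i j, i ≠ j → ∀ x, P i (P j x) = 0
  hasSum : ∀ x, HasSum (fun i => P i x) x

namespace IsOrthDecomp

variable {P : ι → H →L[ℂ] H} (h : IsOrthDecomp P)
include h

lemma inner_eq_zero {i j : ι} (hij : i ≠ j) (x y : H) : inner ℂ (P i x) (P j y) = 0 := by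
  rw [h.symm, h.orth i j hij, inner_zero_right]

lemma norm_sum_sq (S : Finset ι) (c : ι → ℂ) (x : ι → H) :
    ‖∑ i ∈ S, c i • P i (x i)‖ ^ 2 = ∑ i ∈ S, (‖c i‖ * ‖P i (x i)‖) ^ 2 := by
  classical
  have h1 : inner ℂ (∑ i ∈ S, c i • P i (x i)) (∑ i ∈ S, c i • P i (x i)) =
      ∑ i ∈ S, inner ℂ (c i • P i (x i)) (c i • P i (x i)) := by
    rw [sum_inner]
    refine Finset.sum_congr rfl fun i hi => ?_
    rw [inner_sum, Finset.sum_eq_single i]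
    · intro j _ hji
      rw [inner_smul_left, inner_smul_right, h.inner_eq_zero hji.symm]; simp
    · exact fun hn => absurd hi hn
  have h2 := congrArg Complex.re h1
  rw [Complex.re_sum] at h2
  have h3 : ∀ y : H, (inner ℂ y y).re = ‖y‖ ^ 2 := fun y => by
    simpa using (inner_self_eq_norm_sq (𝕜 := ℂ) y)
  simp only [h3, norm_smul] at h2
  exact h2

lemma hasSum_norm_sq (x : H) : HasSum (fun i => ‖P i x‖ ^ 2) (‖x‖ ^ 2) := by
  have h1 := ((h.hasSum x).norm).pow 2
  refine Filter.Tendsto.congr (fun S => ?_) h1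
  simpa using h.norm_sum_sq S (fun _ => 1) (fun _ => x)

end IsOrthDecomp

open Complex HadamardThreeLines in
/-- The interpolation inequality between `ℓ¹` and `ℓ²`, in terms of the normalized lengths
`γ j` and `β i` of the blocks of input and output. -/
lemma interpolation_core {I J : Finset ι} {p M S Q : ℝ} (hp1 : 1 ≤ p) (hp2 : p ≤ 2)
    (hM : 0 ≤ M) {β γ : ι → ℝ} (hβ : ∀ i ∈ I, 0 < β i) (hγ : ∀ j ∈ J, 0 < γ j)
    (m : ι → ι → ℂ) (hQ : 0 ≤ Q) (hS : 0 ≤ S)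
    (h0 : ∑ j ∈ J, γ j ^ p * ∑ i ∈ I, ‖m i j‖ ≤ M * Q)
    (h1 : ∀ d c : ι → ℂ, (∀ i ∈ I, ‖d i‖ = β i ^ (p / 2)) → (∀ j ∈ J, ‖c j‖ = γ j ^ (p / 2)) →
      ‖∑ i ∈ I, ∑ j ∈ J, d i * c j * m i j‖ ≤ Real.sqrt S * Real.sqrt Q)
    (hθ : ‖∑ i ∈ I, ∑ j ∈ J, ((β i ^ (p - 1) * γ j : ℝ) : ℂ) * m i j‖ = S) :
    S ≤ M ^ (2 - p) * Q := by
  -- The analytic families `β^(pz/2)` and `γ^(p(1-z/2))`: on `Re z = 0` the moduli are `1` and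
  -- `γ^p`, the `ℓ¹` pairing; on `Re z = 1` they are `β^(p/2)` and `γ^(p/2)`, the `ℓ²` pairing.
  set e : ι → ι → ℂ → ℂ := fun i j z =>
    cexp (p * z / 2 * Real.log (β i)) * cexp (p * (1 - z / 2) * Real.log (γ j)) with he
  set Φ : ℂ → ℂ := fun z => ∑ i ∈ I, ∑ j ∈ J, e i j z * m i j with hΦ
  have hnβ : ∀ i ∈ I, ∀ z : ℂ, ‖cexp (p * z / 2 * Real.log (β i))‖ = β i ^ (p * z.re / 2) := by
    intro i hi z
    rw [Complex.norm_exp, Real.rpow_def_of_pos (hβ i hi)]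
    congr 1
    rw [show (p * z / 2 * Real.log (β i) : ℂ) = ((p / 2 * Real.log (β i) : ℝ) : ℂ) * z by
      push_cast; ring, re_ofReal_mul]
    ring
  have hnγ : ∀ j ∈ J, ∀ z : ℂ,
      ‖cexp (p * (1 - z / 2) * Real.log (γ j))‖ = γ j ^ (p * (1 - z.re / 2)) := by
    intro j hj z
    rw [Complex.norm_exp, Real.rpow_def_of_pos (hγ j hj)]
    congr 1
    rw [show (p * (1 - z / 2) * Real.log (γ j) : ℂ) =
      ((p * Real.log (γ j) : ℝ) : ℂ) * (1 - ((1 / 2 : ℝ) : ℂ) * z) by push_cast; ring,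
      re_ofReal_mul, sub_re, re_ofReal_mul, one_re]
    ring
  -- Chosen so that `pθ/2 = p - 1` and `p(1 - θ/2) = 1`, the exponents in `hθ`.
  set θ : ℝ := 2 - 2 / p with hθdef
  have hp0 : 0 < p := by linarith
  have hθ0 : 0 ≤ θ := by
    rw [hθdef, sub_nonneg, div_le_iff₀ hp0]; linarith
  have hθ1 : θ ≤ 1 := by
    have : 1 ≤ 2 / p := by rw [le_div_iff₀ hp0]; linarith
    rw [hθdef]; linarith
  have hdiff : Differentiable ℂ Φ := by
    simp only [hΦ, he]
    fun_prop
  have hbdd : BddAbove ((norm ∘ Φ) '' verticalClosedStrip 0 1) := by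
    refine ⟨∑ i ∈ I, ∑ j ∈ J, (max 1 (β i) ^ p * (max 1 (γ j)) ^ p *
      max 1 (β i)⁻¹ ^ p * (max 1 (γ j)⁻¹) ^ p) * ‖m i j‖, ?_⟩
    rintro _ ⟨z, hz, rfl⟩
    rw [verticalClosedStrip, Set.mem_preimage, Set.mem_Icc] at hz
    refine (norm_sum_le _ _).trans (Finset.sum_le_sum fun i hi =>
      (norm_sum_le _ _).trans (Finset.sum_le_sum fun j hj => ?_))
    rw [norm_mul, he, norm_mul, hnβ i hi, hnγ j hj]
    refine mul_le_mul_of_nonneg_right ?_ (norm_nonneg _)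
    have hle : ∀ x r : ℝ, 0 < x → 0 ≤ r → r ≤ p → x ^ r ≤ max 1 x ^ p := fun x r hx hr hrp =>
      (Real.rpow_le_rpow hx.le (le_max_right _ _) hr).trans
        (Real.rpow_le_rpow_of_exponent_le (le_max_left _ _) hrp)
    have hone : ∀ x : ℝ, 1 ≤ max 1 x ^ p := fun x => Real.one_le_rpow (le_max_left _ _) hp0.le
    calc β i ^ (p * z.re / 2) * γ j ^ (p * (1 - z.re / 2))
        ≤ max 1 (β i) ^ p * (max 1 (γ j)) ^ p := by
          refine mul_le_mul (hle _ _ (hβ i hi) ?_ ?_) (hle _ _ (hγ j hj) ?_ ?_)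
            (Real.rpow_nonneg (hγ j hj).le _) (by positivity)
          · have := hz.1; positivity
          · nlinarith [hz.2]
          · have : 0 ≤ 1 - z.re / 2 := by linarith [hz.2]
            positivity
          · nlinarith [hz.1]
      _ = max 1 (β i) ^ p * (max 1 (γ j)) ^ p * 1 * 1 := by ring
      _ ≤ _ := by
          gcongr
          · exact hone _
          · exact hone _
  have hA : ∀ z ∈ re ⁻¹' {0}, ‖Φ z‖ ≤ M * Q := by
    intro z hz
    have hz0 : z.re = 0 := hz
    refine le_trans ?_ h0
    refine (norm_sum_le _ _).trans ?_
    simp only [Finset.mul_sum]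
    rw [Finset.sum_comm]
    refine Finset.sum_le_sum fun i hi => (norm_sum_le _ _).trans (Finset.sum_le_sum fun j hj => ?_)
    rw [norm_mul, he, norm_mul, hnβ i hi, hnγ j hj, hz0]
    simp
  have hB : ∀ z ∈ re ⁻¹' {1}, ‖Φ z‖ ≤ Real.sqrt S * Real.sqrt Q := by
    intro z hz
    have hz1 : z.re = 1 := hz
    refine h1 (fun i => cexp (p * z / 2 * Real.log (β i)))
      (fun j => cexp (p * (1 - z / 2) * Real.log (γ j))) (fun i hi => ?_) (fun j hj => ?_)
    · rw [hnβ i hi, hz1]; ring_nf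
    · rw [hnγ j hj, hz1]; ring_nf
  have key := norm_le_interp_of_mem_verticalClosedStrip₀₁' Φ (z := (θ : ℂ))
    (by simp [verticalClosedStrip, hθ0, hθ1]) hdiff.diffContOnCl hbdd hA hB
  have hΦθ : ‖Φ θ‖ = S := by
    rw [← hθ, hΦ]
    congr 1
    refine Finset.sum_congr rfl fun i hi => Finset.sum_congr rfl fun j hj => ?_
    congr 1
    rw [he, Real.rpow_def_of_pos (hβ i hi)]
    push_cast
    rw [show (p * (θ : ℂ) / 2 * Real.log (β i) : ℂ) = Real.log (β i) * (p - 1) by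
        rw [hθdef]; push_cast
        have : (p : ℂ) ≠ 0 := by exact_mod_cast hp0.ne'
        field_simp,
      show (p * (1 - (θ : ℂ) / 2) * Real.log (γ j) : ℂ) = ((Real.log (γ j) : ℝ) : ℂ) by
        rw [hθdef]; push_cast
        have : (p : ℂ) ≠ 0 := by exact_mod_cast hp0.ne'
        field_simp
        ring,
      ← Complex.ofReal_exp (Real.log (γ j)), Real.exp_log (hγ j hj)]
  rw [hΦθ, Complex.ofReal_re] at key
  -- The three lines inequality reads `S ≤ (MQ)^(1-θ) (SQ)^(θ/2)`. For `S > 0` the power of `S` is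
  -- divided out, leaving `S^(1/p)` because `1 - θ/2 = 1/p`; the `p`-th power concludes, as `p(1-θ)
  -- = 2 - p`.
  rcases hS.eq_or_lt with hS0 | hSpos
  · rw [← hS0]; positivity
  have hsq : (Real.sqrt S * Real.sqrt Q) ^ θ = S ^ (θ / 2) * Q ^ (θ / 2) := by
    rw [Real.mul_rpow (Real.sqrt_nonneg _) (Real.sqrt_nonneg _), Real.sqrt_eq_rpow,
      Real.sqrt_eq_rpow, ← Real.rpow_mul hS, ← Real.rpow_mul hQ]
    ring_nf
  rw [hsq, Real.mul_rpow hM hQ] at key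
  have hQpos : 0 < Q := by
    rcases hQ.eq_or_lt with hQ0 | hQ0
    · exfalso
      rcases hθ0.eq_or_lt with h | h
      · rw [← hQ0, ← h] at key; simp at key; linarith
      · rw [← hQ0, Real.zero_rpow (by linarith : θ / 2 ≠ 0)] at key; simp at key; linarith
    · exact hQ0
  have hp' : 1 - θ / 2 = 1 / p := by rw [hθdef]; ring
  have key2 : S ^ (1 / p) ≤ M ^ (1 - θ) * Q ^ (1 / p) := by
    rw [← hp', Real.rpow_sub hSpos, Real.rpow_one, div_le_iff₀ (by positivity)]
    refine key.trans (le_of_eq ?_)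
    rw [show 1 - θ / 2 = (1 - θ) + θ / 2 by ring, Real.rpow_add hQpos]
    ring
  have key3 := Real.rpow_le_rpow (by positivity) key2 hp0.le
  rw [Real.mul_rpow (by positivity) (by positivity), ← Real.rpow_mul hS, ← Real.rpow_mul hM,
    ← Real.rpow_mul hQ, one_div_mul_cancel hp0.ne', Real.rpow_one, Real.rpow_one] at key3
  refine key3.trans (le_of_eq ?_)
  congr 2
  rw [hθdef]
  field_simp
  ring

variable {P : ι → H →L[ℂ] H}

/-- Interpolation between the weighted `ℓ¹(H)` and `ℓ²(H)` bounds of a contraction. -/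
lemma IsOrthDecomp.interpolation (hP : IsOrthDecomp P) {v : ι → ℝ} (hv : ∀ i, 0 < v i)
    {T : H →L[ℂ] H} (hT : ∀ x, ‖T x‖ ≤ ‖x‖) {M : ℝ} (hM : 0 ≤ M)
    (h1 : ∀ (j : ι) (x : H) (S : Finset ι),
      ∑ i ∈ S, Real.sqrt (v i) * ‖P i (T (P j x))‖ ≤ M * (Real.sqrt (v j) * ‖P j x‖))
    {p : ℝ} (hp1 : 1 ≤ p) (hp2 : p ≤ 2) (S S' : Finset ι) (f : H) :
    ∑ i ∈ S, v i ^ (1 - p / 2) * ‖P i (T (∑ j ∈ S', P j f))‖ ^ p ≤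
      M ^ (2 - p) * ∑ j ∈ S', v j ^ (1 - p / 2) * ‖P j f‖ ^ p := by
  classical
  have hp0 : 0 < p := by linarith
  set u := T (∑ j ∈ S', P j f) with hu
  -- Vanishing blocks are discarded so that the lengths `β`, `γ` are positive and have logarithms.
  set I := S.filter fun i => P i u ≠ 0 with hI
  set J := S'.filter fun j => P j f ≠ 0 with hJ
  have hsum : ∀ (A : Finset ι) (x : H), ∑ i ∈ A, v i ^ (1 - p / 2) * ‖P i x‖ ^ p =
      ∑ i ∈ A.filter (fun i => P i x ≠ 0), v i ^ (1 - p / 2) * ‖P i x‖ ^ p := by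
    intro A x
    rw [Finset.sum_filter_of_ne]
    intro i _ hne h0
    exact hne (by rw [h0, norm_zero, Real.zero_rpow hp0.ne', mul_zero])
  have hfJ : ∑ j ∈ S', P j f = ∑ j ∈ J, P j f := by
    rw [hJ, Finset.sum_filter_of_ne]
    intro j _ hne; exact hne
  rw [hsum S u, hsum S' f]
  set β : ι → ℝ := fun i => ‖P i u‖ / Real.sqrt (v i) with hβ
  set γ : ι → ℝ := fun j => ‖P j f‖ / Real.sqrt (v j) with hγ
  have hsv : ∀ i, 0 < Real.sqrt (v i) := fun i => Real.sqrt_pos.2 (hv i)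
  have hβpos : ∀ i ∈ I, 0 < β i := fun i hi =>
    div_pos (norm_pos_iff.2 (Finset.mem_filter.1 hi).2) (hsv i)
  have hγpos : ∀ j ∈ J, 0 < γ j := fun j hj =>
    div_pos (norm_pos_iff.2 (Finset.mem_filter.1 hj).2) (hsv j)
  have hnu : ∀ i, ‖P i u‖ = β i * Real.sqrt (v i) := fun i =>
    (div_mul_cancel₀ _ (hsv i).ne').symm
  have hnf : ∀ j, ‖P j f‖ = γ j * Real.sqrt (v j) := fun j =>
    (div_mul_cancel₀ _ (hsv j).ne').symm
  have hterm : ∀ (i : ι) (b : ℝ), 0 ≤ b →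
      v i ^ (1 - p / 2) * (b * Real.sqrt (v i)) ^ p = b ^ p * v i := by
    intro i b hb
    rw [Real.mul_rpow hb (hsv i).le, Real.sqrt_eq_rpow, ← Real.rpow_mul (hv i).le]
    calc _ = b ^ p * (v i ^ (1 - p / 2) * v i ^ (1 / 2 * p)) := by ring
      _ = _ := by rw [← Real.rpow_add (hv i)]; ring_nf; simp
  have hSeq : ∑ i ∈ I, v i ^ (1 - p / 2) * ‖P i u‖ ^ p = ∑ i ∈ I, β i ^ p * v i :=
    Finset.sum_congr rfl fun i hi => by rw [hnu, hterm i _ (hβpos i hi).le]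
  have hQeq : ∑ j ∈ J, v j ^ (1 - p / 2) * ‖P j f‖ ^ p = ∑ j ∈ J, γ j ^ p * v j :=
    Finset.sum_congr rfl fun j hj => by rw [hnf, hterm j _ (hγpos j hj).le]
  rw [hSeq, hQeq]
  -- The matrix of `T` between normalized blocks. Pairing it with `β^(p-1)` and `γ` recovers `∑
  -- β_i^p v_i`, since `f` was used to build `u` itself.
  set m : ι → ι → ℂ := fun i j =>
    (((β i)⁻¹ : ℝ) : ℂ) * (((γ j)⁻¹ : ℝ) : ℂ) * inner ℂ (P i u) (T (P j f)) with hm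
  have hcomb : ∀ d c : ι → ℂ, ∑ i ∈ I, ∑ j ∈ J, d i * c j * m i j =
      inner ℂ (∑ i ∈ I, (starRingEnd ℂ (d i) * (((β i)⁻¹ : ℝ) : ℂ)) • P i u)
        (T (∑ j ∈ J, (c j * (((γ j)⁻¹ : ℝ) : ℂ)) • P j f)) := by
    intro d c
    rw [sum_inner]
    refine Finset.sum_congr rfl fun i _ => ?_
    rw [map_sum, inner_sum]
    refine Finset.sum_congr rfl fun j _ => ?_
    rw [map_smul, inner_smul_left, inner_smul_right, hm]
    simp only [map_mul, Complex.conj_conj, Complex.conj_ofReal]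
    ring
  have hsq : ∀ (A : Finset ι) (x : H) (w : ι → ℝ) (c : ι → ℂ), (∀ i ∈ A, 0 < w i) →
      (∀ i, ‖P i x‖ = w i * Real.sqrt (v i)) → (∀ i ∈ A, ‖c i‖ = w i ^ (p / 2)) →
      ‖∑ i ∈ A, (c i * (((w i)⁻¹ : ℝ) : ℂ)) • P i x‖ = Real.sqrt (∑ i ∈ A, w i ^ p * v i) := by
    intro A x w c hw hx hc
    rw [eq_comm, Real.sqrt_eq_iff_mul_self_eq (Finset.sum_nonneg fun i hi =>
      mul_nonneg (Real.rpow_nonneg (hw i hi).le _) (hv i).le) (norm_nonneg _), ← sq,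
      hP.norm_sum_sq A _ (fun _ => x)]
    refine Finset.sum_congr rfl fun i hi => ?_
    rw [norm_mul, hc i hi, hx i, Complex.norm_real, norm_inv, Real.norm_of_nonneg (hw i hi).le,
      show w i ^ (p / 2) * (w i)⁻¹ * (w i * Real.sqrt (v i)) =
        w i ^ (p / 2) * Real.sqrt (v i) * ((w i)⁻¹ * w i) by ring, inv_mul_cancel₀ (hw i hi).ne',
      mul_one, mul_pow, Real.sq_sqrt (hv i).le, ← Real.rpow_natCast, ← Real.rpow_mul (hw i hi).le]
    congr 2
    push_cast
    ring
  refine interpolation_core hp1 hp2 hM hβpos hγpos m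
    (Finset.sum_nonneg fun j hj => mul_nonneg (Real.rpow_nonneg (hγpos j hj).le _) (hv j).le)
    (Finset.sum_nonneg fun i hi => mul_nonneg (Real.rpow_nonneg (hβpos i hi).le _) (hv i).le)
    ?_ ?_ ?_
  · rw [Finset.mul_sum]
    refine Finset.sum_le_sum fun j hj => ?_
    have hγj := hγpos j hj
    calc γ j ^ p * ∑ i ∈ I, ‖m i j‖
        ≤ γ j ^ p * ∑ i ∈ I, (γ j)⁻¹ * (Real.sqrt (v i) * ‖P i (T (P j f))‖) := by
          gcongr with i hi
          have hβi := hβpos i hi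
          rw [hm, norm_mul, norm_mul, Complex.norm_real, Complex.norm_real,
            Real.norm_of_nonneg (by positivity), Real.norm_of_nonneg (by positivity),
            ← hP.idem i u, hP.symm i]
          have := norm_inner_le_norm (𝕜 := ℂ) (P i u) (P i (T (P j f)))
          calc (β i)⁻¹ * (γ j)⁻¹ * ‖inner ℂ (P i u) (P i (T (P j f)))‖
              ≤ (β i)⁻¹ * (γ j)⁻¹ * (‖P i u‖ * ‖P i (T (P j f))‖) := by gcongr
            _ = (γ j)⁻¹ * (Real.sqrt (v i) * ‖P i (T (P j f))‖) * ((β i)⁻¹ * β i) := by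
                rw [hnu]; ring
            _ = _ := by rw [inv_mul_cancel₀ hβi.ne', mul_one]
      _ ≤ γ j ^ p * ((γ j)⁻¹ * (M * (Real.sqrt (v j) * ‖P j f‖))) := by
          rw [← Finset.mul_sum]
          gcongr
          exact h1 j f I
      _ = M * (γ j ^ p * (Real.sqrt (v j) * Real.sqrt (v j))) * ((γ j)⁻¹ * γ j) := by
          rw [hnf]; ring
      _ = M * (γ j ^ p * v j) := by
          rw [inv_mul_cancel₀ hγj.ne', mul_one, Real.mul_self_sqrt (hv j).le]
  · intro d c hd hc
    rw [hcomb, ← hsq I u β (fun i => starRingEnd ℂ (d i)) hβpos hnu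
      (fun i hi => by rw [RCLike.norm_conj, hd i hi]), ← hsq J f γ c hγpos hnf hc]
    exact (norm_inner_le_norm _ _).trans (mul_le_mul_of_nonneg_left (hT _) (norm_nonneg _))
  · have hJu : T (∑ j ∈ J, ((γ j : ℂ) * (((γ j)⁻¹ : ℝ) : ℂ)) • P j f) = u := by
      rw [hu, hfJ]
      congr 1
      refine Finset.sum_congr rfl fun j hj => ?_
      rw [← Complex.ofReal_mul, mul_inv_cancel₀ (hγpos j hj).ne', Complex.ofReal_one, one_smul]
    have h2 := hcomb (fun i => ((β i ^ (p - 1) : ℝ) : ℂ)) (fun j => (γ j : ℂ))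
    simp only [← Complex.ofReal_mul] at h2 hJu
    rw [h2, hJu, sum_inner]
    have h3 : ∀ i ∈ I, inner ℂ ((starRingEnd ℂ ((β i ^ (p - 1) : ℝ) : ℂ) *
        (((β i)⁻¹ : ℝ) : ℂ)) • P i u) u = ((β i ^ p * v i : ℝ) : ℂ) := by
      intro i hi
      have hb := hβpos i hi
      have h4 : inner ℂ (P i u) (P i u) = ((‖P i u‖ ^ 2 : ℝ) : ℂ) := by
        rw [inner_self_eq_norm_sq_to_K]; simp
      rw [Complex.conj_ofReal, ← Complex.ofReal_mul, inner_smul_left, ← hP.idem i u, hP.symm i,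
        h4, hnu, Complex.conj_ofReal, ← Complex.ofReal_mul]
      congr 1
      rw [mul_pow, Real.sq_sqrt (hv i).le, Real.rpow_sub hb, Real.rpow_one]
      field_simp
    rw [Finset.sum_congr rfl h3, ← Complex.ofReal_sum, Complex.norm_real, Real.norm_of_nonneg]
    exact Finset.sum_nonneg fun i hi => mul_nonneg (Real.rpow_nonneg (hβpos i hi).le _) (hv i).le

end Interpolation

/-! ### Multiplication operators on `L²`. -/

section MulOp

variable {X : Type*} [MeasurableSpace X] {μ : Measure X}

/-- The operator of multiplication by a bounded function on `L²`. -/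
def mulOp {φ : X → ℝ} (h : MemLp (fun x => (φ x : ℂ)) ∞ μ) : Lp ℂ 2 μ →L[ℂ] Lp ℂ 2 μ :=
  (ContinuousLinearMap.lsmul ℂ ℂ).holderL μ ∞ 2 2 (h.toLp _)

lemma coeFn_mulOp {φ : X → ℝ} (h : MemLp (fun x => (φ x : ℂ)) ∞ μ) (f : Lp ℂ 2 μ) :
    mulOp h f =ᵐ[μ] fun x => (φ x : ℂ) * f x := by
  have h1 := (ContinuousLinearMap.lsmul ℂ ℂ (E := ℂ)).coeFn_holder (r := 2) (h.toLp _) f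
  filter_upwards [h1, h.coeFn_toLp] with x hx hx'
  exact hx.trans (by rw [hx']; rfl)

lemma memLp_top_of_bounded {φ : X → ℝ} (hφ : Measurable φ) (C : ℝ) (hC : ∀ x, |φ x| ≤ C) :
    MemLp (fun x => (φ x : ℂ)) ∞ μ :=
  memLp_top_of_bound (by fun_prop) C (.of_forall fun x => by simpa using hC x)

lemma inner_mulOp {φ : X → ℝ} (h : MemLp (fun x => (φ x : ℂ)) ∞ μ) (f g : Lp ℂ 2 μ) :
    inner ℂ (mulOp h f) g = inner ℂ f (mulOp h g) := by
  rw [L2.inner_def, L2.inner_def]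
  refine integral_congr_ae ?_
  filter_upwards [coeFn_mulOp h f, coeFn_mulOp h g] with x hx hx'
  rw [hx, hx']
  simp only [RCLike.inner_apply, map_mul, Complex.conj_ofReal]
  ring

end MulOp

/-! ### The orthogonal decomposition of `L²` along a countable measurable partition. -/

section Cells

variable {X ι : Type*} [MeasurableSpace X] [MeasurableSpace ι] [DiscreteMeasurableSpace ι]
  {μ : Measure X} {idx : X → ι}

lemma memLp_top_comp_idx (hidx : Measurable idx) {c : ι → ℝ} (C : ℝ) (hC : ∀ i, |c i| ≤ C) :
    MemLp (fun x => (c (idx x) : ℂ)) ∞ μ :=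
  memLp_top_of_bounded (φ := fun x => c (idx x)) ((Measurable.of_discrete (f := c)).comp hidx) C
    fun x => hC (idx x)

/-- The operator that multiplies by the constant `c i` on the cell `{idx = i}`. -/
def diagOp (μ : Measure X) (hidx : Measurable idx) (c : ι → ℝ) (C : ℝ) (hC : ∀ i, |c i| ≤ C) :
    Lp ℂ 2 μ →L[ℂ] Lp ℂ 2 μ :=
  mulOp (memLp_top_comp_idx hidx C hC)

/-- The projection on the cell `{idx = i}`. -/
def cellProj (μ : Measure X) (hidx : Measurable idx) (i : ι) : Lp ℂ 2 μ →L[ℂ] Lp ℂ 2 μ :=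
  diagOp μ hidx (Set.indicator {i} 1) 1 fun j => by
    by_cases h : j ∈ ({i} : Set ι) <;> simp [h]

lemma coeFn_diagOp (hidx : Measurable idx) {c : ι → ℝ} {C : ℝ} (hC : ∀ i, |c i| ≤ C)
    (f : Lp ℂ 2 μ) : diagOp μ hidx c C hC f =ᵐ[μ] fun x => (c (idx x) : ℂ) * f x :=
  coeFn_mulOp _ f

lemma coeFn_cellProj (hidx : Measurable idx) (i : ι) (f : Lp ℂ 2 μ) :
    cellProj μ hidx i f =ᵐ[μ] (idx ⁻¹' {i}).indicator f := by
  filter_upwards [coeFn_diagOp hidx (c := Set.indicator {i} 1) (C := 1) (fun j => by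
    by_cases h : j ∈ ({i} : Set ι) <;> simp [h]) f] with x hx
  rw [cellProj, hx]
  by_cases h : idx x = i <;> simp [h]

lemma cellProj_diagOp (hidx : Measurable idx) {c : ι → ℝ} {C : ℝ} (hC : ∀ i, |c i| ≤ C) (i : ι)
    (f : Lp ℂ 2 μ) :
    cellProj μ hidx i (diagOp μ hidx c C hC f) = (c i : ℂ) • cellProj μ hidx i f := by
  refine Lp.ext ?_
  filter_upwards [coeFn_cellProj hidx i (diagOp μ hidx c C hC f), coeFn_diagOp hidx hC f,
    coeFn_cellProj hidx i f, Lp.coeFn_smul (c i : ℂ) (cellProj μ hidx i f)] with x h1 h2 h3 h4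
  rw [h1, h4, Pi.smul_apply, h3]
  by_cases h : idx x = i
  · simp [h, h2]
  · simp [h]

lemma inner_diagOp (hidx : Measurable idx) {c : ι → ℝ} {C : ℝ} (hC : ∀ i, |c i| ≤ C)
    (f g : Lp ℂ 2 μ) :
    inner ℂ (diagOp μ hidx c C hC f) g = inner ℂ f (diagOp μ hidx c C hC g) :=
  inner_mulOp _ f g

lemma measurableSet_cell (hidx : Measurable idx) (i : ι) : MeasurableSet (idx ⁻¹' {i}) :=
  hidx (measurableSet_singleton i)

lemma tsum_lintegral_cells [Countable ι] (hidx : Measurable idx) (g : X → ℝ≥0∞) :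
    ∑' i, ∫⁻ x in idx ⁻¹' {i}, g x ∂μ = ∫⁻ x, g x ∂μ := by
  rw [← lintegral_iUnion (measurableSet_cell hidx)]
  · rw [← Set.preimage_iUnion, Set.iUnion_of_singleton, Set.preimage_univ, Measure.restrict_univ]
  · intro i j hij
    exact Disjoint.preimage idx (Set.disjoint_singleton.2 hij)

lemma tsum_eLpNorm_cells [Countable ι] (hidx : Measurable idx) {p : ℝ} (hp : 0 < p)
    (g : X → ℂ) :
    ∑' i, eLpNorm ((idx ⁻¹' {i}).indicator g) (ENNReal.ofReal p) μ ^ p =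
      eLpNorm g (ENNReal.ofReal p) μ ^ p := by
  have hp0 : ENNReal.ofReal p ≠ 0 := by simpa using hp
  have key : ∀ ν : Measure X, eLpNorm g (ENNReal.ofReal p) ν ^ p = ∫⁻ x, ‖g x‖ₑ ^ p ∂ν := by
    intro ν
    rw [eLpNorm_eq_lintegral_rpow_enorm_toReal hp0 ENNReal.ofReal_ne_top,
      ENNReal.toReal_ofReal hp.le, ← ENNReal.rpow_mul, one_div_mul_cancel hp.ne', ENNReal.rpow_one]
  simp only [eLpNorm_indicator_eq_eLpNorm_restrict (measurableSet_cell hidx _), key]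
  exact tsum_lintegral_cells hidx _

lemma tsum_enorm_cellProj_sq [Countable ι] (hidx : Measurable idx) (f : Lp ℂ 2 μ) :
    ∑' i, ‖cellProj μ hidx i f‖ₑ ^ 2 = ‖f‖ₑ ^ 2 := by
  have h := tsum_eLpNorm_cells (μ := μ) hidx (p := 2) two_pos f
  simp only [ENNReal.ofReal_ofNat, ENNReal.rpow_ofNat] at h
  simp only [Lp.enorm_def, eLpNorm_congr_ae (coeFn_cellProj hidx _ f)]
  exact h

lemma cellProj_isOrthDecomp [Countable ι] (hidx : Measurable idx) :
    IsOrthDecomp (cellProj μ hidx) := by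
  have hsymm : ∀ i (x y : Lp ℂ 2 μ),
      inner ℂ (cellProj μ hidx i x) y = inner ℂ x (cellProj μ hidx i y) :=
    fun i x y => inner_diagOp hidx _ x y
  have hcomp : ∀ i j (x : Lp ℂ 2 μ), cellProj μ hidx i (cellProj μ hidx j x) =
      ((Set.indicator {j} (1 : ι → ℝ) i : ℝ) : ℂ) • cellProj μ hidx i x :=
    fun i j x => cellProj_diagOp hidx _ i x
  have hidem : ∀ i (x : Lp ℂ 2 μ), cellProj μ hidx i (cellProj μ hidx i x) =
      cellProj μ hidx i x := fun i x => by simp [hcomp]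
  have horth : ∀ i j, i ≠ j → ∀ x : Lp ℂ 2 μ, cellProj μ hidx i (cellProj μ hidx j x) = 0 :=
    fun i j hij x => by simp [hcomp, hij]
  refine ⟨hsymm, hidem, horth, fun x => ?_⟩
  have hns : HasSum (fun i => ‖cellProj μ hidx i x‖ ^ 2) (‖x‖ ^ 2) := by
    have h1 := tsum_enorm_cellProj_sq hidx x
    have h2 : ∀ i, ENNReal.ofReal (‖cellProj μ hidx i x‖ ^ 2) = ‖cellProj μ hidx i x‖ₑ ^ 2 :=
      fun i => by rw [ENNReal.ofReal_pow (norm_nonneg _), ofReal_norm]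
    have h3 : ∑' i, ENNReal.ofReal (‖cellProj μ hidx i x‖ ^ 2) = ENNReal.ofReal (‖x‖ ^ 2) := by
      simp only [h2, h1]
      rw [ENNReal.ofReal_pow (norm_nonneg _), ofReal_norm]
    have h4 : Summable fun i => ‖cellProj μ hidx i x‖ ^ 2 := by
      have := ENNReal.summable_toReal (f := fun i => ENNReal.ofReal (‖cellProj μ hidx i x‖ ^ 2))
        (h3 ▸ ENNReal.ofReal_ne_top)
      simpa [ENNReal.toReal_ofReal (sq_nonneg _)] using this
    have h5 := ENNReal.ofReal_tsum_of_nonneg (fun i => sq_nonneg ‖cellProj μ hidx i x‖) h4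
    rw [h3] at h5
    have h6 := (ENNReal.ofReal_eq_ofReal_iff (tsum_nonneg fun i => sq_nonneg _)
      (sq_nonneg _)).1 h5
    rw [← h6]
    exact h4.hasSum
  -- Pythagoras turns convergence of the norm squares, which is countable additivity of the
  -- integral, into unconditional convergence of the vectors.
  have key : ∀ S : Finset ι, ‖x - ∑ i ∈ S, cellProj μ hidx i x‖ ^ 2 =
      ‖x‖ ^ 2 - ∑ i ∈ S, ‖cellProj μ hidx i x‖ ^ 2 := by
    intro S
    classical
    set y := ∑ i ∈ S, cellProj μ hidx i x with hy
    have h3 : ∀ z : Lp ℂ 2 μ, (inner ℂ z z).re = ‖z‖ ^ 2 := fun z => by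
      simpa using (inner_self_eq_norm_sq (𝕜 := ℂ) z)
    have hxy : (inner ℂ x y).re = ∑ i ∈ S, ‖cellProj μ hidx i x‖ ^ 2 := by
      rw [hy, inner_sum, Complex.re_sum]
      refine Finset.sum_congr rfl fun i _ => ?_
      rw [← hidem i x, ← hsymm, h3, hidem]
    have hyy : ‖y‖ ^ 2 = ∑ i ∈ S, ‖cellProj μ hidx i x‖ ^ 2 := by
      rw [← h3, hy, sum_inner, Complex.re_sum]
      refine Finset.sum_congr rfl fun i hi => ?_
      rw [hsymm, map_sum, Finset.sum_eq_single i, ← hsymm, h3, ]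
      · intro j _ hj; exact horth i j hj.symm x
      · exact fun hn => absurd hi hn
    have := norm_sub_sq (𝕜 := ℂ) x y
    rw [this]
    change ‖x‖ ^ 2 - 2 * (inner ℂ x y).re + ‖y‖ ^ 2 = _
    rw [hxy, hyy]
    ring
  rw [HasSum, tendsto_iff_norm_sub_tendsto_zero]
  have h0 : Filter.Tendsto (fun S : Finset ι => ‖x - ∑ i ∈ S, cellProj μ hidx i x‖ ^ 2)
      (SummationFilter.unconditional ι).filter (nhds 0) := by
    simp only [key]
    have := (tendsto_const_nhds (x := ‖x‖ ^ 2)).sub hns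
    simpa using this
  have h1 := h0.sqrt
  simp only [Real.sqrt_zero, Real.sqrt_sq (norm_nonneg _)] at h1
  simpa only [norm_sub_rev] using h1

end Cells

/-! ### Nets and volume counting in doubling spaces. -/

section Geometry

/-- Group the indices by dyadic size of `1 + d j`: polynomial growth of order `n` against decay of
order `β > n` gives a geometric series. Used both for counting net points and for summing volumes.
-/
lemma sum_decay_le {n β : ℝ} (hn : 0 ≤ n) (hβ : n < β) : ∃ C : ℝ, 0 ≤ C ∧
    ∀ {ι : Type*} (T : Finset ι) (v d : ι → ℝ) (B : ℝ), (∀ j, 0 ≤ v j) → (∀ j, 0 ≤ d j) →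
      (∀ l : ℝ, 1 ≤ l → ∑ j ∈ T with d j ≤ l, v j ≤ B * l ^ n) →
      ∑ j ∈ T, v j * (1 + d j) ^ (-β) ≤ C * B := by
  set q : ℝ := 2 ^ (n - β) with hq
  have hq0 : 0 ≤ q := by positivity
  have hq1 : q < 1 := Real.rpow_lt_one_of_one_lt_of_neg one_lt_two (by linarith)
  refine ⟨2 ^ n * (1 - q)⁻¹, mul_nonneg (by positivity) (inv_nonneg.2 (by linarith)), ?_⟩
  intro ι T v d B hv hd hB
  have hex : ∀ j, ∃ l : ℕ, (2 : ℝ) ^ l ≤ 1 + d j ∧ 1 + d j < 2 ^ (l + 1) := fun j =>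
    exists_nat_pow_near (by linarith [hd j]) one_lt_two
  choose l hl1 hl2 using hex
  have hB0 : 0 ≤ B := by
    have := (Finset.sum_nonneg fun j _ => hv j).trans (hB 1 le_rfl)
    simpa using this
  obtain ⟨L, hL⟩ : ∃ L, ∀ j ∈ T, l j < L :=
    ⟨T.sup l + 1, fun j hj => Nat.lt_succ_of_le (Finset.le_sup hj)⟩
  have h1 : ∀ j, v j * (1 + d j) ^ (-β) ≤ v j * (2 ^ l j) ^ (-β) := fun j =>
    mul_le_mul_of_nonneg_left (Real.rpow_le_rpow_of_nonpos (by positivity) (hl1 j)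
      (by linarith)) (hv j)
  calc ∑ j ∈ T, v j * (1 + d j) ^ (-β) ≤ ∑ j ∈ T, v j * ((2 : ℝ) ^ l j) ^ (-β) :=
        Finset.sum_le_sum fun j _ => h1 j
    _ = ∑ m ∈ Finset.range L, ∑ j ∈ T with l j = m, v j * ((2 : ℝ) ^ l j) ^ (-β) :=
        (Finset.sum_fiberwise_of_maps_to (fun j hj => Finset.mem_range.2 (hL j hj)) _).symm
    _ ≤ ∑ m ∈ Finset.range L, 2 ^ n * B * q ^ m := by
        refine Finset.sum_le_sum fun m _ => ?_
        calc ∑ j ∈ T with l j = m, v j * ((2 : ℝ) ^ l j) ^ (-β)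
            = (∑ j ∈ T with l j = m, v j) * ((2 : ℝ) ^ m) ^ (-β) := by
              rw [Finset.sum_mul]
              exact Finset.sum_congr rfl fun j hj => by rw [(Finset.mem_filter.1 hj).2]
          _ ≤ (B * (2 ^ (m + 1)) ^ n) * ((2 : ℝ) ^ m) ^ (-β) := by
              refine mul_le_mul_of_nonneg_right ?_ (by positivity)
              refine le_trans ?_ (hB (2 ^ (m + 1)) (one_le_pow₀ one_le_two))
              refine Finset.sum_le_sum_of_subset_of_nonneg (fun j hj => ?_) fun j _ _ => hv j
              rw [Finset.mem_filter] at hj ⊢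
              exact ⟨hj.1, by have := hl2 j; rw [hj.2] at this; linarith⟩
          _ = 2 ^ n * B * q ^ m := by
              have h2 : (0 : ℝ) < 2 := two_pos
              rw [pow_succ, Real.mul_rpow (by positivity) h2.le, hq, ← Real.rpow_natCast,
                ← Real.rpow_natCast, ← Real.rpow_mul h2.le, ← Real.rpow_mul h2.le,
                ← Real.rpow_mul h2.le, show (n - β) * m = m * n + m * (-β) by ring,
                Real.rpow_add h2]
              ring
    _ = 2 ^ n * B * ∑ m ∈ Finset.range L, q ^ m := by rw [Finset.mul_sum]
    _ ≤ 2 ^ n * B * (1 - q)⁻¹ := by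
        refine mul_le_mul_of_nonneg_left ?_ (by positivity)
        rw [← tsum_geometric_of_lt_one hq0 hq1]
        exact (summable_geometric_of_lt_one hq0 hq1).sum_le_tsum _ fun m _ => by positivity
    _ = _ := by ring

variable {X : Type*} [MetricSpace X]

/-- `S` is a `τ`-separated set and `idx` a measurable choice of a point of `S` at distance
less than `τ`. -/
structure IsNet [MeasurableSpace X] (τ : ℝ) (S : Set X) (idx : X → S) : Prop where
  countable : S.Countable
  separated : S.Pairwise fun x y => τ ≤ dist x y
  measurable : Measurable idx
  dist_lt : ∀ z : X, dist z (idx z : X) < τ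

/-- A maximal separated set, from Zorn, is a net; it is countable because its disjoint `τ/2`-balls
are open in a separable space. The index is the first admissible point in an enumeration, which
makes the choice measurable. -/
lemma exists_isNet [TopologicalSpace.SeparableSpace X] [MeasurableSpace X] [BorelSpace X]
    [Nonempty X] {τ : ℝ} (hτ : 0 < τ) : ∃ (S : Set X) (idx : X → S), IsNet τ S idx := by
  obtain ⟨S, hS⟩ := zorn_subset {S : Set X | S.Pairwise fun x y => τ ≤ dist x y}
    fun c hc hchain => ⟨⋃₀ c, by
      rintro x ⟨s, hs, hxs⟩ y ⟨t, ht, hyt⟩ hxy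
      rcases hchain.total hs ht with h | h
      · exact hc ht (h hxs) hyt hxy
      · exact hc hs hxs (h hyt) hxy, fun s hs => Set.subset_sUnion_of_mem hs⟩
  have hsep : S.Pairwise fun x y => τ ≤ dist x y := hS.prop
  have hcov : ∀ z, ∃ x ∈ S, dist z x < τ := by
    intro z
    by_contra hn
    push Not at hn
    have hins : (insert z S).Pairwise fun x y => τ ≤ dist x y := by
      refine hsep.insert fun y hy _ => ⟨hn y hy, ?_⟩
      rw [dist_comm]; exact hn y hy
    have hz : z ∈ S := hS.le_of_ge hins (Set.subset_insert z S) (Set.mem_insert z S)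
    have := hn z hz
    rw [dist_self] at this
    linarith
  have hcount : S.Countable := by
    refine Set.PairwiseDisjoint.countable_of_isOpen (s := fun x => Metric.ball x (τ / 2)) ?_
      (fun x _ => Metric.isOpen_ball) fun x _ => ⟨x, Metric.mem_ball_self (by linarith)⟩
    intro x hx y hy hxy
    exact Metric.ball_disjoint_ball (by linarith [hsep hx hy hxy])
  obtain ⟨x₀, hx₀, -⟩ := hcov (Classical.arbitrary X)
  have : Countable S := hcount
  have : Nonempty S := ⟨⟨x₀, hx₀⟩⟩
  obtain ⟨e, he⟩ := exists_surjective_nat S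
  have hfind : ∀ z : X, ∃ m, dist z (e m : X) < τ := fun z => by
    obtain ⟨x, hx, hzx⟩ := hcov z
    obtain ⟨m, hm⟩ := he ⟨x, hx⟩
    exact ⟨m, by rw [hm]; exact hzx⟩
  classical
  refine ⟨S, fun z => e (Nat.find (hfind z)), hcount, hsep, ?_, fun z => Nat.find_spec (hfind z)⟩
  refine (Measurable.of_discrete (f := e)).comp (measurable_find hfind fun m => ?_)
  exact measurableSet_lt (by fun_prop) measurable_const

variable [MeasurableSpace X] {μ : Measure X} {n : ℝ}

lemma IsHomogeneousType.exists_doubling (hμ : IsHomogeneousType μ n) : ∃ D : ℝ, 1 ≤ D ∧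
    ∀ (x : X) (r l : ℝ), 0 < r → 1 ≤ l →
      μ.real (Metric.ball x (l * r)) ≤ D * l ^ n * μ.real (Metric.ball x r) := by
  obtain ⟨-, D, hD⟩ := hμ
  refine ⟨max D 1, le_max_right _ _, fun x r l hr hl => (hD x r l hr hl).trans ?_⟩
  gcongr
  exact le_max_left _ _

/-- By doubling, one null ball makes all concentric dilates null, and these exhaust `X`. -/
lemma IsHomogeneousType.measureReal_ball_pos (hμ : IsHomogeneousType μ n) (h0 : μ ≠ 0) (x : X)
    {r : ℝ} (hr : 0 < r) : 0 < μ.real (Metric.ball x r) := by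
  obtain ⟨D, hD1, hD⟩ := hμ.exists_doubling
  refine lt_of_le_of_ne measureReal_nonneg fun h => h0 ?_
  have hz : ∀ k : ℕ, μ (Metric.ball x ((k + 1 : ℝ) * r)) = 0 := fun k => by
    have h1 := hD x r (k + 1) hr (by linarith [(Nat.cast_nonneg k : (0 : ℝ) ≤ k)])
    rw [← h, mul_zero] at h1
    have h2 := le_antisymm h1 measureReal_nonneg
    rwa [measureReal_eq_zero_iff (hμ.1 x _).ne] at h2
  rw [← Measure.measure_univ_eq_zero]
  have hU : (Set.univ : Set X) = ⋃ k : ℕ, Metric.ball x ((k + 1 : ℝ) * r) := by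
    symm
    refine Set.eq_univ_of_forall fun y => Set.mem_iUnion.2 ?_
    obtain ⟨k, hk⟩ := exists_nat_gt (dist y x / r)
    exact ⟨k, by rw [Metric.mem_ball, ← div_lt_iff₀ hr]; linarith⟩
  rw [hU]
  exact measure_iUnion_null hz

/-- Doubling data, with the constant made explicit. -/
structure IsDoubling (μ : Measure X) (n D : ℝ) : Prop where
  one_le : 1 ≤ D
  finite : ∀ (x : X) (r : ℝ), μ (Metric.ball x r) < ∞
  pos : ∀ (x : X) {r : ℝ}, 0 < r → 0 < μ.real (Metric.ball x r)
  doubling : ∀ (x : X) (r l : ℝ), 0 < r → 1 ≤ l →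
    μ.real (Metric.ball x (l * r)) ≤ D * l ^ n * μ.real (Metric.ball x r)

variable {D τ : ℝ} {S : Set X} {idx : X → S}

lemma IsDoubling.ball_le_of_dist_lt (hD : IsDoubling μ n D) (hτ : 0 < τ) {x y : X}
    (hxy : dist x y < τ) :
    μ.real (Metric.ball x τ) ≤ D * 2 ^ n * μ.real (Metric.ball y τ) :=
  (measureReal_mono (Metric.ball_subset_ball' (by linarith)) (hD.finite _ _).ne).trans
    (hD.doubling y τ 2 hτ one_le_two)

variable [BorelSpace X]

lemma IsDoubling.sum_half_balls_le (hD : IsDoubling μ n D) (hτ : 0 < τ) (hS : IsNet τ S idx)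
    (x : X) (T : Finset S) {l : ℝ} (hl : 1 ≤ l) :
    ∑ j ∈ T with dist x (j : S) / τ ≤ l, μ.real (Metric.ball (j : X) (τ / 2)) ≤
      μ.real (Metric.ball x (2 * l * τ)) := by
  have hdisj : ((T.filter fun j : S => dist x j / τ ≤ l : Finset S) : Set S).PairwiseDisjoint
      fun j : S => Metric.ball (j : X) (τ / 2) := by
    intro i _ j _ hij
    refine Metric.ball_disjoint_ball ?_
    linarith [hS.separated i.2 j.2 (fun h => hij (Subtype.ext h))]
  rw [← measureReal_biUnion_finset hdisj (fun j _ => measurableSet_ball)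
    (fun j _ => (hD.finite _ _).ne)]
  refine measureReal_mono (Set.iUnion₂_subset fun j hj => ?_) (hD.finite _ _).ne
  have hj' := (Finset.mem_filter.1 hj).2
  rw [div_le_iff₀ hτ] at hj'
  refine Metric.ball_subset_ball' ?_
  rw [dist_comm]
  nlinarith

lemma IsDoubling.sum_balls_le (hD : IsDoubling μ n D) (hτ : 0 < τ) (hS : IsNet τ S idx)
    (x : X) (T : Finset S) {l : ℝ} (hl : 1 ≤ l) :
    ∑ j ∈ T with dist x (j : S) / τ ≤ l, μ.real (Metric.ball (j : X) τ) ≤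
      D * 2 ^ n * (D * 2 ^ n) * μ.real (Metric.ball x τ) * l ^ n := by
  have hD0 : 0 < D := lt_of_lt_of_le one_pos hD.one_le
  calc _ ≤ ∑ j ∈ T with dist x (j : S) / τ ≤ l,
          D * 2 ^ n * μ.real (Metric.ball (j : X) (τ / 2)) := by
        refine Finset.sum_le_sum fun j _ => ?_
        have := hD.doubling (j : X) (τ / 2) 2 (by linarith) one_le_two
        rwa [mul_div_cancel₀ _ (two_ne_zero : (2 : ℝ) ≠ 0)] at this
    _ ≤ D * 2 ^ n * μ.real (Metric.ball x (2 * l * τ)) := by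
        rw [← Finset.mul_sum]
        exact mul_le_mul_of_nonneg_left (hD.sum_half_balls_le hτ hS x T hl) (by positivity)
    _ ≤ D * 2 ^ n * (D * (2 * l) ^ n * μ.real (Metric.ball x τ)) := by
        refine mul_le_mul_of_nonneg_left (hD.doubling x τ (2 * l) hτ (by linarith)) (by positivity)
    _ = _ := by rw [Real.mul_rpow (by norm_num) (by linarith)]; ring

/-- The disjoint half-balls lie in `B(x, 2lτ)`, and each carries a fixed fraction of its measure:
`B(x, 2lτ)` lies in `B(j, 3lτ)`, the dilate of `B(j, τ/2)` by `6l`. -/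
lemma IsDoubling.card_le (hD : IsDoubling μ n D) (hτ : 0 < τ) (hS : IsNet τ S idx)
    (x : X) (T : Finset S) {l : ℝ} (hl : 1 ≤ l) :
    ∑ j ∈ T with dist x (j : S) / τ ≤ l, (1 : ℝ) ≤ D * 6 ^ n * l ^ n := by
  have hD0 : 0 < D := lt_of_lt_of_le one_pos hD.one_le
  have hV := hD.pos x (r := 2 * l * τ) (by positivity)
  have key : ∑ j ∈ T with dist x (j : S) / τ ≤ l, μ.real (Metric.ball x (2 * l * τ)) ≤
      D * 6 ^ n * l ^ n * μ.real (Metric.ball x (2 * l * τ)) := by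
    calc _ ≤ ∑ j ∈ T with dist x (j : S) / τ ≤ l,
          D * (6 * l) ^ n * μ.real (Metric.ball (j : X) (τ / 2)) := by
          refine Finset.sum_le_sum fun j hj => ?_
          have hj' := (Finset.mem_filter.1 hj).2
          rw [div_le_iff₀ hτ] at hj'
          refine le_trans (measureReal_mono (Metric.ball_subset_ball' ?_) (hD.finite _ _).ne)
            (hD.doubling (j : X) (τ / 2) (6 * l) (by linarith) (by linarith))
          linarith
      _ ≤ D * (6 * l) ^ n * μ.real (Metric.ball x (2 * l * τ)) := by
          rw [← Finset.mul_sum]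
          exact mul_le_mul_of_nonneg_left (hD.sum_half_balls_le hτ hS x T hl) (by positivity)
      _ = _ := by rw [Real.mul_rpow (by norm_num) (by linarith)]; ring
  have h2 : (∑ j ∈ T with dist x (j : S) / τ ≤ l, (1 : ℝ)) * μ.real (Metric.ball x (2 * l * τ)) ≤
      D * 6 ^ n * l ^ n * μ.real (Metric.ball x (2 * l * τ)) := by
    simpa [Finset.sum_mul] using key
  exact le_of_mul_le_mul_right h2 hV

lemma IsDoubling.sum_decay (hn : 0 ≤ n) {β : ℝ} (hβ : n < β) : ∃ C : ℝ, 0 ≤ C ∧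
    ∀ {μ : Measure X}, IsDoubling μ n D → ∀ {τ : ℝ} {S : Set X} {idx : X → S}, 0 < τ →
      IsNet τ S idx → ∀ (x : X) (T : Finset S), ∑ j ∈ T, (1 + dist x (j : S) / τ) ^ (-β) ≤ C := by
  obtain ⟨C, hC0, hC⟩ := sum_decay_le hn hβ
  refine ⟨C * (max D 0 * 6 ^ n), by positivity, fun hD τ S idx hτ hS x T => ?_⟩
  have := hC T (fun _ => 1) (fun j => dist x (j : S) / τ) (max D 0 * 6 ^ n) (fun _ => zero_le_one)
    (fun j => by positivity) fun l hl => (hD.card_le hτ hS x T hl).trans (by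
      gcongr
      exact le_max_left _ _)
  simpa using this

/-- Rescale distances by `ρ`: the factored-out `ρ^(-β)` and the volume growth `ρ^n` make up
`ρ^(n-β)`, whose precise power yields the growth rate in time. -/
lemma IsDoubling.sum_decay_volume (hn : 0 ≤ n) {β : ℝ} (hβ : n < β) : ∃ C : ℝ, 0 ≤ C ∧
    ∀ {μ : Measure X}, IsDoubling μ n D → ∀ {τ : ℝ} {S : Set X} {idx : X → S}, 0 < τ →
      IsNet τ S idx → ∀ (x : X) (T : Finset S) {ρ : ℝ}, 1 ≤ ρ →
      ∑ j ∈ T, μ.real (Metric.ball (j : X) τ) * (ρ + dist x (j : S) / τ) ^ (-β) ≤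
        C * ρ ^ (n - β) * μ.real (Metric.ball x τ) := by
  obtain ⟨C, hC0, hC⟩ := sum_decay_le hn hβ
  refine ⟨C * (D * 2 ^ n * (D * 2 ^ n)), mul_nonneg hC0 (mul_self_nonneg _), fun {μ} hD τ S idx hτ hS x T ρ hρ => ?_⟩
  have hρ0 : 0 < ρ := by linarith
  have := hC T (fun j => μ.real (Metric.ball (j : X) τ)) (fun j => dist x (j : S) / τ / ρ)
    (D * 2 ^ n * (D * 2 ^ n) * μ.real (Metric.ball x τ) * ρ ^ n)
    (fun _ => measureReal_nonneg) (fun j => by positivity) fun l hl => by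
      simp only [div_le_iff₀ hρ0]
      refine (hD.sum_balls_le hτ hS x T (l := l * ρ) (by nlinarith)).trans (le_of_eq ?_)
      rw [Real.mul_rpow (by linarith) hρ0.le]
      ring
  calc _ = ρ ^ (-β) * ∑ j ∈ T, μ.real (Metric.ball (j : X) τ) *
        (1 + dist x (j : S) / τ / ρ) ^ (-β) := by
        rw [Finset.mul_sum]
        refine Finset.sum_congr rfl fun j _ => ?_
        have h1 : ρ + dist x (j : S) / τ = ρ * (1 + dist x (j : S) / τ / ρ) := by
          field_simp
        rw [h1, Real.mul_rpow hρ0.le (by positivity)]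
        ring
    _ ≤ ρ ^ (-β) * (C * (D * 2 ^ n * (D * 2 ^ n) * μ.real (Metric.ball x τ) * ρ ^ n)) :=
        mul_le_mul_of_nonneg_left this (by positivity)
    _ = _ := by
        rw [show n - β = n + -β by ring, Real.rpow_add hρ0]
        ring

end Geometry

/-! ### Schur tests for matrices and for block operators. -/

section Schur

/-- Schur's test in `ℓ^p`. -/
lemma schur_test {ι : Type*} (T₁ T₂ : Finset ι) {k : ι → ι → ℝ} {C p : ℝ}
    (hp : 1 ≤ p) (hk : ∀ i j, 0 ≤ k i j) (h₁ : ∀ i, ∑ j ∈ T₂, k i j ≤ C)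
    (h₂ : ∀ j, ∑ i ∈ T₁, k i j ≤ C) {b : ι → ℝ} (hb : ∀ j, 0 ≤ b j) :
    ∑ i ∈ T₁, (∑ j ∈ T₂, k i j * b j) ^ p ≤ C ^ p * ∑ j ∈ T₂, b j ^ p := by
  have hp0 : 0 < p := by linarith
  rcases T₂.eq_empty_or_nonempty with rfl | ⟨j₀, -⟩
  · simp [Real.zero_rpow hp0.ne']
  have hC : 0 ≤ C := (Finset.sum_nonneg fun i _ => hk i j₀).trans (h₂ j₀)
  have hnn : ∀ i, 0 ≤ ∑ j ∈ T₂, k i j * b j ^ p := fun i =>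
    Finset.sum_nonneg fun j _ => mul_nonneg (hk i j) (Real.rpow_nonneg (hb j) _)
  -- Hölder with `k i ·` as weights; the column sums then supply the last factor `C`.
  have hrow : ∀ i, (∑ j ∈ T₂, k i j * b j) ^ p ≤ C ^ (p - 1) * ∑ j ∈ T₂, k i j * b j ^ p := by
    intro i
    have h := Real.inner_le_weight_mul_Lp_of_nonneg T₂ hp (fun j => k i j) b (hk i) hb
    have hs : 0 ≤ ∑ j ∈ T₂, k i j := Finset.sum_nonneg fun j _ => hk i j
    calc (∑ j ∈ T₂, k i j * b j) ^ p
        ≤ ((∑ j ∈ T₂, k i j) ^ (1 - p⁻¹) * (∑ j ∈ T₂, k i j * b j ^ p) ^ p⁻¹) ^ p :=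
          Real.rpow_le_rpow (Finset.sum_nonneg fun j _ => mul_nonneg (hk i j) (hb j)) h hp0.le
      _ = (∑ j ∈ T₂, k i j) ^ (p - 1) * ∑ j ∈ T₂, k i j * b j ^ p := by
          rw [Real.mul_rpow (by positivity) (Real.rpow_nonneg (hnn i) _), ← Real.rpow_mul hs,
            ← Real.rpow_mul (hnn i), inv_mul_cancel₀ hp0.ne', Real.rpow_one, sub_mul,
            inv_mul_cancel₀ hp0.ne', one_mul]
      _ ≤ _ := by
          refine mul_le_mul_of_nonneg_right ?_ (hnn i)
          exact Real.rpow_le_rpow hs (h₁ i) (by linarith)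
  calc _ ≤ ∑ i ∈ T₁, C ^ (p - 1) * ∑ j ∈ T₂, k i j * b j ^ p := Finset.sum_le_sum fun i _ => hrow i
    _ = C ^ (p - 1) * ∑ j ∈ T₂, (∑ i ∈ T₁, k i j) * b j ^ p := by
        rw [← Finset.mul_sum, Finset.sum_comm]
        simp only [Finset.sum_mul]
    _ ≤ C ^ (p - 1) * ∑ j ∈ T₂, C * b j ^ p := by
        gcongr with j _
        · exact Real.rpow_nonneg (hb j) _
        · exact h₂ j
    _ = _ := by
        rw [← Finset.mul_sum, ← mul_assoc]
        congr 1
        rcases hC.eq_or_lt with h | h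
        · rw [← h, mul_zero, Real.zero_rpow hp0.ne']
        · rw [Real.rpow_sub_one h.ne', div_mul_cancel₀ _ h.ne']

variable {H ι : Type*} [NormedAddCommGroup H] [InnerProductSpace ℂ H] {P : ι → H →L[ℂ] H}

lemma IsOrthDecomp.sum_norm_sq_le (hP : IsOrthDecomp P) (T : Finset ι) (x : H) :
    ∑ i ∈ T, ‖P i x‖ ^ 2 ≤ ‖x‖ ^ 2 :=
  sum_le_hasSum T (fun _ _ => sq_nonneg _) (hP.hasSum_norm_sq x)

/-- Schur's test for operators given by blocks. -/
lemma IsOrthDecomp.norm_le_of_blocks (hP : IsOrthDecomp P) {L : H →L[ℂ] H} {k : ι → ι → ℝ} {C : ℝ}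
    (hC : 0 ≤ C) (hk : ∀ i j, 0 ≤ k i j) (h₁ : ∀ i (T : Finset ι), ∑ j ∈ T, k i j ≤ C)
    (h₂ : ∀ j (T : Finset ι), ∑ i ∈ T, k i j ≤ C)
    (hL : ∀ i j x, ‖P i (L (P j x))‖ ≤ k i j * ‖P j x‖) (x : H) : ‖L x‖ ≤ C * ‖x‖ := by
  have hfin : ∀ T : Finset ι, ‖L (∑ j ∈ T, P j x)‖ ≤ C * ‖x‖ := by
    intro T
    have hsq : ‖L (∑ j ∈ T, P j x)‖ ^ 2 ≤ (C * ‖x‖) ^ 2 := by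
      refine hasSum_le_of_sum_le (hP.hasSum_norm_sq (L (∑ j ∈ T, P j x))) fun T' => ?_
      have h := schur_test T' T (p := 2) one_le_two hk (fun i => h₁ i T) (fun j => h₂ j T')
        (b := fun j => ‖P j x‖) (fun j => norm_nonneg _)
      simp only [Real.rpow_ofNat] at h
      calc ∑ i ∈ T', ‖P i (L (∑ j ∈ T, P j x))‖ ^ 2
          ≤ ∑ i ∈ T', (∑ j ∈ T, k i j * ‖P j x‖) ^ 2 := by
            refine Finset.sum_le_sum fun i _ => ?_
            refine pow_le_pow_left₀ (norm_nonneg _) ?_ 2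
            rw [map_sum, map_sum]
            exact (norm_sum_le _ _).trans (Finset.sum_le_sum fun j _ => hL i j x)
        _ ≤ C ^ 2 * ∑ j ∈ T, ‖P j x‖ ^ 2 := h
        _ ≤ C ^ 2 * ‖x‖ ^ 2 := by gcongr; exact hP.sum_norm_sq_le T x
        _ = _ := by ring
    exact le_of_sq_le_sq hsq (by positivity)
  have hlim : Filter.Tendsto (fun T : Finset ι => ‖L (∑ j ∈ T, P j x)‖) Filter.atTop
      (nhds ‖L x‖) :=
    ((L.continuous.tendsto x).comp (hP.hasSum x)).norm
  exact le_of_tendsto' hlim hfin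

end Schur

/-! ### Weighted energy estimates for `exp(itA)`. -/

section Propagation

variable {H : Type*} [NormedAddCommGroup H] [InnerProductSpace ℂ H] [CompleteSpace H]

/-- The unitary group `exp(i t A)`. -/
def unitaryGroup (A : H →L[ℂ] H) (t : ℝ) : H →L[ℂ] H :=
  NormedSpace.exp (t • (Complex.I • A))

lemma unitaryGroup_neg (A : H →L[ℂ] H) (t : ℝ) : unitaryGroup (-A) (-t) = unitaryGroup A t := by
  simp [unitaryGroup]

/-- With `u = exp(itA) f`, the derivative of `‖W u‖²` is `2 Re ⟨W u, iWAu⟩`. Replacing `WA` by `AW`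
costs a commutator, and `Re ⟨W u, iA(W u)⟩ = 0` by self-adjointness; Gronwall finishes. -/
lemma norm_mul_unitaryGroup_le_of_nonneg {A W : H →L[ℂ] H} (hA : IsSelfAdjoint A) {c : ℝ}
    (hW : ∀ u, ‖W (A u) - A (W u)‖ ≤ c * ‖W u‖) {t : ℝ} (ht : 0 ≤ t) (f : H) :
    ‖W (unitaryGroup A t f)‖ ≤ Real.exp (c * t) * ‖W f‖ := by
  set w : ℝ → H := fun r => W (unitaryGroup A r f) with hw
  have hder : ∀ r, HasDerivAt w (W (Complex.I • A (unitaryGroup A r f))) r := by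
    intro r
    have h1 : HasDerivAt (fun r : ℝ => unitaryGroup A r)
        ((Complex.I • A) * unitaryGroup A r) r :=
      hasDerivAt_exp_smul_const' (𝕂 := ℝ) (Complex.I • A) r
    have h2 := ((ContinuousLinearMap.apply ℂ H f).restrictScalars ℝ).hasFDerivAt.comp_hasDerivAt r h1
    exact (W.restrictScalars ℝ).hasFDerivAt.comp_hasDerivAt r h2
  have hreal : ∀ x : H, (inner ℂ x (Complex.I • A x)).re = 0 := by
    intro x
    rw [inner_smul_right]
    have := hA.isSymmetric
    have him : (inner ℂ x (A x)).im = 0 := by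
      have h := this x x
      rw [ContinuousLinearMap.coe_coe, ← inner_conj_symm] at h
      exact Complex.conj_eq_iff_im.1 h
    simp [him]
  have hg : ∀ r, HasDerivAt (fun r => ‖w r‖ ^ 2)
      (2 * (inner ℂ (w r) (W (Complex.I • A (unitaryGroup A r f)))).re) r := by
    intro r
    let _ : InnerProductSpace ℝ H := InnerProductSpace.rclikeToReal ℂ H
    have := (hder r).norm_sq
    rw [real_inner_eq_re_inner ℂ] at this
    exact this
  have hbound : ∀ r, ‖2 * (inner ℂ (w r) (W (Complex.I • A (unitaryGroup A r f)))).re‖ ≤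
      2 * c * ‖‖w r‖ ^ 2‖ + 0 := by
    intro r
    set u := unitaryGroup A r f with hu
    have h1 : W (Complex.I • A u) = Complex.I • (W (A u) - A (W u)) + Complex.I • A (W u) := by
      rw [map_smul, smul_sub, sub_add_cancel]
    rw [h1, inner_add_right, Complex.add_re, hw, hreal, add_zero]
    rw [norm_mul, Real.norm_ofNat, Real.norm_of_nonneg (sq_nonneg _), add_zero, mul_assoc]
    refine mul_le_mul_of_nonneg_left ?_ zero_le_two
    calc ‖(inner ℂ (W u) (Complex.I • (W (A u) - A (W u)))).re‖
        ≤ ‖inner ℂ (W u) (Complex.I • (W (A u) - A (W u)))‖ := Complex.abs_re_le_norm _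
      _ ≤ ‖W u‖ * ‖Complex.I • (W (A u) - A (W u))‖ := norm_inner_le_norm _ _
      _ ≤ ‖W u‖ * (c * ‖W u‖) := by
          rw [norm_smul, Complex.norm_I, one_mul]
          exact mul_le_mul_of_nonneg_left (hW u) (norm_nonneg _)
      _ = _ := by ring
  have h0 : w 0 = W f := by simp [hw, unitaryGroup]
  have key := norm_le_gronwallBound_of_norm_deriv_right_le (f := fun r => ‖w r‖ ^ 2) (a := 0)
    (b := t) (δ := ‖W f‖ ^ 2) (K := 2 * c) (ε := 0)
    (fun r _ => (hg r).continuousAt.continuousWithinAt) (fun r _ => (hg r).hasDerivWithinAt)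
    (by rw [h0]; simp) (fun r _ => hbound r) t ⟨ht, le_rfl⟩
  rw [gronwallBound_ε0, sub_zero, Real.norm_of_nonneg (sq_nonneg _)] at key
  refine le_of_sq_le_sq (key.trans (le_of_eq ?_)) (by positivity)
  rw [mul_pow, ← Real.exp_nat_mul]
  push_cast
  ring_nf

lemma norm_mul_unitaryGroup_le {A W : H →L[ℂ] H} (hA : IsSelfAdjoint A) {c : ℝ}
    (hW : ∀ u, ‖W (A u) - A (W u)‖ ≤ c * ‖W u‖) (t : ℝ) (f : H) :
    ‖W (unitaryGroup A t f)‖ ≤ Real.exp (c * |t|) * ‖W f‖ := by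
  rcases le_total 0 t with ht | ht
  · rw [abs_of_nonneg ht]
    exact norm_mul_unitaryGroup_le_of_nonneg hA hW ht f
  · rw [abs_of_nonpos ht, ← unitaryGroup_neg]
    refine norm_mul_unitaryGroup_le_of_nonneg hA.neg (fun u => ?_) (by linarith) f
    have := hW u
    rwa [neg_apply, neg_apply, map_neg, sub_neg_eq_add,
      neg_add_eq_sub, norm_sub_rev]

lemma norm_unitaryGroup_le {A : H →L[ℂ] H} (hA : IsSelfAdjoint A) (t : ℝ) (f : H) :
    ‖unitaryGroup A t f‖ ≤ ‖f‖ := by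
  have := norm_mul_unitaryGroup_le (W := ContinuousLinearMap.id ℂ H) (c := 0) hA (by simp) t f
  simpa using this

end Propagation

/-! ### Off-diagonal estimates for the blocks of `A` along a net. -/

section Blocks

variable {X : Type*} [MetricSpace X] [MeasurableSpace X] {μ : Measure X}
  {n D τ p a K : ℝ} {S : Set X} {idx : X → S}

lemma IsNet.cell_subset_ball (hS : IsNet τ S idx) (i : S) :
    idx ⁻¹' {i} ⊆ Metric.ball (i : X) τ := fun z hz => by
  have := hS.dist_lt z
  rwa [show idx z = i from hz] at this

variable [BorelSpace X] {A : Lp ℂ 2 μ →L[ℂ] Lp ℂ 2 μ}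

/-- The projections on the cells of a net. -/
def IsNet.proj (hS : IsNet τ S idx) (μ : Measure X) (i : S) : Lp ℂ 2 μ →L[ℂ] Lp ℂ 2 μ :=
  haveI : Countable S := hS.countable
  cellProj μ hS.measurable i

lemma IsNet.coeFn_proj (hS : IsNet τ S idx) (i : S) (f : Lp ℂ 2 μ) :
    hS.proj μ i f =ᵐ[μ] (idx ⁻¹' {i}).indicator f :=
  haveI : Countable S := hS.countable
  coeFn_cellProj hS.measurable i f

lemma IsNet.isOrthDecomp (hS : IsNet τ S idx) (μ : Measure X) : IsOrthDecomp (hS.proj μ) :=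
  haveI : Countable S := hS.countable
  cellProj_isOrthDecomp hS.measurable

lemma IsNet.tsum_eLpNorm_proj (hS : IsNet τ S idx) (hp : 0 < p) (f : Lp ℂ 2 μ) :
    ∑' i, eLpNorm (hS.proj μ i f) (ENNReal.ofReal p) μ ^ p =
      eLpNorm f (ENNReal.ofReal p) μ ^ p := by
  have : Countable S := hS.countable
  rw [← tsum_eLpNorm_cells hS.measurable hp f]
  simp only [eLpNorm_congr_ae (hS.coeFn_proj _ f)]

lemma IsNet.measurableSet_cell (hS : IsNet τ S idx) (i : S) : MeasurableSet (idx ⁻¹' {i}) :=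
  hS.measurable (measurableSet_singleton i)

lemma PVE.pos [Nonempty X] (h : PVE μ n a p τ K A) : 0 < K := by
  have h1 := h (Classical.arbitrary X) (Classical.arbitrary X)
  have h2 := ENNReal.ofReal_pos.1 (lt_of_le_of_lt zero_le h1)
  simpa using h2

lemma IsNet.eLpNorm_proj_le (hS : IsNet τ S idx) (hD : IsDoubling μ n D) (hτ : 0 < τ)
    (hp1 : 1 ≤ p) (hp2 : p < 2) (i : S) (f : Lp ℂ 2 μ) :
    eLpNorm (hS.proj μ i f) (ENNReal.ofReal p) μ ≤
      ENNReal.ofReal (μ.real (Metric.ball (i : X) τ) ^ (1 / p - 1 / 2)) * ‖hS.proj μ i f‖ₑ := by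
  have hσ : 0 ≤ 1 / p - 1 / 2 :=
    sub_nonneg.2 (one_div_le_one_div_of_le (by linarith) hp2.le)
  rw [Lp.enorm_def, eLpNorm_congr_ae (hS.coeFn_proj i f), eLpNorm_congr_ae (hS.coeFn_proj i f),
    eLpNorm_indicator_eq_eLpNorm_restrict (hS.measurableSet_cell i),
    eLpNorm_indicator_eq_eLpNorm_restrict (hS.measurableSet_cell i)]
  refine (eLpNorm_le_eLpNorm_mul_rpow_measure_univ (q := 2) ?_
    (Lp.aestronglyMeasurable f).restrict).trans ?_
  · rw [← ENNReal.ofReal_ofNat]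
    exact ENNReal.ofReal_le_ofReal hp2.le
  · rw [mul_comm, Measure.restrict_apply_univ, ENNReal.toReal_ofReal (by linarith),
      ENNReal.toReal_ofNat, ← ENNReal.ofReal_rpow_of_pos (hD.pos _ hτ)]
    gcongr
    rw [ofReal_measureReal (hD.finite _ _).ne]
    exact measure_mono (hS.cell_subset_ball i)

lemma IsNet.ballProj_proj (hS : IsNet τ S idx) (j : S) (f : Lp ℂ 2 μ) :
    ballProj μ (j : X) τ (hS.proj μ j f) = hS.proj μ j f := by
  refine Lp.ext ?_
  refine (MemLp.coeFn_toLp _).trans ?_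
  filter_upwards [hS.coeFn_proj j f] with x hx
  by_cases hxb : x ∈ Metric.ball (j : X) τ
  · rw [Set.indicator_of_mem hxb]
  · rw [Set.indicator_of_notMem hxb, hx, Set.indicator_of_notMem
      fun h => hxb (hS.cell_subset_ball j h)]

/-- The off-diagonal estimate for the blocks of `A`. -/
lemma PVE.block_le (h : PVE μ n a p τ K A) (hS : IsNet τ S idx) (hD : IsDoubling μ n D)
    (hτ : 0 < τ) (hp1 : 1 ≤ p) (hp2 : p < 2) (i j : S) (f : Lp ℂ 2 μ) :
    ENNReal.ofReal (μ.real (Metric.ball (i : X) τ) ^ (1 / p - 1 / 2)) *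
        ‖hS.proj μ i (A (hS.proj μ j f))‖ₑ ≤
      ENNReal.ofReal ((D * 2 ^ n) ^ (1 / p - 1 / 2) *
        (K * (1 + dist (i : X) j / τ) ^ (-n - a))) *
        eLpNorm (hS.proj μ j f) (ENNReal.ofReal p) μ := by
  have hσ : 0 ≤ 1 / p - 1 / 2 :=
    sub_nonneg.2 (one_div_le_one_div_of_le (by linarith) hp2.le)
  have hD0 : 0 < D := lt_of_lt_of_le one_pos hD.one_le
  set g := hS.proj μ j f with hg
  set V := μ.real (Metric.ball (i : X) τ) with hV
  have hgm : MemLp g (ENNReal.ofReal p) μ := ⟨Lp.aestronglyMeasurable g,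
    (hS.eLpNorm_proj_le hD hτ hp1 hp2 j f).trans_lt
      (ENNReal.mul_lt_top ENNReal.ofReal_lt_top enorm_lt_top)⟩
  have h1 : eLpNorm (localized μ A (1 / p - 1 / 2) τ i j g) 2 μ ≤
      ENNReal.ofReal (K * (1 + dist (i : X) j / τ) ^ (-n - a)) *
        eLpNorm g (ENNReal.ofReal p) μ := by
    have hsup : eLpNorm (localized μ A (1 / p - 1 / 2) τ i j g) 2 μ /
        eLpNorm g (ENNReal.ofReal p) μ ≤
        ENNReal.ofReal (K * (1 + dist (i : X) j / τ) ^ (-n - a)) :=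
      le_trans (le_iSup₂ (f := fun (f : Lp ℂ 2 μ) (_ : MemLp f (ENNReal.ofReal p) μ) =>
        eLpNorm (localized μ A (1 / p - 1 / 2) τ i j f) 2 μ / eLpNorm f (ENNReal.ofReal p) μ)
        g hgm) (h i j).le
    -- A zero denominator cannot be cleared from the quotient, but then `g = 0` and the left side
    -- vanishes.
    by_cases h0 : eLpNorm g (ENNReal.ofReal p) μ = 0
    · have hg0 : g = 0 := by
        rw [eLpNorm_eq_zero_iff (Lp.aestronglyMeasurable g) (by simpa using by linarith)] at h0
        exact (Lp.eq_zero_iff_ae_eq_zero).2 h0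
      have hbp : ballProj μ (j : X) τ g = 0 := by rw [hg, hS.ballProj_proj, ← hg, hg0]
      have : eLpNorm (localized μ A (1 / p - 1 / 2) τ i j g) 2 μ = 0 := by
        rw [← eLpNorm_zero (ε := ℂ) (p := 2) (μ := μ)]
        refine eLpNorm_congr_ae ?_
        filter_upwards [Lp.coeFn_zero ℂ 2 μ] with x hx
        rw [localized, hbp, map_zero]
        by_cases hxb : x ∈ Metric.ball (i : X) τ
        · rw [Set.indicator_of_mem hxb, hx, Pi.zero_apply, mul_zero]
        · rw [Set.indicator_of_notMem hxb, Pi.zero_apply]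
      rw [this]; exact zero_le
    · rwa [ENNReal.div_le_iff h0 hgm.2.ne] at hsup
  have h2 : ENNReal.ofReal (V ^ (1 / p - 1 / 2)) * ‖hS.proj μ i (A g)‖ₑ ≤
      ENNReal.ofReal ((D * 2 ^ n) ^ (1 / p - 1 / 2)) *
        eLpNorm (localized μ A (1 / p - 1 / 2) τ i j g) 2 μ := by
    have h3 : ENNReal.ofReal (V ^ (1 / p - 1 / 2)) * ‖hS.proj μ i (A g)‖ₑ =
        eLpNorm (((V ^ (1 / p - 1 / 2) : ℝ) : ℂ) • (hS.proj μ i (A g) : X → ℂ)) 2 μ := by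
      rw [eLpNorm_const_smul, ← Lp.enorm_def, ← ofReal_norm (E := ℂ), Complex.norm_real,
        Real.norm_of_nonneg (by positivity)]
    rw [h3]
    refine eLpNorm_le_mul_eLpNorm_of_ae_le_mul ?_ 2
    filter_upwards [hS.coeFn_proj i (A g)] with x hx
    rw [Pi.smul_apply, hx, localized, hg, hS.ballProj_proj, ← hg]
    by_cases hxi : x ∈ idx ⁻¹' {i}
    · have hxb := hS.cell_subset_ball i hxi
      rw [Set.indicator_of_mem hxi, Set.indicator_of_mem hxb, norm_smul, norm_mul,
        Complex.norm_real, Complex.norm_real, Real.norm_of_nonneg (by positivity),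
        Real.norm_of_nonneg (by positivity), ← mul_assoc]
      refine mul_le_mul_of_nonneg_right ?_ (norm_nonneg _)
      -- Doubling replaces the volume at a point of the cell by that at the net point; this is the
      -- origin of the factor `(D * 2^n)^(1/p-1/2)`.
      rw [← Real.mul_rpow (by positivity) (by positivity)]
      refine Real.rpow_le_rpow (by positivity) ?_ hσ
      exact hD.ball_le_of_dist_lt hτ (by rw [dist_comm]; exact hxb)
    · rw [Set.indicator_of_notMem hxi, smul_zero, norm_zero]; positivity
  refine h2.trans ?_
  rw [ENNReal.ofReal_mul (by positivity), mul_assoc]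
  gcongr

/-- Hölder on the cell of `j` turns the `p → 2` bound into a `2 → 2` bound with the factor `(V_j /
V_i)^(1/p-1/2)`, which is at most `1` for this order of volumes. -/
lemma PVE.norm_block_le_of_le (h : PVE μ n a p τ K A) (hS : IsNet τ S idx)
    (hD : IsDoubling μ n D) (hτ : 0 < τ) (hp1 : 1 ≤ p) (hp2 : p < 2) (i j : S)
    (hij : μ.real (Metric.ball (j : X) τ) ≤ μ.real (Metric.ball (i : X) τ)) (f : Lp ℂ 2 μ) :
    ‖hS.proj μ i (A (hS.proj μ j f))‖ ≤ (D * 2 ^ n) ^ (1 / p - 1 / 2) *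
        (K * (1 + dist (i : X) j / τ) ^ (-n - a)) * ‖hS.proj μ j f‖ := by
  have hne : Nonempty X := ⟨i⟩
  have hK := h.pos
  have hσ : 0 ≤ 1 / p - 1 / 2 :=
    sub_nonneg.2 (one_div_le_one_div_of_le (by linarith) hp2.le)
  have hD0 : 0 < D := lt_of_lt_of_le one_pos hD.one_le
  have h1 := (h.block_le hS hD hτ hp1 hp2 i j f).trans
    (mul_le_mul_right (hS.eLpNorm_proj_le hD hτ hp1 hp2 j f) _)
  have hVi := hD.pos (i : X) hτ
  have hVj := hD.pos (j : X) hτ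
  rw [← ofReal_norm, ← ofReal_norm, ← ENNReal.ofReal_mul (by positivity),
    ← ENNReal.ofReal_mul (by positivity), ← ENNReal.ofReal_mul (by positivity),
    ENNReal.ofReal_le_ofReal_iff (by positivity)] at h1
  have h2 : μ.real (Metric.ball (j : X) τ) ^ (1 / p - 1 / 2) ≤
      μ.real (Metric.ball (i : X) τ) ^ (1 / p - 1 / 2) := Real.rpow_le_rpow hVj.le hij hσ
  have h3 : 0 < μ.real (Metric.ball (i : X) τ) ^ (1 / p - 1 / 2) := by positivity
  refine le_of_mul_le_mul_left (h1.trans ?_) h3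
  calc _ ≤ (D * 2 ^ n) ^ (1 / p - 1 / 2) * (K * (1 + dist (i : X) j / τ) ^ (-n - a)) *
        (μ.real (Metric.ball (i : X) τ) ^ (1 / p - 1 / 2) * ‖hS.proj μ j f‖) := by gcongr
    _ = _ := by ring

/-- The `L²` off-diagonal estimate for the blocks of `A`. -/
lemma PVE.norm_block_le (h : PVE μ n a p τ K A) (hA : IsSelfAdjoint A) (hS : IsNet τ S idx)
    (hD : IsDoubling μ n D) (hτ : 0 < τ) (hp1 : 1 ≤ p) (hp2 : p < 2) (i j : S) (f : Lp ℂ 2 μ) :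
    ‖hS.proj μ i (A (hS.proj μ j f))‖ ≤ (D * 2 ^ n) ^ (1 / p - 1 / 2) *
        (K * (1 + dist (i : X) j / τ) ^ (-n - a)) * ‖hS.proj μ j f‖ := by
  rcases le_total (μ.real (Metric.ball (j : X) τ)) (μ.real (Metric.ball (i : X) τ)) with hij | hij
  · exact h.norm_block_le_of_le hS hD hτ hp1 hp2 i j hij f
  -- For the opposite order of volumes pass to the adjoint block: `‖y‖² = ⟨P_j A y, P_j f⟩` with `y
  -- = P_i y`, so the favourable case applies with `i` and `j` exchanged.
  have hP := hS.isOrthDecomp μ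
  set y := hS.proj μ i (A (hS.proj μ j f)) with hy
  set c := (D * 2 ^ n) ^ (1 / p - 1 / 2) * (K * (1 + dist (i : X) j / τ) ^ (-n - a)) with hc
  have h1 := h.norm_block_le_of_le hS hD hτ hp1 hp2 j i hij (A (hS.proj μ j f))
  rw [dist_comm (j : X) i, ← hc, ← hy] at h1
  have hsymm : ∀ u w, inner ℂ (A u) w = inner ℂ u (A w) := fun u w => hA.isSymmetric u w
  have h2 : ‖y‖ ^ 2 ≤ c * ‖y‖ * ‖hS.proj μ j f‖ := by
    have h3 : (inner ℂ y y).re = ‖y‖ ^ 2 := by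
      simpa using (inner_self_eq_norm_sq (𝕜 := ℂ) y)
    have h4 : inner ℂ y y = inner ℂ (hS.proj μ j (A y)) (hS.proj μ j f) := by
      conv_lhs => rw [hy, ← hP.symm, hP.idem, ← hy, ← hsymm, ← hP.idem j f, ← hP.symm]
    rw [← h3, h4]
    refine (Complex.re_le_norm _).trans ((norm_inner_le_norm _ _).trans ?_)
    exact mul_le_mul_of_nonneg_right h1 (norm_nonneg _)
  rcases (norm_nonneg y).eq_or_lt with h0 | h0
  · rw [← h0]
    have hne : Nonempty X := ⟨i⟩
    have hK := h.pos
    have hD0 : 0 < D := lt_of_lt_of_le one_pos hD.one_le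
    positivity
  · refine le_of_mul_le_mul_left (le_trans (le_of_eq ?_) (h2.trans (le_of_eq ?_))) h0
    · ring
    · ring

end Blocks

/-! ### Polynomial weights: commutators with `A` and the weighted `ℓ¹` endpoint. -/

section Weights

lemma IsOrthDecomp.ext {H ι : Type*} [NormedAddCommGroup H] [InnerProductSpace ℂ H]
    {P : ι → H →L[ℂ] H} (hP : IsOrthDecomp P) {x y : H} (h : ∀ i, P i x = P i y) : x = y :=
  (hP.hasSum x).unique (by simpa only [h] using hP.hasSum y)

variable {X : Type*} [MetricSpace X]

/-- The weight `(ρ + min (d(x, i) / τ) N) ^ k`. -/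
def netWeight (τ : ℝ) (S : Set X) (x : X) (ρ N : ℝ) (k : ℕ) (i : S) : ℝ :=
  (ρ + min (dist x (i : X) / τ) N) ^ k

variable {τ ρ N : ℝ} {S : Set X} {x : X} {k : ℕ}

lemma one_le_netWeight_base (hτ : 0 < τ) (hN : 0 ≤ N) (i : S) :
    ρ ≤ ρ + min (dist x (i : X) / τ) N :=
  le_add_of_nonneg_right (le_min (by positivity) hN)

lemma one_le_netWeight (hτ : 0 < τ) (hN : 0 ≤ N) (hρ : 1 ≤ ρ) (i : S) :
    1 ≤ netWeight τ S x ρ N k i :=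
  one_le_pow₀ (hρ.trans (one_le_netWeight_base hτ hN i))

lemma abs_netWeight_le (hτ : 0 < τ) (hN : 0 ≤ N) (hρ : 1 ≤ ρ) (i : S) :
    |netWeight τ S x ρ N k i| ≤ (ρ + N) ^ k := by
  have := one_le_netWeight_base (ρ := ρ) (x := x) hτ hN i
  rw [abs_of_nonneg (zero_le_one.trans (one_le_netWeight hτ hN hρ i))]
  exact pow_le_pow_left₀ (by linarith) (by gcongr; exact min_le_right _ _) k

lemma abs_inv_netWeight_le (hτ : 0 < τ) (hN : 0 ≤ N) (hρ : 1 ≤ ρ) (i : S) :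
    |(netWeight τ S x ρ N k i)⁻¹| ≤ 1 := by
  have := one_le_netWeight (k := k) (x := x) hτ hN hρ i
  rw [abs_of_nonneg (by positivity)]
  exact inv_le_one_of_one_le₀ this

/-- The bases differ by at most `δ = d(i,j)/τ`, truncation being 1-Lipschitz, and are comparable up
to `1 + δ`. One power of the base survives in the denominator and is at least `ρ`, hence the gain
`1/ρ`; the bound is uniform in the truncation `N`. -/
lemma netWeight_sub_le (hτ : 0 < τ) (hN : 0 ≤ N) (hρ : 1 ≤ ρ) (i j : S) :
    |netWeight τ S x ρ N k i * (netWeight τ S x ρ N k j)⁻¹ - 1| ≤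
      k / ρ * (1 + dist (i : X) j / τ) ^ k := by
  set u := ρ + min (dist x (i : X) / τ) N with hu
  set w := ρ + min (dist x (j : X) / τ) N with hw
  set δ := dist (i : X) j / τ with hδ
  have hδ0 : 0 ≤ δ := by positivity
  have hρu : ρ ≤ u := one_le_netWeight_base hτ hN i
  have hρw : ρ ≤ w := one_le_netWeight_base hτ hN j
  have huw : |u - w| ≤ δ := by
    have h1 : |u - w| ≤ |dist x (i : X) / τ - dist x (j : X) / τ| := by
      rw [hu, hw, add_sub_add_left_eq_sub]
      refine (abs_min_sub_min_le_max _ _ _ _).trans ?_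
      simp
    refine h1.trans ?_
    rw [← sub_div, abs_div, abs_of_pos hτ, hδ]
    gcongr
    rw [dist_comm x i, dist_comm x j]
    exact abs_dist_sub_le (i : X) j x
  have hw0 : 0 < w := by linarith
  have hwk : 0 < w ^ k := by positivity
  have hmax : max |u| |w| ≤ w * (1 + δ) := by
    rw [abs_of_nonneg (by linarith), abs_of_nonneg hw0.le]
    have := (abs_le.1 huw).2
    refine max_le ?_ ?_ <;> nlinarith
  change |u ^ k * (w ^ k)⁻¹ - 1| ≤ _
  rcases Nat.eq_zero_or_pos k with hk | hk
  · subst hk; simp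
  have h2 : |u ^ k - w ^ k| ≤ k * (1 + δ) ^ k * w ^ (k - 1) := by
    calc |u ^ k - w ^ k| ≤ |u - w| * k * max |u| |w| ^ (k - 1) := abs_pow_sub_pow_le u w k
      _ ≤ (1 + δ) * k * (w * (1 + δ)) ^ (k - 1) := by
          gcongr
          linarith
      _ = k * ((1 + δ) ^ (k - 1) * (1 + δ)) * w ^ (k - 1) := by rw [mul_pow]; ring
      _ = _ := by rw [← pow_succ, Nat.sub_add_cancel hk]
  have h3 : u ^ k * (w ^ k)⁻¹ - 1 = (u ^ k - w ^ k) / w ^ k := by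
    field_simp
  rw [h3, abs_div, abs_of_pos hwk, div_le_iff₀ hwk]
  refine h2.trans ?_
  have h4 : w ^ k = w ^ (k - 1) * w := by rw [← pow_succ, Nat.sub_add_cancel hk]
  rw [h4]
  have h5 : 1 ≤ w / ρ := by rw [one_le_div (by linarith)]; exact hρw
  calc k * (1 + δ) ^ k * w ^ (k - 1) ≤ k * (1 + δ) ^ k * w ^ (k - 1) * (w / ρ) :=
        le_mul_of_one_le_right (by positivity) h5
    _ = _ := by ring

variable [MeasurableSpace X] [BorelSpace X] {μ : Measure X} {n a : ℝ} {idx : X → S}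

/-- Multiplication by `c i` on the cell of `i`. -/
def IsNet.diag (hS : IsNet τ S idx) (μ : Measure X) (c : S → ℝ) (C : ℝ) (hC : ∀ i, |c i| ≤ C) :
    Lp ℂ 2 μ →L[ℂ] Lp ℂ 2 μ :=
  haveI : Countable S := hS.countable
  diagOp μ hS.measurable c C hC

lemma IsNet.proj_diag (hS : IsNet τ S idx) {c : S → ℝ} {C : ℝ} (hC : ∀ i, |c i| ≤ C) (i : S)
    (f : Lp ℂ 2 μ) : hS.proj μ i (hS.diag μ c C hC f) = (c i : ℂ) • hS.proj μ i f :=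
  haveI : Countable S := hS.countable
  cellProj_diagOp hS.measurable hC i f

lemma IsNet.diag_proj (hS : IsNet τ S idx) {c : S → ℝ} {C : ℝ} (hC : ∀ i, |c i| ≤ C) (j : S)
    (f : Lp ℂ 2 μ) : hS.diag μ c C hC (hS.proj μ j f) = (c j : ℂ) • hS.proj μ j f := by
  have hP := hS.isOrthDecomp μ
  refine hP.ext fun i => ?_
  rw [hS.proj_diag, map_smul]
  by_cases hij : i = j
  · rw [hij]
  · rw [hP.orth i j hij, smul_zero, smul_zero]

/-- The commutator of `A` with a weight. -/
lemma exists_commutator_bound (X : Type*) [MetricSpace X] [MeasurableSpace X] [BorelSpace X]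
    (hn : 0 ≤ n) (hka : (k : ℝ) < a) (D p K : ℝ) :
    ∃ C : ℝ, 0 ≤ C ∧ ∀ {μ : Measure X}, IsDoubling μ n D → ∀ {τ : ℝ} {S : Set X} {idx : X → S},
      ∀ (hS : IsNet τ S idx) (hτ : 0 < τ) {A : Lp ℂ 2 μ →L[ℂ] Lp ℂ 2 μ}, IsSelfAdjoint A →
      1 ≤ p → p < 2 → PVE μ n a p τ K A → ∀ (x : X) {ρ N : ℝ} (hρ : 1 ≤ ρ) (hN : 0 ≤ N)
      (u : Lp ℂ 2 μ),
      ‖hS.diag μ (netWeight τ S x ρ N k) _ (abs_netWeight_le hτ hN hρ) (A u) -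
        A (hS.diag μ (netWeight τ S x ρ N k) _ (abs_netWeight_le hτ hN hρ) u)‖ ≤
      C / ρ * ‖hS.diag μ (netWeight τ S x ρ N k) _ (abs_netWeight_le hτ hN hρ) u‖ := by
  obtain ⟨C₀, hC₀, hsum⟩ := IsDoubling.sum_decay (X := X) (D := D) hn (β := n + a - k) (by linarith)
  set B := |(D * 2 ^ n) ^ (1 / p - 1 / 2)| * |K| with hB
  refine ⟨k * B * C₀, by positivity, ?_⟩
  intro μ hD τ S idx hS hτ A hA hp1 hp2 hPVE x ρ N hρ hN u
  have hne : Nonempty X := ⟨x⟩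
  have hK := hPVE.pos
  have hD0 : 0 < D := lt_of_lt_of_le one_pos hD.one_le
  have hP := hS.isOrthDecomp μ
  set c := netWeight τ S x ρ N k with hc
  set W := hS.diag μ c _ (abs_netWeight_le hτ hN hρ) with hW
  set W' := hS.diag μ (fun i => (c i)⁻¹) 1 (abs_inv_netWeight_le hτ hN hρ) with hW'
  have hc1 : ∀ i, 1 ≤ c i := fun i => one_le_netWeight hτ hN hρ i
  have hinv : W' (W u) = u := hP.ext fun i => by
    rw [hS.proj_diag, hS.proj_diag, smul_smul, ← Complex.ofReal_mul,
      inv_mul_cancel₀ (by linarith [hc1 i]), Complex.ofReal_one, one_smul]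
  -- The blocks of `[W, A] W⁻¹` are `(c_i/c_j - 1) P_i A P_j`. The factor costs `(1+δ)^k`, and the
  -- remaining decay of order `n + a - k > n` is summable for Schur's test.
  set L : Lp ℂ 2 μ →L[ℂ] Lp ℂ 2 μ := (W ∘L A - A ∘L W) ∘L W' with hL
  have key : ‖L (W u)‖ ≤ k * B * C₀ / ρ * ‖W u‖ := by
    refine hP.norm_le_of_blocks
      (k := fun i j => k * B / ρ * (1 + dist (i : X) j / τ) ^ (-(n + a - k)))
      (by positivity) (fun i j => by positivity) (fun i T => ?_) (fun j T => ?_)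
      (fun i j y => ?_) (W u)
    · rw [← Finset.mul_sum, mul_div_right_comm (k * B) C₀ ρ]
      exact mul_le_mul_of_nonneg_left (hsum hD hτ hS i T) (by positivity)
    · rw [← Finset.mul_sum, mul_div_right_comm (k * B) C₀ ρ]
      simp only [dist_comm _ (j : X)]
      exact mul_le_mul_of_nonneg_left (hsum hD hτ hS j T) (by positivity)
    · have h1 : hS.proj μ i (L (hS.proj μ j y)) =
          ((c i * (c j)⁻¹ - 1 : ℝ) : ℂ) • hS.proj μ i (A (hS.proj μ j y)) := by
        have hcj : ((c j : ℝ) : ℂ) ≠ 0 := by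
          have := hc1 j; exact_mod_cast (by linarith : c j ≠ 0)
        rw [hL, ContinuousLinearMap.comp_apply, hW', hS.diag_proj, map_smul, map_smul,
          sub_apply, map_sub, ContinuousLinearMap.comp_apply,
          ContinuousLinearMap.comp_apply, hW, hS.proj_diag, hS.diag_proj, map_smul, map_smul,
          ← sub_smul, smul_smul]
        congr 1
        push_cast
        field_simp
      rw [h1, norm_smul, Complex.norm_real, Real.norm_eq_abs]
      have hδ : 0 < 1 + dist (i : X) j / τ := by positivity
      calc _ ≤ (k / ρ * (1 + dist (i : X) j / τ) ^ k) * ((D * 2 ^ n) ^ (1 / p - 1 / 2) *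
            (K * (1 + dist (i : X) j / τ) ^ (-n - a)) * ‖hS.proj μ j y‖) :=
            mul_le_mul (netWeight_sub_le hτ hN hρ i j)
              (hPVE.norm_block_le hA hS hD hτ hp1 hp2 i j y) (norm_nonneg _) (by positivity)
        _ = _ := by
            rw [hB, abs_of_nonneg (by positivity), abs_of_pos hK,
              show -(n + a - k) = (k : ℝ) + (-n - a) by ring, Real.rpow_add hδ, Real.rpow_natCast]
            ring
  have hLW : L (W u) = W (A u) - A (W u) := by
    rw [hL, ContinuousLinearMap.comp_apply, hinv]
    rfl
  rw [← hLW]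
  exact key

/-- The weighted `ℓ¹(L²)` bound of the unitary group. -/
lemma exists_l1_bound (X : Type*) [MetricSpace X] [MeasurableSpace X] [BorelSpace X]
    (hn : 0 ≤ n) (hka : (k : ℝ) < a) (hnk : n < 2 * k) (D p K : ℝ) :
    ∃ C : ℝ, 0 ≤ C ∧ ∀ {μ : Measure X}, IsDoubling μ n D → ∀ {τ : ℝ} {S : Set X} {idx : X → S},
      ∀ (hS : IsNet τ S idx), 0 < τ → ∀ {A : Lp ℂ 2 μ →L[ℂ] Lp ℂ 2 μ}, IsSelfAdjoint A →
      1 ≤ p → p < 2 → PVE μ n a p τ K A → ∀ (t : ℝ) (j : S) (f : Lp ℂ 2 μ) (T : Finset S),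
      ∑ i ∈ T, Real.sqrt (μ.real (Metric.ball (i : X) τ)) *
          ‖hS.proj μ i (unitaryGroup A t (hS.proj μ j f))‖ ≤
        C * (1 + |t|) ^ (n / 2) *
          (Real.sqrt (μ.real (Metric.ball (j : X) τ)) * ‖hS.proj μ j f‖) := by
  obtain ⟨C₁, hC₁, hcomm⟩ := exists_commutator_bound X hn hka D p K
  obtain ⟨C₂, hC₂, hvol⟩ := IsDoubling.sum_decay_volume (X := X) (D := D) hn hnk
  refine ⟨Real.sqrt C₂ * Real.exp C₁, by positivity, ?_⟩
  intro μ hD τ S idx hS hτ A hA hp1 hp2 hPVE t j f T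
  set ρ := 1 + |t| with hρdef
  have hρ : 1 ≤ ρ := le_add_of_nonneg_right (abs_nonneg t)
  have hρ0 : 0 < ρ := by linarith
  -- The truncation level is put beyond all points of `T`, so it is invisible on `T`; no constant
  -- depends on it.
  obtain ⟨N, hN, hNT⟩ : ∃ N : ℝ, 0 ≤ N ∧ ∀ i ∈ T, dist (j : X) i / τ ≤ N := by
    refine ⟨∑ i ∈ T, dist (j : X) i / τ, Finset.sum_nonneg fun i _ => by positivity, fun i hi => ?_⟩
    exact Finset.single_le_sum (f := fun i : S => dist (j : X) i / τ)
      (fun i _ => by positivity) hi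
  have hP := hS.isOrthDecomp μ
  set c := netWeight τ S (j : X) ρ N k with hc
  have hc1 : ∀ i, 1 ≤ c i := fun i => one_le_netWeight hτ hN hρ i
  set W := hS.diag μ c _ (abs_netWeight_le hτ hN hρ) with hW
  set u := unitaryGroup A t (hS.proj μ j f) with hu
  have hWu : ‖W u‖ ≤ Real.exp C₁ * (ρ ^ k * ‖hS.proj μ j f‖) := by
    have h1 := norm_mul_unitaryGroup_le hA (hcomm hD hS hτ hA hp1 hp2 hPVE (j : X) hρ hN) t
      (hS.proj μ j f)
    refine h1.trans ?_
    -- The choice `ρ = 1 + |t|` keeps the Gronwall exponent bounded in time.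
    have h2 : C₁ / ρ * |t| ≤ C₁ := by
      rw [div_mul_eq_mul_div, div_le_iff₀ hρ0]
      exact mul_le_mul_of_nonneg_left (by linarith) hC₁
    have h3 : netWeight τ S (j : X) ρ N k j = ρ ^ k := by
      simp [netWeight, hN]
    rw [hS.diag_proj, norm_smul, Complex.norm_real, h3, Real.norm_of_nonneg (by positivity)]
    gcongr
  have hterm : ∀ i ∈ T, Real.sqrt (μ.real (Metric.ball (i : X) τ)) * ‖hS.proj μ i u‖ =
      (Real.sqrt (μ.real (Metric.ball (i : X) τ)) * (c i)⁻¹) * ‖hS.proj μ i (W u)‖ := by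
    intro i _
    have := hc1 i
    rw [hW, hS.proj_diag, norm_smul, Complex.norm_real, Real.norm_of_nonneg (by linarith)]
    field_simp
  have hCS := Finset.sum_mul_sq_le_sq_mul_sq T
    (fun i => Real.sqrt (μ.real (Metric.ball (i : X) τ)) * (c i)⁻¹)
    (fun i => ‖hS.proj μ i (W u)‖)
  -- Here `2k > n` enters. Together with the initial weight `ρ^k` on the cell of `j`, the square
  -- root of `ρ^(n-2k)` leaves `ρ^(n/2)`.
  have hV : ∑ i ∈ T, (Real.sqrt (μ.real (Metric.ball (i : X) τ)) * (c i)⁻¹) ^ 2 ≤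
      C₂ * ρ ^ (n - 2 * k) * μ.real (Metric.ball (j : X) τ) := by
    refine le_trans (Finset.sum_le_sum fun i hi => le_of_eq ?_) (hvol hD hτ hS j T hρ)
    rw [mul_pow, Real.sq_sqrt measureReal_nonneg]
    congr 1
    have hpos : 0 < ρ + dist (j : X) i / τ := by positivity
    rw [hc, netWeight, min_eq_left (hNT i hi), Real.rpow_neg hpos.le, inv_pow, ← pow_mul,
      mul_comm k 2]
    congr 1
    rw [← Real.rpow_natCast]
    push_cast
    rfl
  rw [Finset.sum_congr rfl hterm]
  refine le_of_sq_le_sq (hCS.trans ((mul_le_mul hV (hP.sum_norm_sq_le T (W u))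
    (Finset.sum_nonneg fun i _ => sq_nonneg _) (by positivity)).trans ?_)) (by positivity)
  calc _ ≤ C₂ * ρ ^ (n - 2 * k) * μ.real (Metric.ball (j : X) τ) *
        (Real.exp C₁ * (ρ ^ k * ‖hS.proj μ j f‖)) ^ 2 := by gcongr
    _ = C₂ * Real.exp C₁ ^ 2 * (ρ ^ (n - 2 * k) * (ρ ^ k) ^ 2) * (μ.real (Metric.ball (j : X) τ) *
        ‖hS.proj μ j f‖ ^ 2) := by ring
    _ = _ := by
        have h1 : ρ ^ (n - 2 * k) * (ρ ^ k) ^ 2 = (ρ ^ (n / 2)) ^ 2 := by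
          rw [← Real.rpow_natCast, ← Real.rpow_natCast, ← Real.rpow_natCast, ← Real.rpow_mul hρ0.le,
            ← Real.rpow_mul hρ0.le, ← Real.rpow_add hρ0]
          congr 1
          push_cast
          ring
        rw [h1, mul_pow, mul_pow, mul_pow, mul_pow, Real.sq_sqrt hC₂, Real.sq_sqrt measureReal_nonneg]

end Weights

/-! ### The weighted amalgam space `ℓ^p(L²)` and the unitary group on it. -/

section Amalgam

variable {X : Type*} [MetricSpace X] [MeasurableSpace X] [BorelSpace X] {μ : Measure X}
  {n D τ p a K : ℝ} {S : Set X} {idx : X → S} {A : Lp ℂ 2 μ →L[ℂ] Lp ℂ 2 μ}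

/-- The finite sections of the norm of the weighted amalgam space `ℓ^p(L²)`, to the power `p`. -/
def IsNet.amalgam (hS : IsNet τ S idx) (μ : Measure X) (p : ℝ) (T : Finset S)
    (g : Lp ℂ 2 μ) : ℝ :=
  ∑ i ∈ T, μ.real (Metric.ball (i : X) τ) ^ (1 - p / 2) * ‖hS.proj μ i g‖ ^ p

lemma IsNet.continuous_amalgam (hS : IsNet τ S idx) (hp : 0 < p) (T : Finset S) :
    Continuous (hS.amalgam μ p T) := by
  unfold IsNet.amalgam
  refine continuous_finsetSum _ fun i _ => continuous_const.mul ?_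
  exact ((hS.proj μ i).continuous.norm).rpow_const fun _ => Or.inr hp.le

lemma amalgam_term_eq (hp : 0 < p) {v b : ℝ} (hv : 0 ≤ v) (hb : 0 ≤ b) :
    (v ^ (1 / p - 1 / 2) * b) ^ p = v ^ (1 - p / 2) * b ^ p := by
  rw [Real.mul_rpow (by positivity) hb, ← Real.rpow_mul hv]
  congr 2
  field_simp

/-- The amalgam norm dominates the `L^p` norm. -/
lemma IsNet.eLpNorm_rpow_le (hS : IsNet τ S idx) (hD : IsDoubling μ n D) (hτ : 0 < τ)
    (hp1 : 1 ≤ p) (hp2 : p < 2) {g : Lp ℂ 2 μ} {Q : ℝ} (hQ : ∀ T, hS.amalgam μ p T g ≤ Q) :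
    eLpNorm g (ENNReal.ofReal p) μ ^ p ≤ ENNReal.ofReal Q := by
  have hp0 : 0 < p := by linarith
  rw [← hS.tsum_eLpNorm_proj hp0 g, ENNReal.tsum_eq_iSup_sum]
  refine iSup_le fun T => ?_
  refine le_trans ?_ (ENNReal.ofReal_le_ofReal (hQ T))
  rw [IsNet.amalgam, ENNReal.ofReal_sum_of_nonneg fun i _ => by positivity]
  refine Finset.sum_le_sum fun i _ => ?_
  rw [← amalgam_term_eq hp0 measureReal_nonneg (norm_nonneg _),
    ← ENNReal.ofReal_rpow_of_nonneg (by positivity) hp0.le, ENNReal.ofReal_mul (by positivity),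
    ofReal_norm]
  exact ENNReal.rpow_le_rpow (hS.eLpNorm_proj_le hD hτ hp1 hp2 i g) hp0.le

/-- `A` maps `L^p` to the amalgam space. -/
lemma exists_amalgam_apply_le (X : Type*) [MetricSpace X] [MeasurableSpace X] [BorelSpace X]
    (hn : 0 ≤ n) (ha : 0 < a) (D p K : ℝ) :
    ∃ C : ℝ, 0 ≤ C ∧ ∀ {μ : Measure X}, IsDoubling μ n D → ∀ {τ : ℝ} {S : Set X} {idx : X → S},
      ∀ (hS : IsNet τ S idx), 0 < τ → ∀ {A : Lp ℂ 2 μ →L[ℂ] Lp ℂ 2 μ},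
      1 ≤ p → p < 2 → PVE μ n a p τ K A → ∀ (f : Lp ℂ 2 μ), MemLp f (ENNReal.ofReal p) μ →
      ∀ T, hS.amalgam μ p T (A f) ≤ (C * (eLpNorm f (ENNReal.ofReal p) μ).toReal) ^ p := by
  obtain ⟨C₀, hC₀, hsum⟩ := IsDoubling.sum_decay (X := X) (D := D) hn (β := n + a) (by linarith)
  set B := |(D * 2 ^ n) ^ (1 / p - 1 / 2)| * |K| with hB
  refine ⟨B * C₀, by positivity, ?_⟩
  intro μ hD τ S idx hS hτ A hp1 hp2 hPVE f hf T
  have hp0 : 0 < p := by linarith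
  have hP := hS.isOrthDecomp μ
  set b : S → ℝ := fun j => (eLpNorm (hS.proj μ j f) (ENNReal.ofReal p) μ).toReal with hb
  have hbfin : ∀ j, eLpNorm (hS.proj μ j f) (ENNReal.ofReal p) μ ≠ ∞ := fun j =>
    ((hS.eLpNorm_proj_le hD hτ hp1 hp2 j f).trans_lt
      (ENNReal.mul_lt_top ENNReal.ofReal_lt_top enorm_lt_top)).ne
  have hbsum : ∀ T' : Finset S, ∑ j ∈ T', b j ^ p ≤
      (eLpNorm f (ENNReal.ofReal p) μ).toReal ^ p := by
    intro T'
    have h1 := ENNReal.sum_le_tsum (f := fun j => eLpNorm (hS.proj μ j f) (ENNReal.ofReal p) μ ^ p) T'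
    rw [hS.tsum_eLpNorm_proj hp0 f] at h1
    have h2 := ENNReal.toReal_mono (ENNReal.rpow_ne_top_of_nonneg hp0.le hf.2.ne) h1
    rw [ENNReal.toReal_sum fun j _ => ENNReal.rpow_ne_top_of_nonneg hp0.le (hbfin j)] at h2
    simpa only [← ENNReal.toReal_rpow] using h2
  have hblock : ∀ i j : S, μ.real (Metric.ball (i : X) τ) ^ (1 / p - 1 / 2) *
      ‖hS.proj μ i (A (hS.proj μ j f))‖ ≤ B * (1 + dist (i : X) j / τ) ^ (-(n + a)) * b j := by
    intro i j
    have hne : Nonempty X := ⟨i⟩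
    have hK := hPVE.pos
    have hD0 : 0 < D := lt_of_lt_of_le one_pos hD.one_le
    have h1 := hPVE.block_le hS hD hτ hp1 hp2 i j f
    rw [← ENNReal.ofReal_toReal (hbfin j), ← ofReal_norm, ← ENNReal.ofReal_mul (by positivity),
      ← ENNReal.ofReal_mul (by positivity), ENNReal.ofReal_le_ofReal_iff
        (mul_nonneg (by positivity) ENNReal.toReal_nonneg)] at h1
    refine h1.trans (le_of_eq ?_)
    rw [hB, abs_of_nonneg (by positivity), abs_of_pos hK, neg_add']
    ring
  have hfin : ∀ T' : Finset S, hS.amalgam μ p T (A (∑ j ∈ T', hS.proj μ j f)) ≤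
      (B * C₀ * (eLpNorm f (ENNReal.ofReal p) μ).toReal) ^ p := by
    intro T'
    have hschur := schur_test T T' (k := fun i j => B * (1 + dist (i : X) j / τ) ^ (-(n + a)))
      (C := B * C₀) hp1 (fun i j => by positivity)
      (fun i => by
        rw [← Finset.mul_sum]
        exact mul_le_mul_of_nonneg_left (hsum hD hτ hS i T') (by positivity))
      (fun j => by
        rw [← Finset.mul_sum]
        simp only [dist_comm _ (j : X)]
        exact mul_le_mul_of_nonneg_left (hsum hD hτ hS j T) (by positivity))
      (b := b) fun j => ENNReal.toReal_nonneg
    rw [Real.mul_rpow (by positivity) ENNReal.toReal_nonneg]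
    refine le_trans ?_ (hschur.trans (mul_le_mul_of_nonneg_left (hbsum T') (by positivity)))
    refine Finset.sum_le_sum fun i _ => ?_
    rw [← amalgam_term_eq hp0 measureReal_nonneg (norm_nonneg _)]
    refine Real.rpow_le_rpow (by positivity) ?_ hp0.le
    rw [map_sum, map_sum]
    refine (mul_le_mul_of_nonneg_left (norm_sum_le _ _) (by positivity)).trans ?_
    rw [Finset.mul_sum]
    exact Finset.sum_le_sum fun j _ => hblock i j
  have hlim : Filter.Tendsto (fun T' : Finset S => hS.amalgam μ p T (A (∑ j ∈ T', hS.proj μ j f)))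
      Filter.atTop (nhds (hS.amalgam μ p T (A f))) :=
    (((hS.continuous_amalgam hp0 T).comp A.continuous).tendsto f).comp (hP.hasSum f)
  exact le_of_tendsto' hlim hfin

/-- The growth of the unitary group on the amalgam space. -/
lemma exists_amalgam_unitaryGroup_le (X : Type*) [MetricSpace X] [MeasurableSpace X]
    [BorelSpace X] {k : ℕ} (hn : 0 ≤ n) (hka : (k : ℝ) < a) (hnk : n < 2 * k) (D p K : ℝ) :
    ∃ C : ℝ, 0 ≤ C ∧ ∀ {μ : Measure X}, IsDoubling μ n D → ∀ {τ : ℝ} {S : Set X} {idx : X → S},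
      ∀ (hS : IsNet τ S idx), 0 < τ → ∀ {A : Lp ℂ 2 μ →L[ℂ] Lp ℂ 2 μ}, IsSelfAdjoint A →
      1 ≤ p → p < 2 → PVE μ n a p τ K A → ∀ (t : ℝ) (g : Lp ℂ 2 μ) (q : ℝ), 0 ≤ q →
      (∀ T, hS.amalgam μ p T g ≤ q ^ p) → ∀ T, hS.amalgam μ p T (unitaryGroup A t g) ≤
        (C * (1 + |t|) ^ (n * (1 / p - 1 / 2)) * q) ^ p := by
  obtain ⟨C, hC, hl1⟩ := exists_l1_bound X hn hka hnk D p K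
  -- Interpolation gives the endpoint constant to the power `2 - p` for `p`-th powers of norms,
  -- hence `(2-p)/p` for the norms themselves; the same exponent turns `n/2` into `n(1/p-1/2)`.
  refine ⟨C ^ (2 / p - 1), by positivity, ?_⟩
  intro μ hD τ S idx hS hτ A hA hp1 hp2 hPVE t g q hq hg T
  have hp0 : 0 < p := by linarith
  have hP := hS.isOrthDecomp μ
  have hfin : ∀ T' : Finset S, hS.amalgam μ p T (unitaryGroup A t (∑ j ∈ T', hS.proj μ j g)) ≤
      (C * (1 + |t|) ^ (n / 2)) ^ (2 - p) * q ^ p := fun T' =>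
    (hP.interpolation (v := fun i : S => μ.real (Metric.ball (i : X) τ)) (fun i => hD.pos _ hτ)
      (norm_unitaryGroup_le hA t) (by positivity)
      (fun j x T => hl1 hD hS hτ hA hp1 hp2 hPVE t j x T) hp1 hp2.le T T' g).trans
      (mul_le_mul_of_nonneg_left (hg T') (by positivity))
  have hlim : Filter.Tendsto
      (fun T' : Finset S => hS.amalgam μ p T (unitaryGroup A t (∑ j ∈ T', hS.proj μ j g)))
      Filter.atTop (nhds (hS.amalgam μ p T (unitaryGroup A t g))) :=
    (((hS.continuous_amalgam hp0 T).comp (unitaryGroup A t).continuous).tendsto g).comp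
      (hP.hasSum g)
  refine (le_of_tendsto' hlim hfin).trans (le_of_eq ?_)
  have ht : (0 : ℝ) ≤ 1 + |t| := by positivity
  have e1 : n / 2 * (2 - p) = n * (1 / p - 1 / 2) * p := by field_simp
  have e2 : 2 - p = (2 / p - 1) * p := by field_simp
  rw [Real.mul_rpow (by positivity) hq, Real.mul_rpow (x := C) hC (by positivity),
    Real.mul_rpow (x := C ^ (2 / p - 1)) (by positivity) (by positivity), ← Real.rpow_mul hC,
    ← Real.rpow_mul ht, ← Real.rpow_mul ht, e1, ← e2]

variable [Fact (1 ≤ ENNReal.ofReal p)]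

/-- The map to the weighted `ℓ^p`-sum of finitely many blocks. -/
def IsNet.amalgamMap (hS : IsNet τ S idx) (μ : Measure X) (p : ℝ) [Fact (1 ≤ ENNReal.ofReal p)]
    (T : Finset S) : Lp ℂ 2 μ →L[ℂ] PiLp (ENNReal.ofReal p) (fun _ : T => Lp ℂ 2 μ) :=
  (PiLp.continuousLinearEquiv (ENNReal.ofReal p) ℂ (fun _ : T => Lp ℂ 2 μ)).symm.toContinuousLinearMap
    ∘L ContinuousLinearMap.pi fun i : T =>
      ((μ.real (Metric.ball ((i : S) : X) τ) ^ (1 / p - 1 / 2) : ℝ) : ℂ) • hS.proj μ i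

lemma IsNet.norm_amalgamMap (hS : IsNet τ S idx) (hp : 0 < p) (T : Finset S) (g : Lp ℂ 2 μ) :
    ‖hS.amalgamMap μ p T g‖ ^ p = hS.amalgam μ p T g := by
  have h1 : (ENNReal.ofReal p).toReal = p := ENNReal.toReal_ofReal hp.le
  rw [PiLp.norm_eq_sum (by rw [h1]; exact hp), h1, ← Real.rpow_mul
    (Finset.sum_nonneg fun i _ => by positivity), one_div_mul_cancel hp.ne', Real.rpow_one,
    IsNet.amalgam, ← Finset.sum_coe_sort T]
  refine Finset.sum_congr rfl fun i _ => ?_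
  rw [← amalgam_term_eq hp measureReal_nonneg (norm_nonneg _)]
  congr 1
  have : hS.amalgamMap μ p T g i =
    ((μ.real (Metric.ball ((i : S) : X) τ) ^ (1 / p - 1 / 2) : ℝ) : ℂ) • hS.proj μ i g := rfl
  rw [this, norm_smul, Complex.norm_real, Real.norm_of_nonneg (by positivity)]

/-- Minkowski's integral inequality for the amalgam norms. -/
lemma IsNet.amalgam_integral_le (hS : IsNet τ S idx) (hp : 0 < p) {φ : ℝ → Lp ℂ 2 μ}
    (hφ : Integrable φ) {B : ℝ → ℝ} (hB0 : ∀ ξ, 0 ≤ B ξ) (hB : Integrable B) (T : Finset S)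
    (h : ∀ ξ, hS.amalgam μ p T (φ ξ) ≤ B ξ ^ p) :
    hS.amalgam μ p T (∫ ξ, φ ξ) ≤ (∫ ξ, B ξ) ^ p := by
  rw [← hS.norm_amalgamMap hp]
  refine Real.rpow_le_rpow (norm_nonneg _) ?_ hp.le
  -- A finite section is the `p`-th power of a genuine `PiLp` norm of a linear image, so Minkowski
  -- is the triangle inequality for the Bochner integral.
  rw [← ContinuousLinearMap.integral_comp_comm _ hφ]
  refine norm_integral_le_of_norm_le hB (.of_forall fun ξ => ?_)
  have := h ξ
  rw [← hS.norm_amalgamMap hp] at this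
  exact (Real.rpow_le_rpow_iff (norm_nonneg _) (hB0 ξ) hp).1 this

end Amalgam

/-! ### Functional calculus through the Fourier integral. -/

section FunctionalCalculus

open scoped FourierTransform

variable {H : Type*} [NormedAddCommGroup H] [InnerProductSpace ℂ H] [CompleteSpace H]

lemma ofReal_re_of_mem_spectrum {A : H →L[ℂ] H} (hA : IsSelfAdjoint A) {z : ℂ}
    (hz : z ∈ spectrum ℂ A) : (z.re : ℂ) = z :=
  (hA.mem_spectrum_eq_re hz).symm

lemma cfc_exp_eq_unitaryGroup {A : H →L[ℂ] H} (hA : IsSelfAdjoint A) (t : ℝ) :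
    cfc (fun z : ℂ => Complex.exp ((t * z.re : ℝ) * Complex.I)) A = unitaryGroup A t := by
  have hn : IsStarNormal A := hA.isStarNormal
  have h1 : cfc (fun z : ℂ => Complex.exp ((t * z.re : ℝ) * Complex.I)) A =
      cfc (fun z : ℂ => Complex.exp (((t : ℂ) * Complex.I) • z)) A := by
    refine cfc_congr fun z hz => ?_
    simp only [smul_eq_mul, Complex.ofReal_mul, ofReal_re_of_mem_spectrum hA hz]
    ring_nf
  have hn' : IsStarNormal (((t : ℂ) * Complex.I) • A) := by
    refine ⟨?_⟩
    rw [star_smul]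
    exact (hn.star_comm_self.smul_left _).smul_right _
  rw [h1, cfc_comp_smul _ Complex.exp A (by fun_prop) hn,
    CFC.complex_exp_eq_normedSpace_exp hn', unitaryGroup, mul_smul, Complex.coe_smul]

lemma continuous_unitaryGroup (A : H →L[ℂ] H) : Continuous (unitaryGroup A) :=
  letI : NormedAlgebra ℚ (H →L[ℂ] H) := .restrictScalars ℚ ℂ _
  NormedSpace.exp_continuous.comp (continuous_id.smul continuous_const)

lemma integrable_smul_unitaryGroup {A : H →L[ℂ] H} (hA : IsSelfAdjoint A) {h : ℝ → ℂ}
    (hh : Integrable h) : Integrable fun ξ => h ξ • unitaryGroup A (-2 * Real.pi * ξ) := by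
  refine hh.norm.mono' (hh.aestronglyMeasurable.smul
    ((continuous_unitaryGroup A).comp (by fun_prop)).aestronglyMeasurable) (.of_forall fun ξ => ?_)
  rw [norm_smul]
  refine mul_le_of_le_one_right (norm_nonneg _) ?_
  exact ContinuousLinearMap.opNorm_le_bound _ zero_le_one fun f => by
    simpa using norm_unitaryGroup_le hA _ f

/-- Fourier inversion for the functional calculus. -/
lemma funcCalc_fourier {A : H →L[ℂ] H} (hA : IsSelfAdjoint A) {h : ℝ → ℂ} (hh : Integrable h) :
    funcCalc (𝓕 h) A = ∫ ξ, h ξ • unitaryGroup A (-2 * Real.pi * ξ) := by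
  have hn : IsStarNormal A := hA.isStarNormal
  set E : ℝ → ℂ → ℂ := fun ξ z => Complex.exp ((-2 * Real.pi * ξ * z.re : ℝ) * Complex.I) with hE
  have hEc : Continuous (Function.uncurry E) := by
    simp only [hE, Function.uncurry_def]
    fun_prop
  have hEz : ∀ ξ, Continuous (E ξ) := fun ξ => hEc.comp (Continuous.prodMk_right ξ)
  have hEm : ∀ ξ, ContinuousOn (fun z => h ξ * E ξ z) (spectrum ℂ A) := fun ξ =>
    (continuous_const.mul (hEz ξ)).continuousOn
  -- The integral is taken in the continuous functions on the spectrum. Factoring out the merely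
  -- measurable `h` leaves a jointly continuous kernel, which settles measurability.
  have hmk : (fun ξ => ContinuousMap.mkD ((spectrum ℂ A).domRestrict fun z => h ξ * E ξ z) 0) =
      fun ξ => h ξ • ContinuousMap.mkD ((spectrum ℂ A).domRestrict (E ξ)) 0 := by
    funext ξ
    ext z
    rw [ContinuousMap.mkD_apply_of_continuousOn (hEm ξ),
      ContinuousMap.smul_apply, ContinuousMap.mkD_apply_of_continuousOn (hEz ξ).continuousOn,
      smul_eq_mul]
  have hint : Integrable fun ξ =>
      ContinuousMap.mkD ((spectrum ℂ A).domRestrict fun z => h ξ * E ξ z) 0 := by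
    refine ⟨?_, ContinuousMap.hasFiniteIntegral_mkD_restrict_of_bound _ _
      (.of_forall hEm) _ hh.norm.2
      (.of_forall fun ξ z _ => ?_)⟩
    · rw [hmk]
      exact hh.aestronglyMeasurable.smul
        (ContinuousMap.aeStronglyMeasurable_mkD_restrict_of_uncurry E 0 hEc.continuousOn)
    · rw [norm_mul, hE, Complex.norm_exp_ofReal_mul_I, mul_one]
  have h1 : funcCalc (𝓕 h) A = cfc (fun z : ℂ => ∫ ξ, h ξ * E ξ z) A := by
    rw [funcCalc]
    congr 1
    funext z
    rw [Real.fourier_real_eq_integral_exp_smul]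
    refine integral_congr_ae (.of_forall fun ξ => ?_)
    simp only [hE, smul_eq_mul]
    ring_nf
  rw [h1, cfc_integral' (fun ξ z => h ξ * E ξ z) A (.of_forall hEm) hint]
  refine integral_congr_ae (.of_forall fun ξ => ?_)
  change cfc (fun z => h ξ * E ξ z) A = _
  rw [cfc_const_mul _ _ _ (hEz ξ).continuousOn, hE, cfc_exp_eq_unitaryGroup hA]

lemma funcCalc_mul_self {A : H →L[ℂ] H} (hA : IsSelfAdjoint A) {F G : ℝ → ℂ} (hG : Continuous G)
    (h : ∀ l : ℝ, F l = G l * l) : funcCalc F A = funcCalc G A * A := by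
  have hn : IsStarNormal A := hA.isStarNormal
  have h1 : funcCalc F A = cfc (fun z : ℂ => G z.re * z) A := by
    refine cfc_congr fun z hz => ?_
    rw [h, ofReal_re_of_mem_spectrum hA hz]
  rw [h1, cfc_mul _ _ A (by fun_prop) (by fun_prop), cfc_id' ℂ A, funcCalc]

end FunctionalCalculus

/-! ### The multiplier bound in terms of a weighted `L¹` norm. -/

section Multiplier

open scoped FourierTransform

lemma IsNet.amalgam_smul {X : Type*} [MetricSpace X] [MeasurableSpace X] [BorelSpace X]
    {μ : Measure X} {τ p : ℝ} {S : Set X} {idx : X → S} (hS : IsNet τ S idx) (T : Finset S)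
    (c : ℂ) (g : Lp ℂ 2 μ) :
    hS.amalgam μ p T (c • g) = ‖c‖ ^ p * hS.amalgam μ p T g := by
  rw [IsNet.amalgam, IsNet.amalgam, Finset.mul_sum]
  refine Finset.sum_congr rfl fun i _ => ?_
  rw [map_smul, norm_smul, Real.mul_rpow (norm_nonneg _) (norm_nonneg _)]
  ring

/-- The `L^p` bound for `F(A) A` in terms of a weighted `L¹` norm of the Fourier transform. -/
lemma exists_opNorm_fourier_le {X : Type*} [MetricSpace X] [TopologicalSpace.SeparableSpace X]
    [Nonempty X] [MeasurableSpace X] [BorelSpace X] {μ : Measure X} {n a p D : ℝ} {k : ℕ}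
    (hn : 0 ≤ n) (hD : IsDoubling μ n D) (hka : (k : ℝ) < a) (hnk : n < 2 * k) (hp₁ : 1 ≤ p)
    (hp₂ : p < 2) (K : ℝ) :
    ∃ C : ℝ≥0, 0 < C ∧ ∀ τ : ℝ, 0 < τ → ∀ A : Lp ℂ 2 μ →L[ℂ] Lp ℂ 2 μ, IsSelfAdjoint A →
      PVE μ n a p τ K A → ∀ h : ℝ → ℂ, Integrable h →
      opNorm μ (ENNReal.ofReal p) (ENNReal.ofReal p) (fun f => (funcCalc (𝓕 h) A * A) f) ≤
        C * ∫⁻ ξ, ENNReal.ofReal ((1 + |ξ|) ^ (n * (1 / p - 1 / 2))) * ‖h ξ‖ₑ := by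
  have hp0 : 0 < p := by linarith
  have ha : 0 < a := lt_of_le_of_lt (by positivity) hka
  have : Fact (1 ≤ ENNReal.ofReal p) := ⟨by simpa using ENNReal.ofReal_le_ofReal hp₁⟩
  set α := n * (1 / p - 1 / 2) with hα
  have hα0 : 0 ≤ α :=
    mul_nonneg hn (sub_nonneg.2 (one_div_le_one_div_of_le hp0 hp₂.le))
  obtain ⟨C₁, hC₁, hin⟩ := exists_amalgam_apply_le X hn ha D p K
  obtain ⟨C₂, hC₂, hgr⟩ := exists_amalgam_unitaryGroup_le X hn hka hnk D p K
  set M : ℝ := C₂ * (2 * Real.pi) ^ α * C₁ with hM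
  have hM0 : 0 ≤ M := by positivity
  -- `M + 1` rather than `M` keeps the constant positive, so that an infinite weighted integral
  -- makes the right side `∞` and not `0 * ∞ = 0`.
  refine ⟨(M + 1).toNNReal, Real.toNNReal_pos.2 (by positivity), ?_⟩
  intro τ hτ A hA hPVE h hh
  obtain ⟨S, idx, hS⟩ := exists_isNet (X := X) hτ
  by_cases hfin : ∫⁻ ξ, ENNReal.ofReal ((1 + |ξ|) ^ α) * ‖h ξ‖ₑ = ∞
  · rw [hfin, ENNReal.mul_top]
    · exact le_top
    · exact ENNReal.coe_ne_zero.2 (Real.toNNReal_pos.2 (by positivity)).ne'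
  have hwm : AEStronglyMeasurable (fun ξ => (1 + |ξ|) ^ α * ‖h ξ‖) volume := by
    refine AEStronglyMeasurable.mul ?_ hh.aestronglyMeasurable.norm
    exact (Continuous.rpow_const (by fun_prop) fun ξ => Or.inr hα0).aestronglyMeasurable
  have hwe : ∀ ξ, ‖(1 + |ξ|) ^ α * ‖h ξ‖‖ₑ = ENNReal.ofReal ((1 + |ξ|) ^ α) * ‖h ξ‖ₑ := by
    intro ξ
    rw [enorm_mul, enorm_norm, Real.enorm_of_nonneg (by positivity)]
  have hwi : Integrable fun ξ => (1 + |ξ|) ^ α * ‖h ξ‖ := by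
    refine ⟨hwm, ?_⟩
    rw [HasFiniteIntegral]
    simp_rw [hwe]
    exact lt_top_iff_ne_top.2 hfin
  have hw : ENNReal.ofReal (∫ ξ, (1 + |ξ|) ^ α * ‖h ξ‖) =
      ∫⁻ ξ, ENNReal.ofReal ((1 + |ξ|) ^ α) * ‖h ξ‖ₑ := by
    rw [ofReal_integral_eq_lintegral_ofReal hwi (.of_forall fun ξ => by positivity)]
    refine lintegral_congr fun ξ => ?_
    rw [← hwe, Real.enorm_of_nonneg (by positivity)]
  rw [opNorm]
  refine iSup₂_le fun f hf => ENNReal.div_le_of_le_mul ?_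
  set q := (eLpNorm f (ENNReal.ofReal p) μ).toReal with hq
  have hq0 : 0 ≤ q := ENNReal.toReal_nonneg
  set I := ∫ ξ, (1 + |ξ|) ^ α * ‖h ξ‖ with hI
  have hI0 : 0 ≤ I := integral_nonneg fun ξ => by positivity
  have hint := integrable_smul_unitaryGroup hA hh
  have happ : (funcCalc (𝓕 h) A * A) f =
      ∫ ξ, h ξ • unitaryGroup A (-2 * Real.pi * ξ) (A f) := by
    rw [funcCalc_fourier hA hh]
    exact ((ContinuousLinearMap.apply ℂ (Lp ℂ 2 μ) (A f)).integral_comp_comm hint).symm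
  have hint' : Integrable fun ξ => h ξ • unitaryGroup A (-2 * Real.pi * ξ) (A f) :=
    hint.apply_continuousLinearMap (A f)
  have hpt : ∀ T ξ, hS.amalgam μ p T (h ξ • unitaryGroup A (-2 * Real.pi * ξ) (A f)) ≤
      (M * q * ((1 + |ξ|) ^ α * ‖h ξ‖)) ^ p := by
    intro T ξ
    have h1 := hgr hD hS hτ hA hp₁ hp₂ hPVE (-2 * Real.pi * ξ) (A f) (C₁ * q) (by positivity)
      (fun T => hin hD hS hτ hp₁ hp₂ hPVE f hf T) T
    have h2 : (1 + |(-2 * Real.pi * ξ)|) ^ α ≤ (2 * Real.pi) ^ α * (1 + |ξ|) ^ α := by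
      rw [← Real.mul_rpow (by positivity) (by positivity)]
      refine Real.rpow_le_rpow (by positivity) ?_ hα0
      rw [abs_mul, abs_mul, abs_neg, abs_of_pos Real.pi_pos, abs_of_pos (by norm_num : (0:ℝ) < 2)]
      nlinarith [Real.pi_gt_three]
    rw [hS.amalgam_smul]
    calc _ ≤ ‖h ξ‖ ^ p * (C₂ * (1 + |(-2 * Real.pi * ξ)|) ^ α * (C₁ * q)) ^ p := by gcongr
      _ = (‖h ξ‖ * (C₂ * (1 + |(-2 * Real.pi * ξ)|) ^ α * (C₁ * q))) ^ p := by
        rw [← Real.mul_rpow (by positivity) (by positivity)]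
      _ ≤ (‖h ξ‖ * (C₂ * ((2 * Real.pi) ^ α * (1 + |ξ|) ^ α) * (C₁ * q))) ^ p := by gcongr
      _ = _ := by rw [hM]; ring_nf
  have hmain := hS.eLpNorm_rpow_le hD hτ hp₁ hp₂ (g := (funcCalc (𝓕 h) A * A) f)
    (Q := (M * q * I) ^ p) (fun T => by
      rw [happ, hI, ← integral_const_mul]
      exact hS.amalgam_integral_le hp0 hint' (fun ξ => by positivity) (hwi.const_mul _) T (hpt T))
  rw [← ENNReal.ofReal_rpow_of_nonneg (by positivity) hp0.le, ENNReal.rpow_le_rpow_iff hp0]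
    at hmain
  refine hmain.trans ?_
  rw [← hw, ← ENNReal.ofReal_toReal hf.2.ne, ← hq, ← ENNReal.ofReal,
    ← ENNReal.ofReal_mul (by positivity), ← ENNReal.ofReal_mul (by positivity)]
  refine ENNReal.ofReal_le_ofReal ?_
  nlinarith [mul_nonneg hq0 hI0]

end Multiplier

end SpectralMultiplier

end

/-! ### The main theorem. -/

open SpectralMultiplier in
theorem theorem3p1 {X : Type*} [MetricSpace X] [TopologicalSpace.SeparableSpace X]
    [MeasurableSpace X] [BorelSpace X] (μ : Measure X)
    (n : ℝ) (hn : 0 < n) (hμ : IsHomogeneousType μ n)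
    (p : ℝ) (hp₁ : 1 ≤ p) (hp₂ : p < 2)
    (a : ℝ) (ha : (⌊n / 2⌋ : ℝ) + 1 < a)
    (s : ℝ) (hs : n * (1 / p - 1 / 2) + 1 / 2 < s)
    (K : ℝ) :
    ∃ C : ℝ≥0, 0 < C ∧
      ∀ (τ : ℝ), 0 < τ →
      ∀ (A : Lp ℂ 2 μ →L[ℂ] Lp ℂ 2 μ), IsSelfAdjoint A → PVE μ n a p τ K A →
      ∀ (F : ℝ →ᵇ ℂ), sobolevNorm s F < ∞ →
        opNorm μ (ENNReal.ofReal p) (ENNReal.ofReal p) (fun f => (funcCalc F A * A) f)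
            ≤ C * sobolevNorm s F ∧
        (A.IsPositive → Function.support F ⊆ Set.Icc (-1) 1 →
          opNorm μ (ENNReal.ofReal p) (ENNReal.ofReal p)
              (fun f => funcCalc (compNegLog F) A f)
            ≤ C * sobolevNorm s F) := by
  rcases eq_or_ne μ 0 with rfl | h0
  · exact ⟨1, one_pos, fun τ _ A _ _ F _ => by simp [opNorm]⟩
  have hX : Nonempty X := by
    by_contra hX
    rw [not_nonempty_iff] at hX
    exact h0 (Measure.eq_zero_of_isEmpty μ)
  obtain ⟨D, hD1, hD⟩ := hμ.exists_doubling
  have hdoub : IsDoubling μ n D :=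
    ⟨hD1, hμ.1, fun x r hr => hμ.measureReal_ball_pos h0 x hr, hD⟩
  have hfl : ((⌊n / 2⌋₊ : ℕ) : ℝ) = (⌊n / 2⌋ : ℝ) := natCast_floor_eq_intCast_floor (by positivity)
  have hka : ((⌊n / 2⌋₊ + 1 : ℕ) : ℝ) < a := by push_cast; rwa [hfl]
  -- The integer `⌊n/2⌋ + 1` lies strictly between `n/2` and `a`; it is the power used in the
  -- weights.
  have hnk : n < 2 * ((⌊n / 2⌋₊ + 1 : ℕ) : ℝ) := by
    have := Nat.lt_floor_add_one (n / 2)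
    push_cast
    linarith
  obtain ⟨Cm, hCm, hmain⟩ := exists_opNorm_fourier_le hn.le hdoub hka hnk hp₁ hp₂ K
  have hα0 : 0 ≤ n * (1 / p - 1 / 2) :=
    mul_nonneg hn.le (sub_nonneg.2 (one_div_le_one_div_of_le (by linarith) hp₂.le))
  obtain ⟨Cw, hw⟩ := lintegral_weight_le hs
  obtain ⟨Cl, hl⟩ := exists_fourier_eq_compNegLog hα0 hs
  set R : ℝ≥0 := ((2 : ℝ) ^ (s / 2)).toNNReal with hR
  have hR0 : 0 < R := Real.toNNReal_pos.2 (by positivity)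
  have hC : 0 < Cm * (Cw + Cl + 1) * R := by positivity
  refine ⟨Cm * (Cw + Cl + 1) * R, hC, fun τ hτ A hA hPVE F _ => ?_⟩
  -- Bounds for every representative `G` pass to the infimum; positivity of the constant allows
  -- dividing by it.
  have hred : ∀ Y : ℝ≥0∞, (∀ G : Lp ℂ 2 (volume : Measure ℝ),
      besselOp s (toDistribution F) = Lp.toTemperedDistribution G →
        Y ≤ (Cm * (Cw + Cl + 1) * R : ℝ≥0) * ‖G‖ₑ) →
      Y ≤ (Cm * (Cw + Cl + 1) * R : ℝ≥0) * sobolevNorm s F := by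
    intro Y hY
    rw [mul_comm, ← ENNReal.div_le_iff_le_mul (Or.inl (ENNReal.coe_ne_zero.2 hC.ne'))
      (Or.inl ENNReal.coe_ne_top)]
    refine le_iInf₂ fun G hG => ENNReal.div_le_of_le_mul ?_
    rw [mul_comm]
    exact hY G hG
  have hcomb : ∀ (c : ℝ≥0) (y N : ℝ≥0∞) (G : Lp ℂ 2 (volume : Measure ℝ)),
      N ≤ ENNReal.ofReal (2 ^ (s / 2)) * ‖G‖ₑ → y ≤ c * N → c ≤ Cw + Cl + 1 →
      Cm * y ≤ (Cm * (Cw + Cl + 1) * R : ℝ≥0) * ‖G‖ₑ := by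
    intro c y N G hN hy hc
    calc (Cm : ℝ≥0∞) * y ≤ Cm * ((Cw + Cl + 1 : ℝ≥0) * (R * ‖G‖ₑ)) := by
          gcongr
          refine hy.trans ?_
          gcongr
          exact hN
      _ = _ := by push_cast; ring
  refine ⟨hred _ fun G hG => ?_, fun _ hF => hred _ fun G hG => ?_⟩
  · obtain ⟨g, hgm, hgi, hFg, hgw⟩ := exists_fourier_eq (by linarith) F G hG
    have hFg' : (F : ℝ → ℂ) = FourierTransform.fourier g := funext hFg
    rw [hFg']
    refine (hmain τ hτ A hA hPVE g hgi).trans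
      (hcomb Cw _ _ G hgw (hw g hgm.aestronglyMeasurable) ?_)
    exact le_add_right (le_add_right le_rfl)
  · obtain ⟨g, hgm, hgi, hFg, hgw⟩ := exists_fourier_eq (by linarith) F G hG
    have hfin : weightedNorm s g < ∞ :=
      hgw.trans_lt (ENNReal.mul_lt_top ENNReal.ofReal_lt_top enorm_lt_top)
    obtain ⟨h, hhi, hh, hhw⟩ := hl F hF g hgi hfin hFg
    rw [funcCalc_mul_self hA (continuous_fourier_of_integrable hhi) hh]
    refine (hmain τ hτ A hA hPVE h hhi).trans (hcomb Cl _ _ G hgw hhw ?_)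
    exact le_add_right (le_add_left le_rfl)
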